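/- Let $d\ge 2$, let $(p,x)\mapsto px$ be a nondegenerate symmetric bilinear form ("inner product", of any signature) on $\mathbb R^d$, and let $U$ be a strongly continuous unitary representation of the additive group $\mathbb R^d$ on a separable complex Hilbert space $\mathcal H$, with spectral resolution $E$, i.e. $E$ is the projection-valued Borel measure on $\mathbb R^d$ with $U(x)=\int e^{ipx}\,dE(p)$ for all $x\in\mathbb R^d$. Let $\operatorname{sp}U$ be the support of $E$, $P=\int p\,dE(p)$ the generators, $|P|^2=\sum_j P_j^2$, $\mathcal D\subset\mathcal H$ the subspace of vectors $\psi$ for which $x\mapsto U(x)\psi$ is smooth, and $\alpha_x(F)=U(x)FU(x)^{-1}$. Let $\mathfrak F$ be the set of linear operators $F$ whose domain contains $\mathcal D$ and for which there is $n\in\mathbb N$ such that $x\mapsto(1+|P|^2)^{-n}\alpha_x(F)(1+|P|^2)^{-n}$ (bounded operators, determined by their values on $\mathcal D$) is infinitely often differentiable in norm. For a linear map $Q$ on $\mathbb R^d$ that is skew-symmetric, $q\,Qp=-p\,Qq$, and $F\in\mathfrak F$, define the warped convolution $F_Q$ on the vectors $\psi\in\mathcal D$ by $$F_Q\psi=\int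 dE(p)\,\alpha_{Qp}(F)\psi=\lim\sum_j E(\Delta_j)\,\alpha_{Qp_j}(F)\psi ,$$ the limit (where it exists) being taken over countable Borel partitions $(\Delta_j)$ of $\mathbb R^d$ with tags $p_j\in\Delta_j$ as the mesh $\sup_j\operatorname{diam}\Delta_j$ tends to $0$. Let $Q$ be skew-symmetric and let $F,G\in\mathfrak F$ be such that, on $\mathcal D$, $\alpha_{Qp}(F)\,\alpha_{-Qq}(G)=\alpha_{-Qq}(G)\,\alpha_{Qp}(F)$ for all $p,q\in\operatorname{sp}U$. Then $F_Q$ and $G_{-Q}$ are defined on all of $\mathcal D$, the products $F_Q\,G_{-Q}$ and $G_{-Q}\,F_Q$ are defined on $\mathcal D$, and $F_Q\,G_{-Q}=G_{-Q}\,F_Q$ there. -/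

import Mathlib

open scoped ContDiff

noncomputable section

namespace Warped

/-- A strongly continuous unitary representation of the additive group `ℝ^d` on `H`. -/
structure UnitaryRep (d : ℕ) (H : Type*) [NormedAddCommGroup H] [InnerProductSpace ℂ H] where
  /-- the unitary operator assigned to a translation -/
  toFun : EuclideanSpace ℝ (Fin d) → (H ≃ₗᵢ[ℂ] H)
  map_add' : ∀ x y, toFun (x + y) = toFun x * toFun y
  continuous' : ∀ ψ : H, Continuous fun x => toFun x ψ

instance {d : ℕ} {H : Type*} [NormedAddCommGroup H] [InnerProductSpace ℂ H] :
    CoeFun (UnitaryRep d H) fun _ => EuclideanSpace ℝ (Fin d) → (H ≃ₗᵢ[ℂ] H) :=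
  ⟨UnitaryRep.toFun⟩

/-- A projection-valued (spectral) measure on the Borel sets of `ℝ^d`, with values in the
orthogonal projections of `H`. -/
structure SpectralMeasure (d : ℕ) (H : Type*) [NormedAddCommGroup H] [InnerProductSpace ℂ H]
    [CompleteSpace H] where
  /-- the projection assigned to a (Borel) set -/
  proj : Set (EuclideanSpace ℝ (Fin d)) → (H →L[ℂ] H)
  isStarProjection' : ∀ S, MeasurableSet S → IsStarProjection (proj S)
  univ' : proj Set.univ = 1
  inter' : ∀ S T, MeasurableSet S → MeasurableSet T → proj (S ∩ T) = proj S * proj T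
  iUnion' : ∀ S : ℕ → Set (EuclideanSpace ℝ (Fin d)), (∀ j, MeasurableSet (S j)) →
    Pairwise (fun i j => Disjoint (S i) (S j)) →
    ∀ ψ : H, HasSum (fun j => proj (S j) ψ) (proj (⋃ j, S j) ψ)

/-- `Δ` is a countable Borel partition of `ℝ^d` (empty pieces are allowed) whose pieces have
diameter at most `δ`, and each nonempty piece `Δ j` is tagged with one of its points `t j`. -/
structure IsTaggedPartition {d : ℕ} (δ : ℝ) (Δ : ℕ → Set (EuclideanSpace ℝ (Fin d)))
    (t : ℕ → EuclideanSpace ℝ (Fin d)) : Prop where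
  measurable : ∀ j, MeasurableSet (Δ j)
  disjoint : Pairwise fun i j => Disjoint (Δ i) (Δ j)
  cover : ⋃ j, Δ j = Set.univ
  mesh : ∀ j, ∀ p ∈ Δ j, ∀ q ∈ Δ j, dist p q ≤ δ
  tag : ∀ j, (Δ j).Nonempty → t j ∈ Δ j

/-- Tagged partitions of arbitrarily small mesh exist. -/
theorem exists_isTaggedPartition (d : ℕ) {δ : ℝ} (hδ : 0 < δ) :
    ∃ (Δ : ℕ → Set (EuclideanSpace ℝ (Fin d))) (t : ℕ → EuclideanSpace ℝ (Fin d)),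
      IsTaggedPartition δ Δ t := by
  classical
  let f : ℕ → Set (EuclideanSpace ℝ (Fin d)) := fun n =>
    Metric.ball (TopologicalSpace.denseSeq (EuclideanSpace ℝ (Fin d)) n) (δ / 2)
  have hf : ∀ n, MeasurableSet (f n) := fun n => Metric.isOpen_ball.measurableSet
  refine ⟨disjointed f, fun n => if h : (disjointed f n).Nonempty then h.some else 0,
    fun n => MeasurableSet.disjointed hf n, disjoint_disjointed f, ?_, ?_, ?_⟩
  · rw [iUnion_disjointed]
    refine Set.eq_univ_of_forall fun x => ?_
    obtain ⟨n, hn⟩ := (TopologicalSpace.denseRange_denseSeq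
      (EuclideanSpace ℝ (Fin d))).exists_dist_lt x (half_pos hδ)
    exact Set.mem_iUnion.2 ⟨n, hn⟩
  · intro j p hp q hq
    have h1 : dist p _ < δ / 2 := disjointed_subset f j hp
    have h2 : dist q _ < δ / 2 := disjointed_subset f j hq
    have := dist_triangle_right p q
      (TopologicalSpace.denseSeq (EuclideanSpace ℝ (Fin d)) j)
    linarith
  · intro j hj
    simp only [dif_pos hj]
    exact hj.some_mem

section

variable {d : ℕ} {H : Type*} [NormedAddCommGroup H] [InnerProductSpace ℂ H] [CompleteSpace H]

/-- `E.HasIntegral g v` says `v = ∫ dE(p) g(p)` for a vector-valued function `g`: the Riemann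
sums `∑ j, E (Δ j) g (t j)` converge and tend to `v` as the mesh of the tagged partition tends
to zero. -/
def SpectralMeasure.HasIntegral (E : SpectralMeasure d H) (g : EuclideanSpace ℝ (Fin d) → H)
    (v : H) : Prop :=
  ∀ ε > 0, ∃ δ > 0, ∀ Δ t, IsTaggedPartition δ Δ t →
    ∃ s, HasSum (fun j => E.proj (Δ j) (g (t j))) s ∧ dist s v ≤ ε

theorem SpectralMeasure.HasIntegral.add {E : SpectralMeasure d H}
    {g g' : EuclideanSpace ℝ (Fin d) → H} {v v' : H} (h : E.HasIntegral g v)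
    (h' : E.HasIntegral g' v') : E.HasIntegral (fun p => g p + g' p) (v + v') := by
  intro ε hε
  obtain ⟨δ, hδ, h⟩ := h (ε / 2) (half_pos hε)
  obtain ⟨δ', hδ', h'⟩ := h' (ε / 2) (half_pos hε)
  refine ⟨min δ δ', lt_min hδ hδ', fun Δ t ht => ?_⟩
  obtain ⟨s, hs, hsv⟩ := h Δ t ⟨ht.1, ht.2, ht.3,
    fun j p hp q hq => (ht.4 j p hp q hq).trans (min_le_left _ _), ht.5⟩
  obtain ⟨s', hs', hsv'⟩ := h' Δ t ⟨ht.1, ht.2, ht.3,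
    fun j p hp q hq => (ht.4 j p hp q hq).trans (min_le_right _ _), ht.5⟩
  refine ⟨s + s', by simpa using hs.add hs', ?_⟩
  have := dist_add_add_le s s' v v'
  linarith

theorem SpectralMeasure.HasIntegral.smul {E : SpectralMeasure d H}
    {g : EuclideanSpace ℝ (Fin d) → H} {v : H} (c : ℂ) (h : E.HasIntegral g v) :
    E.HasIntegral (fun p => c • g p) (c • v) := by
  intro ε hε
  have hc : 0 < ‖c‖ + 1 := by positivity
  obtain ⟨δ, hδ, h⟩ := h (ε / (‖c‖ + 1)) (div_pos hε hc)
  refine ⟨δ, hδ, fun Δ t ht => ?_⟩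
  obtain ⟨s, hs, hsv⟩ := h Δ t ht
  refine ⟨c • s, by simpa using hs.const_smul c, ?_⟩
  rw [dist_smul₀]
  rw [le_div_iff₀ hc] at hsv
  nlinarith [dist_nonneg (x := s) (y := v), norm_nonneg c]

theorem SpectralMeasure.HasIntegral.unique {E : SpectralMeasure d H}
    {g : EuclideanSpace ℝ (Fin d) → H} {v v' : H} (h : E.HasIntegral g v)
    (h' : E.HasIntegral g v') : v = v' := by
  refine dist_le_zero.1 (le_of_forall_pos_le_add fun ε hε => ?_)
  obtain ⟨δ, hδ, h⟩ := h (ε / 2) (half_pos hε)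
  obtain ⟨δ', hδ', h'⟩ := h' (ε / 2) (half_pos hε)
  obtain ⟨Δ, t, ht⟩ := exists_isTaggedPartition d (lt_min hδ hδ')
  obtain ⟨s, hs, hsv⟩ := h Δ t ⟨ht.1, ht.2, ht.3,
    fun j p hp q hq => (ht.4 j p hp q hq).trans (min_le_left _ _), ht.5⟩
  obtain ⟨s', hs', hsv'⟩ := h' Δ t ⟨ht.1, ht.2, ht.3,
    fun j p hp q hq => (ht.4 j p hp q hq).trans (min_le_right _ _), ht.5⟩
  obtain rfl := hs.unique hs'
  have := dist_triangle_left v v' s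
  linarith

/-- `E` is the spectral resolution of `U` with respect to the inner product `B` on `ℝ^d`:
`U(x) = ∫ e^{i B(p, x)} dE(p)` for all `x`. -/
def IsSpectralResolution (B : LinearMap.BilinForm ℝ (EuclideanSpace ℝ (Fin d)))
    (U : UnitaryRep d H) (E : SpectralMeasure d H) : Prop :=
  ∀ x ψ, E.HasIntegral (fun p => Complex.exp (Complex.I * (B p x : ℂ)) • ψ) (U x ψ)

/-- The support of the spectral measure, i.e. the joint spectrum of the generators
`P = ∫ p dE(p)`. -/
def SpectralMeasure.support (E : SpectralMeasure d H) : Set (EuclideanSpace ℝ (Fin d)) :=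
  {p | ∀ S, IsOpen S → p ∈ S → E.proj S ≠ 0}

/-- The subspace `D` of vectors which transform smoothly under `U`. -/
def smoothVectors (U : UnitaryRep d H) : Submodule ℂ H where
  carrier := {ψ | ContDiff ℝ ∞ fun x => U x ψ}
  zero_mem' := by simpa using contDiff_const
  add_mem' := by
    intro a b ha hb
    have h := ContDiff.add (show ContDiff ℝ ∞ fun x => U x a from ha)
      (show ContDiff ℝ ∞ fun x => U x b from hb)
    simpa using h
  smul_mem' := by
    intro c a ha
    have h := ContDiff.const_smul c (show ContDiff ℝ ∞ fun x => U x a from ha)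
    simpa using h

/-- The adjoint action `α_x(F) = U(x) F U(x)⁻¹`, with domain `U(x) dom F`. -/
def adjointAction (U : UnitaryRep d H) (x : EuclideanSpace ℝ (Fin d)) (F : H →ₗ.[ℂ] H) :
    H →ₗ.[ℂ] H where
  domain := F.domain.comap ((U x).symm.toLinearEquiv : H →ₗ[ℂ] H)
  toFun := ((U x).toLinearEquiv : H →ₗ[ℂ] H) ∘ₗ F.toFun ∘ₗ
    (((U x).symm.toLinearEquiv : H →ₗ[ℂ] H).restrict fun _ h => h)

/-- The set `𝔉` of operators `F` with `D ⊆ dom F` such that, for some `n`, the operator-valued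
function `x ↦ (1 + |P|²)⁻ⁿ α_x(F) (1 + |P|²)⁻ⁿ` is smooth in norm. Here `T x` is the bounded
operator given on the dense subspace `D` by that product: if `a = (1 + |P|²)⁻ⁿ ψ` and
`b = α_x(F) a`, then `T x ψ = (1 + |P|²)⁻ⁿ b`. -/
def smoothOperators (U : UnitaryRep d H) (E : SpectralMeasure d H) : Set (H →ₗ.[ℂ] H) :=
  {F | smoothVectors U ≤ F.domain ∧
    ∃ (n : ℕ) (T : EuclideanSpace ℝ (Fin d) → (H →L[ℂ] H)), ContDiff ℝ ∞ T ∧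
      ∀ x, ∀ ψ ∈ smoothVectors U, ∃ a b,
        E.HasIntegral (fun p => ((1 + ‖p‖ ^ 2) ^ n : ℝ)⁻¹ • ψ) a ∧
        (a, b) ∈ (adjointAction U x F).graph ∧
        E.HasIntegral (fun p => ((1 + ‖p‖ ^ 2) ^ n : ℝ)⁻¹ • b) (T x ψ)}

/-- The graph of `F_Q`: all pairs `(ψ, v)` with `ψ ∈ D` and `v = ∫ dE(p) α_{Qp}(F) ψ`. -/
def warpedGraph (U : UnitaryRep d H) (E : SpectralMeasure d H)
    (Q : EuclideanSpace ℝ (Fin d) →ₗ[ℝ] EuclideanSpace ℝ (Fin d)) (F : H →ₗ.[ℂ] H) :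
    Submodule ℂ (H × H) where
  carrier := {w | w.1 ∈ smoothVectors U ∧ ∃ g : EuclideanSpace ℝ (Fin d) → H,
    (∀ p, (w.1, g p) ∈ (adjointAction U (Q p) F).graph) ∧ E.HasIntegral g w.2}
  zero_mem' := by
    refine ⟨zero_mem _, fun _ => 0, fun p => zero_mem _, fun ε hε => ⟨1, one_pos, ?_⟩⟩
    intro Δ t _
    exact ⟨0, by simp, by simpa using hε.le⟩
  add_mem' := by
    rintro a b ⟨ha, g, hg, hi⟩ ⟨hb, g', hg', hi'⟩
    exact ⟨add_mem ha hb, fun p => g p + g' p, fun p => add_mem (hg p) (hg' p), hi.add hi'⟩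
  smul_mem' := by
    rintro c a ⟨ha, g, hg, hi⟩
    exact ⟨Submodule.smul_mem _ c ha, fun p => c • g p,
      fun p => Submodule.smul_mem _ c (hg p), hi.smul c⟩

/-- The warped convolution `F_Q = ∫ dE(p) α_{Qp}(F)`; its domain consists of the vectors in `D`
for which the integral exists. -/
def warpedConvolution (U : UnitaryRep d H) (E : SpectralMeasure d H)
    (Q : EuclideanSpace ℝ (Fin d) →ₗ[ℝ] EuclideanSpace ℝ (Fin d)) (F : H →ₗ.[ℂ] H) :
    H →ₗ.[ℂ] H :=
  (warpedGraph U E Q F).toLinearPMap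

/-- The integral has at most one value, so the graph of `F_Q` is the intended one. -/
theorem warpedConvolution_graph (U : UnitaryRep d H) (E : SpectralMeasure d H)
    (Q : EuclideanSpace ℝ (Fin d) →ₗ[ℝ] EuclideanSpace ℝ (Fin d)) (F : H →ₗ.[ℂ] H) :
    (warpedConvolution U E Q F).graph = warpedGraph U E Q F := by
  refine Submodule.toLinearPMap_graph_eq _ ?_
  rintro ⟨x, v⟩ ⟨_, g, hg, hi⟩ hx
  obtain rfl : x = 0 := hx
  have hg0 : g = fun _ => 0 := funext fun p =>
    LinearPMap.graph_fst_eq_zero_snd _ (hg p) rfl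
  subst hg0
  refine hi.unique fun ε hε => ⟨1, one_pos, fun Δ t _ => ?_⟩
  exact ⟨0, by simp, by simpa using hε.le⟩

end

/-- `A B = B A` on the subspace `D`: for each `ψ ∈ D` the vectors `A (B ψ)` and `B (A ψ)` are
both defined, and they are equal (to `η`). -/
def CommuteOn {H : Type*} [NormedAddCommGroup H] [InnerProductSpace ℂ H] (D : Submodule ℂ H)
    (A B : H →ₗ.[ℂ] H) : Prop :=
  ∀ ψ ∈ D, ∃ η, (∃ φ, (ψ, φ) ∈ B.graph ∧ (φ, η) ∈ A.graph) ∧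
    ∃ χ, (ψ, χ) ∈ A.graph ∧ (χ, η) ∈ B.graph

end Warped

end

noncomputable section

namespace Warped

/-! ### Bounded Borel functional calculus of a projection-valued measure. -/

section FunctionalCalculus

open MeasureTheory Filter Topology

/-! Put σ(p, q) = B(p, Qq), an antisymmetric form, so that exp(iσ(P, t)) = U(Qt). Think of an
operator as a kernel F(p, q) in the spectral representation of P. Then α_{Qt}(F) has kernel
e^{iσ(p,t)} F(p, q) e^{-iσ(q,t)}, and putting t = p shows that F_Q has kernel e^{iσ(p,q)} F(p, q),
because σ(p, p) = 0. Warping is a Schur multiplication, which is made rigorous here by double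
operator integrals.

Momentum space is cut into unit cubes with spectral projections `block n`. A vector is smooth iff
its components decay faster than every power of `wt n` (`mem_smoothVectors_iff`). An operator in 𝔉
acts on such vectors through a matrix of bounded operators that decays rapidly in m - n, up to a
fixed power of `wt n` (`exists_rapidMat`). Between two cubes the Schur multiplier is the exponential
of a bounded generator acting on bounded operators. Its norm there has a bound independent of the
cubes: moving both variables to the corners of their cubes only splits off unitary left and right
factors. Replacing p by a tag within δ of it costs O(δ) times a power of the weight
(`exists_warpMap_bounds`). Rapid decay absorbs such losses, so the Riemann sums converge to the
operator with matrix `warpMat` (`hasIntegral_warpMat`).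

For the commutation, approximate F_Q G_{-Q} by tagging the outer variable of each factor: the left
one of F and the right one of G. Between pieces with tags s and t one then sees F U(-Q(s+t)) G. For
s, t in the spectrum the hypothesis, rearranged, says F U(-Q(s+t)) G = U(-Q(s+t)) [G U(Q(s+t)) F]
U(-Q(s+t)), and the bracket is what the same tagging produces for G_{-Q} F_Q. The outer unitaries
form the Schur multiplier e^{-iσ(p+q, τ(p)+τ(q))}, where τ sends a point to its tag. As the mesh
shrinks it tends to e^{-iσ(p+q, p+q)} = 1 (`tendsto_twistMap`), so both products have the same
matrix (`tsum_warpMat_mul_warpMat`). Tags outside the spectrum are needed only on null pieces. -/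

theorem norm_sum_sq_of_pairwise_inner_eq_zero {H : Type*} [NormedAddCommGroup H]
    [InnerProductSpace ℂ H] {β : Type*} (s : Finset β) (v : β → H)
    (h : ∀ i ∈ s, ∀ j ∈ s, i ≠ j → inner ℂ (v i) (v j) = 0) :
    ‖∑ i ∈ s, v i‖ ^ 2 = ∑ i ∈ s, ‖v i‖ ^ 2 := by
  classical
  induction s using Finset.induction_on with
  | empty => simp
  | insert a s ha ih =>
    rw [Finset.sum_insert ha, Finset.sum_insert ha,
      ← ih fun i hi j hj => h i (Finset.mem_insert_of_mem hi) j (Finset.mem_insert_of_mem hj),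
      sq, sq, sq]
    refine norm_add_sq_eq_norm_sq_add_norm_sq_of_inner_eq_zero _ _ (𝕜 := ℂ) ?_
    rw [inner_sum]
    refine Finset.sum_eq_zero fun i hi => h a (Finset.mem_insert_self _ _) i
      (Finset.mem_insert_of_mem hi) ?_
    rintro rfl
    exact ha hi

theorem norm_mul_sub_mul_le {R : Type*} [NormedRing R] {a b a' b' : R} {C C' η : ℝ}
    (ha : ‖a‖ ≤ C) (hb : ‖b‖ ≤ C') (haa : ‖a - a'‖ ≤ η) (hbb : ‖b - b'‖ ≤ η) (hη1 : η ≤ 1) :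
    ‖a * b - a' * b'‖ ≤ η * (C + C' + 1) := by
  have e : a * b - a' * b' = a * (b - b') + (a - a') * b - (a - a') * (b - b') := by noncomm_ring
  have hη : 0 ≤ η := (norm_nonneg _).trans haa
  have hC : 0 ≤ C := (norm_nonneg _).trans ha
  rw [e]
  have h1 : ‖a * (b - b')‖ ≤ C * η := (norm_mul_le _ _).trans (by gcongr)
  have h2 : ‖(a - a') * b‖ ≤ η * C' := (norm_mul_le _ _).trans (by gcongr)
  have h3 : ‖(a - a') * (b - b')‖ ≤ 1 * η :=
    (norm_mul_le _ _).trans (by gcongr; exact haa.trans hη1)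
  have := norm_sub_le (a * (b - b') + (a - a') * b) ((a - a') * (b - b'))
  have := norm_add_le (a * (b - b')) ((a - a') * b)
  nlinarith

variable {d : ℕ} {H : Type*} [NormedAddCommGroup H] [InnerProductSpace ℂ H] [CompleteSpace H]

namespace SpectralMeasure

variable (E : SpectralMeasure d H)

theorem proj_empty : E.proj ∅ = 0 := by
  ext ψ
  have h := E.iUnion' (fun _ => ∅) (fun _ => MeasurableSet.empty)
    (fun _ _ _ => Set.disjoint_empty _) ψ
  have := h.summable.tendsto_atTop_zero
  simpa using tendsto_nhds_unique tendsto_const_nhds this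

theorem proj_mul_self {S : Set (EuclideanSpace ℝ (Fin d))} (hS : MeasurableSet S) :
    E.proj S * E.proj S = E.proj S := by
  rw [← E.inter' S S hS hS, Set.inter_self]

theorem proj_comm {S T : Set (EuclideanSpace ℝ (Fin d))} (hS : MeasurableSet S)
    (hT : MeasurableSet T) : Commute (E.proj S) (E.proj T) := by
  rw [Commute, SemiconjBy, ← E.inter' S T hS hT, ← E.inter' T S hT hS, Set.inter_comm]

theorem proj_mul_of_disjoint {S T : Set (EuclideanSpace ℝ (Fin d))} (hS : MeasurableSet S)
    (hT : MeasurableSet T) (h : Disjoint S T) : E.proj S * E.proj T = 0 := by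
  rw [← E.inter' S T hS hT, h.inter_eq, E.proj_empty]

theorem proj_mul_of_subset {S T : Set (EuclideanSpace ℝ (Fin d))} (hS : MeasurableSet S)
    (hT : MeasurableSet T) (h : S ⊆ T) : E.proj S * E.proj T = E.proj S := by
  rw [← E.inter' S T hS hT, Set.inter_eq_left.2 h]

theorem norm_proj_le {S : Set (EuclideanSpace ℝ (Fin d))} (hS : MeasurableSet S) :
    ‖E.proj S‖ ≤ 1 :=
  (E.isStarProjection' S hS).norm_le

theorem norm_proj_apply_le {S : Set (EuclideanSpace ℝ (Fin d))} (hS : MeasurableSet S) (ψ : H) :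
    ‖E.proj S ψ‖ ≤ ‖ψ‖ := by
  simpa using (E.proj S).le_of_opNorm_le (E.norm_proj_le hS) ψ

theorem inner_proj_of_disjoint {S T : Set (EuclideanSpace ℝ (Fin d))} (hS : MeasurableSet S)
    (hT : MeasurableSet T) (h : Disjoint S T) (φ ψ : H) :
    inner ℂ (E.proj S φ) (E.proj T ψ) = 0 := by
  have hs : ContinuousLinearMap.adjoint (E.proj S) = E.proj S :=
    (E.isStarProjection' S hS).isSelfAdjoint
  rw [← hs, ContinuousLinearMap.adjoint_inner_left, ← mul_apply_eq_comp,
    E.proj_mul_of_disjoint hS hT h]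
  simp

/-- The vector measure `S ↦ E(S) ψ`. -/
def vectorMeasure (ψ : H) : VectorMeasure (EuclideanSpace ℝ (Fin d)) H := by
  classical
  exact
  { measureOf' := fun S => if MeasurableSet S then E.proj S ψ else 0
    empty' := by simp [E.proj_empty]
    not_measurable' := fun S hS => if_neg hS
    m_iUnion' := fun f hf hd => by
      simpa [hf, MeasurableSet.iUnion hf] using E.iUnion' f hf hd ψ }

theorem vectorMeasure_apply {S : Set (EuclideanSpace ℝ (Fin d))} (hS : MeasurableSet S) (ψ : H) :
    E.vectorMeasure ψ S = E.proj S ψ :=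
  if_pos hS

theorem hasSum_proj_iUnion {β : Type*} [Countable β] {S : β → Set (EuclideanSpace ℝ (Fin d))}
    (hS : ∀ b, MeasurableSet (S b)) (hd : Pairwise fun i j => Disjoint (S i) (S j)) (ψ : H) :
    HasSum (fun b => E.proj (S b) ψ) (E.proj (⋃ b, S b) ψ) := by
  have := (E.vectorMeasure ψ).hasSum_of_disjoint_iUnion hS hd
  simpa only [E.vectorMeasure_apply (hS _), E.vectorMeasure_apply (MeasurableSet.iUnion hS)]
    using this

theorem hasSum_proj {β : Type*} [Countable β] {S : β → Set (EuclideanSpace ℝ (Fin d))}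
    (hS : ∀ b, MeasurableSet (S b)) (hd : Pairwise fun i j => Disjoint (S i) (S j))
    (hU : ⋃ b, S b = Set.univ) (ψ : H) : HasSum (fun b => E.proj (S b) ψ) ψ := by
  have := E.hasSum_proj_iUnion hS hd ψ
  rwa [hU, E.univ', one_apply_eq_self] at this

theorem eq_of_proj_eq {β : Type*} [Countable β] {S : β → Set (EuclideanSpace ℝ (Fin d))}
    (hS : ∀ b, MeasurableSet (S b)) (hd : Pairwise fun i j => Disjoint (S i) (S j))
    (hU : ⋃ b, S b = Set.univ) {φ ψ : H} (h : ∀ b, E.proj (S b) φ = E.proj (S b) ψ) : φ = ψ := by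
  have h1 := E.hasSum_proj hS hd hU φ
  simp only [h] at h1
  exact h1.unique (E.hasSum_proj hS hd hU ψ)

theorem eq_of_proj_mul_eq {β : Type*} [Countable β] {S : β → Set (EuclideanSpace ℝ (Fin d))}
    (hS : ∀ b, MeasurableSet (S b)) (hd : Pairwise fun i j => Disjoint (S i) (S j))
    (hU : ⋃ b, S b = Set.univ) {A A' : H →L[ℂ] H}
    (h : ∀ b, E.proj (S b) * A = E.proj (S b) * A') : A = A' := by
  ext ψ
  exact E.eq_of_proj_eq hS hd hU fun b => congr($(h b) ψ)

theorem eq_of_mul_proj_eq {β : Type*} [Countable β] {S : β → Set (EuclideanSpace ℝ (Fin d))}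
    (hS : ∀ b, MeasurableSet (S b)) (hd : Pairwise fun i j => Disjoint (S i) (S j))
    (hU : ⋃ b, S b = Set.univ) {A A' : H →L[ℂ] H}
    (h : ∀ b, A * E.proj (S b) = A' * E.proj (S b)) : A = A' := by
  ext ψ
  have h1 := A.hasSum (E.hasSum_proj hS hd hU ψ)
  have h2 := A'.hasSum (E.hasSum_proj hS hd hU ψ)
  have h3 : (fun b => A (E.proj (S b) ψ)) = fun b => A' (E.proj (S b) ψ) :=
    funext fun b => congr($(h b) ψ)
  rw [h3] at h1
  exact h1.unique h2

/-- The functional calculus on simple functions. -/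
def simpleCalc (s : SimpleFunc (EuclideanSpace ℝ (Fin d)) ℂ) : H →L[ℂ] H :=
  ∑ c ∈ s.range, c • E.proj (s ⁻¹' {c})

theorem simpleCalc_mul_proj (s : SimpleFunc (EuclideanSpace ℝ (Fin d)) ℂ)
    {S : Set (EuclideanSpace ℝ (Fin d))} (hS : MeasurableSet S) {c : ℂ} (h : ∀ p ∈ S, s p = c) :
    E.simpleCalc s * E.proj S = c • E.proj S := by
  classical
  rcases S.eq_empty_or_nonempty with rfl | ⟨p₀, hp₀⟩
  · simp [E.proj_empty]
  have hc : c ∈ s.range := by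
    rw [← h p₀ hp₀]
    exact s.mem_range_self p₀
  rw [simpleCalc, Finset.sum_mul, Finset.sum_eq_single_of_mem c hc]
  · rw [smul_mul_assoc, ← E.inter' _ _ (s.measurableSet_fiber c) hS, Set.inter_eq_right.2]
    exact fun p hp => h p hp
  · intro c' _ hcc
    rw [smul_mul_assoc, E.proj_mul_of_disjoint (s.measurableSet_fiber c') hS, smul_zero]
    refine Set.disjoint_left.2 fun p hp hp' => hcc ?_
    rw [← h p hp']
    exact hp.symm

/-- Algebraic identities for simple functions can be checked on the level sets of a common
refinement such as `s.pair t`, where every function involved is constant. -/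
theorem eq_of_mul_proj_fiber_eq {β : Type*} (s : SimpleFunc (EuclideanSpace ℝ (Fin d)) β)
    {A A' : H →L[ℂ] H} (h : ∀ c, A * E.proj (s ⁻¹' {c}) = A' * E.proj (s ⁻¹' {c})) : A = A' := by
  have : Countable (Set.range s) := s.finite_range.to_subtype.to_countable
  refine E.eq_of_mul_proj_eq (S := fun c : Set.range s => s ⁻¹' {(c : β)})
    (fun c => s.measurableSet_fiber c) ?_ ?_ fun c => h c
  · intro i j hij
    refine Set.disjoint_left.2 fun p hp hp' => hij (Subtype.ext ?_)
    exact (show s p = i from hp).symm.trans hp'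
  · exact Set.eq_univ_of_forall fun p => Set.mem_iUnion.2 ⟨⟨s p, p, rfl⟩, rfl⟩

theorem simpleCalc_add (s t : SimpleFunc (EuclideanSpace ℝ (Fin d)) ℂ) :
    E.simpleCalc (s + t) = E.simpleCalc s + E.simpleCalc t := by
  refine E.eq_of_mul_proj_fiber_eq (s.pair t) fun c => ?_
  have hm := (s.pair t).measurableSet_fiber c
  have h : ∀ p ∈ (s.pair t) ⁻¹' {c}, s p = c.1 ∧ t p = c.2 := fun p hp =>
    ⟨congrArg Prod.fst hp, congrArg Prod.snd hp⟩
  rw [add_mul, E.simpleCalc_mul_proj s hm fun p hp => (h p hp).1,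
    E.simpleCalc_mul_proj t hm fun p hp => (h p hp).2,
    E.simpleCalc_mul_proj (s + t) (c := c.1 + c.2) hm fun p hp => by
      rw [SimpleFunc.add_apply, (h p hp).1, (h p hp).2], add_smul]

theorem simpleCalc_mul (s t : SimpleFunc (EuclideanSpace ℝ (Fin d)) ℂ) :
    E.simpleCalc (s * t) = E.simpleCalc s * E.simpleCalc t := by
  refine E.eq_of_mul_proj_fiber_eq (s.pair t) fun c => ?_
  have hm := (s.pair t).measurableSet_fiber c
  have h : ∀ p ∈ (s.pair t) ⁻¹' {c}, s p = c.1 ∧ t p = c.2 := fun p hp =>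
    ⟨congrArg Prod.fst hp, congrArg Prod.snd hp⟩
  rw [mul_assoc, E.simpleCalc_mul_proj t hm fun p hp => (h p hp).2, mul_smul_comm,
    E.simpleCalc_mul_proj s hm fun p hp => (h p hp).1,
    E.simpleCalc_mul_proj (s * t) (c := c.1 * c.2) hm fun p hp => by
      rw [SimpleFunc.mul_apply, (h p hp).1, (h p hp).2], smul_smul, mul_comm]

theorem simpleCalc_const (c : ℂ) :
    E.simpleCalc (SimpleFunc.const _ c) = c • 1 := by
  have := E.simpleCalc_mul_proj (SimpleFunc.const _ c) MeasurableSet.univ (c := c)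
    fun p _ => rfl
  rwa [E.univ', mul_one] at this

/-- Components belonging to different values are orthogonal, so Pythagoras gives the sup-norm bound
with no loss from the number of values. This is what permits uniform limits. -/
theorem norm_simpleCalc_le (s : SimpleFunc (EuclideanSpace ℝ (Fin d)) ℂ) {M : ℝ} (hM : 0 ≤ M)
    (h : ∀ p, ‖s p‖ ≤ M) : ‖E.simpleCalc s‖ ≤ M := by
  classical
  refine ContinuousLinearMap.opNorm_le_bound _ hM fun ψ => ?_
  have hdis : ∀ c c' : ℂ, c ≠ c' → Disjoint (s ⁻¹' {c}) (s ⁻¹' {c'}) := fun c c' hc =>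
    Set.disjoint_left.2 fun p hp hp' => hc ((show s p = c from hp).symm.trans hp')
  have h1 : E.simpleCalc s ψ = ∑ c ∈ s.range, c • E.proj (s ⁻¹' {c}) ψ := by
    simp [simpleCalc]
  have h2 : (∑ c ∈ s.range, E.proj (s ⁻¹' {c}) ψ) = ψ := by
    have : (∑ c ∈ s.range, E.proj (s ⁻¹' {c})) = 1 := by
      refine E.eq_of_mul_proj_fiber_eq s fun c => ?_
      by_cases hc : c ∈ s.range
      · rw [Finset.sum_mul, Finset.sum_eq_single_of_mem c hc, one_mul,
          E.proj_mul_self (s.measurableSet_fiber c)]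
        intro c' _ hcc
        exact E.proj_mul_of_disjoint (s.measurableSet_fiber _) (s.measurableSet_fiber _)
          (hdis _ _ hcc)
      · have : s ⁻¹' {c} = ∅ := by
          refine Set.eq_empty_of_forall_notMem fun p hp => hc ?_
          rw [← show s p = c from hp]
          exact s.mem_range_self p
        rw [this, E.proj_empty, mul_zero, mul_zero]
    simpa using congr($this ψ)
  have h3 := norm_sum_sq_of_pairwise_inner_eq_zero s.range
    (fun c => c • E.proj (s ⁻¹' {c}) ψ) fun i _ j _ hij => by
      rw [inner_smul_left, inner_smul_right, E.inner_proj_of_disjoint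
        (s.measurableSet_fiber i) (s.measurableSet_fiber j) (hdis i j hij)]
      simp
  have h4 := norm_sum_sq_of_pairwise_inner_eq_zero s.range
    (fun c => E.proj (s ⁻¹' {c}) ψ) fun i _ j _ hij => E.inner_proj_of_disjoint
        (s.measurableSet_fiber i) (s.measurableSet_fiber j) (hdis i j hij) _ _
  rw [h2] at h4
  rw [← h1] at h3
  refine le_of_sq_le_sq ?_ (by positivity)
  rw [h3, mul_pow, h4, Finset.mul_sum]
  refine Finset.sum_le_sum fun c hc => ?_
  obtain ⟨p, rfl⟩ := SimpleFunc.mem_range.1 hc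
  rw [norm_smul, mul_pow]
  gcongr
  exact h p

theorem norm_simpleCalc_sub_le (s t : SimpleFunc (EuclideanSpace ℝ (Fin d)) ℂ) {M : ℝ}
    (hM : 0 ≤ M) (h : ∀ p, ‖s p - t p‖ ≤ M) : ‖E.simpleCalc s - E.simpleCalc t‖ ≤ M := by
  have h1 : E.simpleCalc s = E.simpleCalc (s - t) + E.simpleCalc t := by
    rw [← E.simpleCalc_add, sub_add_cancel]
  rw [h1, add_sub_cancel_right]
  exact E.norm_simpleCalc_le _ hM fun p => by simpa using h p

end SpectralMeasure

/-- Bounded Borel functions. -/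
structure IsBddMeas (u : EuclideanSpace ℝ (Fin d) → ℂ) : Prop where
  measurable : Measurable u
  bound : ∃ C, ∀ p, ‖u p‖ ≤ C

namespace IsBddMeas

variable {u v : EuclideanSpace ℝ (Fin d) → ℂ}

theorem of_bound (hu : Measurable u) {C : ℝ} (h : ∀ p, ‖u p‖ ≤ C) : IsBddMeas u :=
  ⟨hu, C, h⟩

theorem const (c : ℂ) : IsBddMeas (fun _ : EuclideanSpace ℝ (Fin d) => c) :=
  ⟨measurable_const, ‖c‖, fun _ => le_rfl⟩

theorem add (hu : IsBddMeas u) (hv : IsBddMeas v) : IsBddMeas fun p => u p + v p := by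
  obtain ⟨C, hC⟩ := hu.bound
  obtain ⟨C', hC'⟩ := hv.bound
  exact ⟨hu.1.add hv.1, C + C', fun p => (norm_add_le _ _).trans (add_le_add (hC p) (hC' p))⟩

theorem mul (hu : IsBddMeas u) (hv : IsBddMeas v) : IsBddMeas fun p => u p * v p := by
  obtain ⟨C, hC⟩ := hu.bound
  obtain ⟨C', hC'⟩ := hv.bound
  refine ⟨hu.1.mul hv.1, C * C', fun p => ?_⟩
  rw [norm_mul]
  exact mul_le_mul (hC p) (hC' p) (norm_nonneg _) ((norm_nonneg _).trans (hC p))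

theorem const_mul (hu : IsBddMeas u) (c : ℂ) : IsBddMeas fun p => c * u p :=
  (const c).mul hu

theorem sub (hu : IsBddMeas u) (hv : IsBddMeas v) : IsBddMeas fun p => u p - v p := by
  simpa [sub_eq_add_neg] using hu.add (hv.const_mul (-1))

theorem sum {β : Type*} (s : Finset β) {w : β → EuclideanSpace ℝ (Fin d) → ℂ}
    (hw : ∀ b ∈ s, IsBddMeas (w b)) : IsBddMeas fun p => ∑ b ∈ s, w b p := by
  classical
  induction s using Finset.induction_on with
  | empty => simpa using const 0
  | insert a s ha ih =>
    simp only [Finset.sum_insert ha]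
    exact (hw a (Finset.mem_insert_self _ _)).add
      (ih fun b hb => hw b (Finset.mem_insert_of_mem hb))

theorem pow (hu : IsBddMeas u) (k : ℕ) : IsBddMeas fun p => u p ^ k := by
  induction k with
  | zero => simpa using const 1
  | succ k ih => simpa [pow_succ] using ih.mul hu

theorem exp (hu : IsBddMeas u) : IsBddMeas fun p => Complex.exp (u p) := by
  obtain ⟨C, hC⟩ := hu.bound
  refine ⟨hu.1.cexp, Real.exp C, fun p => ?_⟩
  rw [Complex.norm_exp]
  exact Real.exp_le_exp.2 ((Complex.re_le_norm _).trans (hC p))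

theorem indicator (hu : IsBddMeas u) {S : Set (EuclideanSpace ℝ (Fin d))}
    (hS : MeasurableSet S) : IsBddMeas (S.indicator u) := by
  obtain ⟨C, hC⟩ := hu.bound
  exact ⟨hu.1.indicator hS, C, fun p => (norm_indicator_le_norm_self _ _).trans (hC p)⟩

theorem indicator_one {S : Set (EuclideanSpace ℝ (Fin d))} (hS : MeasurableSet S) :
    IsBddMeas (S.indicator (1 : EuclideanSpace ℝ (Fin d) → ℂ)) :=
  (const 1).indicator hS

/-- Bounded Borel functions are uniform limits of simple functions. -/
theorem exists_simpleFunc (hu : IsBddMeas u) {ε : ℝ} (hε : 0 < ε) :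
    ∃ s : SimpleFunc (EuclideanSpace ℝ (Fin d)) ℂ, ∀ p, ‖u p - s p‖ ≤ ε := by
  obtain ⟨C, hC⟩ := hu.bound
  have hC0 : 0 ≤ C := (norm_nonneg _).trans (hC 0)
  -- Real and imaginary parts are rounded down separately to multiples of η, each with error at most
  -- η; boundedness of `u` leaves finitely many values.
  set η := ε / 2 with hη
  have hη0 : 0 < η := half_pos hε
  let g : EuclideanSpace ℝ (Fin d) → ℤ × ℤ := fun p => (⌊(u p).re / η⌋, ⌊(u p).im / η⌋)
  have hg : Measurable g :=
    ((Complex.measurable_re.comp hu.1).div_const η).floor.prodMk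
      ((Complex.measurable_im.comp hu.1).div_const η).floor
  have hfin : (Set.range g).Finite := by
    refine ((Set.finite_Icc (⌊-C / η⌋) ⌊C / η⌋).prod
      (Set.finite_Icc (⌊-C / η⌋) ⌊C / η⌋)).subset ?_
    rintro _ ⟨p, rfl⟩
    have h1 := abs_le.1 ((Complex.abs_re_le_norm (u p)).trans (hC p))
    have h2 := abs_le.1 ((Complex.abs_im_le_norm (u p)).trans (hC p))
    refine ⟨⟨Int.floor_mono ?_, Int.floor_mono ?_⟩, Int.floor_mono ?_, Int.floor_mono ?_⟩ <;>
      gcongr <;> first | exact h1.1 | exact h1.2 | exact h2.1 | exact h2.2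
  let s₀ : SimpleFunc (EuclideanSpace ℝ (Fin d)) (ℤ × ℤ) :=
    ⟨g, fun c => hg (measurableSet_singleton c), hfin⟩
  refine ⟨s₀.map fun c => ((c.1 * η : ℝ) : ℂ) + ((c.2 * η : ℝ) : ℂ) * Complex.I, fun p => ?_⟩
  have key : ∀ x : ℝ, |x - ⌊x / η⌋ * η| ≤ η := by
    intro x
    have h1 := Int.floor_le (x / η)
    have h2 := (Int.lt_floor_add_one (x / η)).le
    rw [le_div_iff₀ hη0] at h1
    rw [div_le_iff₀ hη0] at h2
    rw [abs_le]
    constructor <;> nlinarith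
  refine (Complex.norm_le_abs_re_add_abs_im _).trans ?_
  have h3 := key (u p).re
  have h4 := key (u p).im
  simp only [SimpleFunc.map_apply, Complex.sub_re, Complex.add_re, Complex.ofReal_re,
    Complex.mul_re, Complex.I_re, Complex.ofReal_im, Complex.I_im, Complex.sub_im,
    Complex.add_im, Complex.mul_im, mul_zero, mul_one, sub_self, add_zero, zero_add]
  change |(u p).re - ⌊(u p).re / η⌋ * η| + |(u p).im - ⌊(u p).im / η⌋ * η| ≤ ε
  linarith

end IsBddMeas

namespace SpectralMeasure

variable (E : SpectralMeasure d H) {u v : EuclideanSpace ℝ (Fin d) → ℂ}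

/-- `A = ∫ u(p) dE(p)` as a uniform limit of simple functions. -/
def IsCalc (u : EuclideanSpace ℝ (Fin d) → ℂ) (A : H →L[ℂ] H) : Prop :=
  ∀ ε > 0, ∃ s : SimpleFunc (EuclideanSpace ℝ (Fin d)) ℂ,
    (∀ p, ‖u p - s p‖ ≤ ε) ∧ ‖A - E.simpleCalc s‖ ≤ ε

variable {E} in
-- Contractivity for the sup norm; with η = 0 it is also uniqueness of the operator attached to a
-- function.
theorem IsCalc.norm_sub_le {A A' : H →L[ℂ] H} (h : E.IsCalc u A) (h' : E.IsCalc v A') {η : ℝ}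
    (hη : 0 ≤ η) (huv : ∀ p, ‖u p - v p‖ ≤ η) : ‖A - A'‖ ≤ η := by
  refine le_of_forall_pos_le_add fun ε hε => ?_
  obtain ⟨s, hs, hs'⟩ := h (ε / 4) (by positivity)
  obtain ⟨t, ht, ht'⟩ := h' (ε / 4) (by positivity)
  have h1 := E.norm_simpleCalc_sub_le s t (M := η + ε / 4 + ε / 4) (by positivity) fun p => by
    have e : s p - t p = (u p - v p) + -(u p - s p) + (v p - t p) := by ring
    rw [e]
    refine (norm_add_le _ _).trans (add_le_add ((norm_add_le _ _).trans ?_) (ht p))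
    rw [norm_neg]
    exact add_le_add (huv p) (hs p)
  have e : A - A' = (A - E.simpleCalc s) + (E.simpleCalc s - E.simpleCalc t)
      + -(A' - E.simpleCalc t) := by abel
  rw [e]
  refine (norm_add_le _ _).trans ?_
  rw [norm_neg]
  have := norm_add_le (A - E.simpleCalc s) (E.simpleCalc s - E.simpleCalc t)
  linarith

theorem exists_isCalc (hu : IsBddMeas u) : ∃ A, E.IsCalc u A := by
  have hpos : ∀ n : ℕ, (0 : ℝ) < 1 / (n + 1) := fun n => Nat.one_div_pos_of_nat
  choose s hs using fun n : ℕ => hu.exists_simpleFunc (hpos n)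
  have hbd : ∀ n m, ‖E.simpleCalc (s n) - E.simpleCalc (s m)‖
      ≤ 1 / ((n : ℝ) + 1) + 1 / ((m : ℝ) + 1) := fun n m =>
    E.norm_simpleCalc_sub_le _ _ (add_pos (hpos n) (hpos m)).le fun p => by
      have e : s n p - s m p = -(u p - s n p) + (u p - s m p) := by ring
      rw [e]
      refine (norm_add_le _ _).trans (add_le_add ?_ (hs m p))
      rw [norm_neg]
      exact hs n p
  have hc : CauchySeq fun n => E.simpleCalc (s n) := by
    refine Metric.cauchySeq_iff.2 fun ε hε => ?_
    obtain ⟨N, hN⟩ := exists_nat_one_div_lt (half_pos hε)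
    refine ⟨N, fun m hm n hn => ?_⟩
    rw [dist_eq_norm]
    have h1 := Nat.one_div_le_one_div (α := ℝ) hm
    have h2 := Nat.one_div_le_one_div (α := ℝ) hn
    linarith [hbd m n]
  obtain ⟨A, hA⟩ := cauchySeq_tendsto_of_complete hc
  refine ⟨A, fun ε hε => ?_⟩
  obtain ⟨N, hN⟩ := exists_nat_one_div_lt (half_pos hε)
  refine ⟨s N, fun p => (hs N p).trans (by linarith), ?_⟩
  refine le_of_tendsto ((hA.sub_const (E.simpleCalc (s N))).norm)
    (eventually_atTop.2 ⟨N, fun m hm => (hbd m N).trans ?_⟩)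
  have h1 := Nat.one_div_le_one_div (α := ℝ) hm
  linarith

open Classical in
/-- The functional calculus `u ↦ u(P) = ∫ u(p) dE(p)` for bounded Borel functions. -/
def fc (u : EuclideanSpace ℝ (Fin d) → ℂ) : H →L[ℂ] H :=
  if h : ∃ A, E.IsCalc u A then h.choose else 0

theorem isCalc_fc (hu : IsBddMeas u) : E.IsCalc u (E.fc u) := by
  rw [fc, dif_pos (E.exists_isCalc hu)]
  exact (E.exists_isCalc hu).choose_spec

variable {E} in
theorem IsCalc.eq_fc {A : H →L[ℂ] H} (h : E.IsCalc u A) (hu : IsBddMeas u) : A = E.fc u :=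
  sub_eq_zero.1 (norm_le_zero_iff.1 (h.norm_sub_le (E.isCalc_fc hu) le_rfl fun p => by simp))

theorem norm_fc_sub_fc_le (hu : IsBddMeas u) (hv : IsBddMeas v) {η : ℝ} (hη : 0 ≤ η)
    (h : ∀ p, ‖u p - v p‖ ≤ η) : ‖E.fc u - E.fc v‖ ≤ η :=
  (E.isCalc_fc hu).norm_sub_le (E.isCalc_fc hv) hη h

theorem isCalc_simpleFunc (s : SimpleFunc (EuclideanSpace ℝ (Fin d)) ℂ) :
    E.IsCalc s (E.simpleCalc s) := fun ε hε =>
  ⟨s, fun p => by simpa using hε.le, by simpa using hε.le⟩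

theorem fc_const (c : ℂ) : E.fc (fun _ => c) = c • 1 := by
  rw [← E.simpleCalc_const c]
  exact ((E.isCalc_simpleFunc (SimpleFunc.const _ c)).eq_fc (IsBddMeas.const c)).symm

theorem norm_fc_le (hu : IsBddMeas u) {M : ℝ} (hM : 0 ≤ M) (h : ∀ p, ‖u p‖ ≤ M) :
    ‖E.fc u‖ ≤ M := by
  simpa [E.fc_const] using
    E.norm_fc_sub_fc_le hu (IsBddMeas.const 0) hM fun p => by simpa using h p

theorem fc_add (hu : IsBddMeas u) (hv : IsBddMeas v) :
    E.fc (fun p => u p + v p) = E.fc u + E.fc v := by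
  refine (IsCalc.eq_fc (fun ε hε => ?_) (hu.add hv)).symm
  obtain ⟨s, hs, hs'⟩ := E.isCalc_fc hu (ε / 2) (half_pos hε)
  obtain ⟨t, ht, ht'⟩ := E.isCalc_fc hv (ε / 2) (half_pos hε)
  refine ⟨s + t, fun p => ?_, ?_⟩
  · rw [SimpleFunc.add_apply, add_sub_add_comm]
    refine (norm_add_le _ _).trans ?_
    linarith [hs p, ht p]
  · rw [E.simpleCalc_add, add_sub_add_comm]
    refine (norm_add_le _ _).trans ?_
    linarith

theorem fc_mul (hu : IsBddMeas u) (hv : IsBddMeas v) :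
    E.fc (fun p => u p * v p) = E.fc u * E.fc v := by
  obtain ⟨C, hC⟩ := hu.bound
  obtain ⟨C', hC'⟩ := hv.bound
  have hC0 : 0 ≤ C := (norm_nonneg _).trans (hC 0)
  have hC0' : 0 ≤ C' := (norm_nonneg _).trans (hC' 0)
  refine (IsCalc.eq_fc (fun ε hε => ?_) (hu.mul hv)).symm
  -- The bound η ≤ 1 turns the quadratic error term of a product into a linear one.
  set η := min 1 (ε / (C + C' + 1)) with hη
  have hη0 : 0 < η := lt_min one_pos (by positivity)
  have hη1 : η ≤ 1 := min_le_left _ _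
  have hηε : η * (C + C' + 1) ≤ ε := (le_div_iff₀ (by positivity)).1 (min_le_right _ _)
  obtain ⟨s, hs, hs'⟩ := E.isCalc_fc hu η hη0
  obtain ⟨t, ht, ht'⟩ := E.isCalc_fc hv η hη0
  refine ⟨s * t, fun p => ?_, ?_⟩
  · rw [SimpleFunc.mul_apply]
    exact (norm_mul_sub_mul_le (hC p) (hC' p) (hs p) (ht p) hη1).trans hηε
  · rw [E.simpleCalc_mul]
    exact (norm_mul_sub_mul_le (E.norm_fc_le hu hC0 hC) (E.norm_fc_le hv hC0' hC') hs' ht'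
      hη1).trans hηε

theorem fc_const_mul (hu : IsBddMeas u) (c : ℂ) :
    E.fc (fun p => c * u p) = c • E.fc u := by
  rw [E.fc_mul (IsBddMeas.const c) hu, E.fc_const, smul_mul_assoc, one_mul]

theorem fc_sub (hu : IsBddMeas u) (hv : IsBddMeas v) :
    E.fc (fun p => u p - v p) = E.fc u - E.fc v := by
  have : (fun p => u p - v p) = fun p => u p + (-1) * v p := by
    ext p
    ring
  rw [this, E.fc_add hu (hv.const_mul _), E.fc_const_mul hv]
  simp [sub_eq_add_neg]

theorem fc_sum {β : Type*} (s : Finset β) {w : β → EuclideanSpace ℝ (Fin d) → ℂ}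
    (hw : ∀ b ∈ s, IsBddMeas (w b)) :
    E.fc (fun p => ∑ b ∈ s, w b p) = ∑ b ∈ s, E.fc (w b) := by
  classical
  induction s using Finset.induction_on with
  | empty => simp [E.fc_const]
  | insert a s ha ih =>
    simp only [Finset.sum_insert ha]
    rw [E.fc_add (hw a (Finset.mem_insert_self _ _))
      (IsBddMeas.sum s fun b hb => hw b (Finset.mem_insert_of_mem hb)),
      ih fun b hb => hw b (Finset.mem_insert_of_mem hb)]

theorem fc_pow (hu : IsBddMeas u) (k : ℕ) : E.fc (fun p => u p ^ k) = E.fc u ^ k := by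
  induction k with
  | zero => simpa using E.fc_const 1
  | succ k ih => simp only [pow_succ, E.fc_mul (hu.pow k) hu, ih]

theorem fc_indicator_one {S : Set (EuclideanSpace ℝ (Fin d))} (hS : MeasurableSet S) :
    E.fc (S.indicator 1) = E.proj S := by
  classical
  let s : SimpleFunc (EuclideanSpace ℝ (Fin d)) ℂ :=
    SimpleFunc.piecewise S hS (SimpleFunc.const _ 1) (SimpleFunc.const _ 0)
  have hs : ∀ p, s p = S.indicator 1 p := fun p => by
    simp only [s, SimpleFunc.coe_piecewise, Set.indicator, Set.piecewise]
    rfl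
  have h1 : E.simpleCalc s * E.proj S = (1 : ℂ) • E.proj S :=
    E.simpleCalc_mul_proj s hS fun p hp => by simp [hs, hp]
  have h2 : E.simpleCalc s * E.proj Sᶜ = (0 : ℂ) • E.proj Sᶜ :=
    E.simpleCalc_mul_proj s hS.compl fun p hp => by simpa [hs] using hp
  have h3 : E.simpleCalc s = E.proj S := by
    refine E.eq_of_mul_proj_eq (S := fun b : Bool => if b then S else Sᶜ) ?_ ?_ ?_ ?_
    · rintro (_ | _)
      · simpa using hS.compl
      · simpa using hS
    · rintro (_ | _) (_ | _) h <;> simp [disjoint_compl_left, disjoint_compl_right] at h ⊢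
    · exact Set.eq_univ_of_forall fun p => Set.mem_iUnion.2 (by
        by_cases hp : p ∈ S
        · exact ⟨true, by simpa using hp⟩
        · exact ⟨false, by simpa using hp⟩)
    · rintro (_ | _)
      · simp [h2, E.proj_mul_of_disjoint hS hS.compl disjoint_compl_right]
      · simp [h1, E.proj_mul_self hS]
  rw [← h3]
  exact ((show (s : _ → ℂ) = S.indicator 1 from funext hs) ▸ (E.isCalc_simpleFunc s).eq_fc
    ((show (s : _ → ℂ) = S.indicator 1 from funext hs) ▸
      (IsBddMeas.indicator_one hS))).symm

theorem fc_comm (hu : IsBddMeas u) (hv : IsBddMeas v) : Commute (E.fc u) (E.fc v) := by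
  rw [Commute, SemiconjBy, ← E.fc_mul hu hv, ← E.fc_mul hv hu]
  simp only [mul_comm]

theorem fc_mul_proj (hu : IsBddMeas u) {S : Set (EuclideanSpace ℝ (Fin d))}
    (hS : MeasurableSet S) : E.fc u * E.proj S = E.fc (S.indicator u) := by
  rw [← E.fc_indicator_one hS, ← E.fc_mul hu (IsBddMeas.indicator_one hS)]
  congr 1
  ext p
  by_cases hp : p ∈ S <;> simp [hp]

theorem fc_comm_proj (hu : IsBddMeas u) {S : Set (EuclideanSpace ℝ (Fin d))}
    (hS : MeasurableSet S) : Commute (E.fc u) (E.proj S) := by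
  rw [← E.fc_indicator_one hS]
  exact E.fc_comm hu (IsBddMeas.indicator_one hS)

theorem fc_mul_proj_congr (hu : IsBddMeas u) (hv : IsBddMeas v)
    {S : Set (EuclideanSpace ℝ (Fin d))} (hS : MeasurableSet S) (h : ∀ p ∈ S, u p = v p) :
    E.fc u * E.proj S = E.fc v * E.proj S := by
  rw [E.fc_mul_proj hu hS, E.fc_mul_proj hv hS, Set.indicator_congr h]

theorem fc_mul_proj_const (hu : IsBddMeas u) {S : Set (EuclideanSpace ℝ (Fin d))}
    (hS : MeasurableSet S) {c : ℂ} (h : ∀ p ∈ S, u p = c) :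
    E.fc u * E.proj S = c • E.proj S := by
  rw [E.fc_mul_proj_congr hu (IsBddMeas.const c) hS h, E.fc_const, smul_mul_assoc, one_mul]

/-- The exponential series converges uniformly on the bounded range of `u`, and `fc` is
multiplicative and sup-norm contractive. -/
theorem exp_fc (hu : IsBddMeas u) :
    NormedSpace.exp (E.fc u) = E.fc fun p => Complex.exp (u p) := by
  obtain ⟨C, hC⟩ := hu.bound
  have hC0 : 0 ≤ C := (norm_nonneg _).trans (hC 0)
  have h1 := (NormedSpace.exp_series_hasSum_exp' (𝕂 := ℂ) (E.fc u)).tendsto_sum_nat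
  refine tendsto_nhds_unique h1 ?_
  have hpart : ∀ n : ℕ, IsBddMeas fun p => ∑ k ∈ Finset.range n, ((k.factorial : ℂ)⁻¹) * u p ^ k :=
    fun n => IsBddMeas.sum _ fun k _ => (hu.pow k).const_mul _
  have h2 : ∀ n : ℕ, (∑ k ∈ Finset.range n, ((k.factorial : ℂ)⁻¹) • E.fc u ^ k) =
      E.fc fun p => ∑ k ∈ Finset.range n, ((k.factorial : ℂ)⁻¹) * u p ^ k := by
    intro n
    rw [E.fc_sum _ fun k _ => (hu.pow k).const_mul _]
    refine Finset.sum_congr rfl fun k _ => ?_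
    rw [E.fc_const_mul (hu.pow k), E.fc_pow hu]
  simp only [h2]
  have h3 := tendstoUniformly_tsum_nat (f := fun k p => ((k.factorial : ℂ)⁻¹) * u p ^ k)
    (Real.summable_pow_div_factorial C) fun n p => by
      rw [norm_mul, norm_inv, norm_pow, Complex.norm_natCast, div_eq_inv_mul]
      gcongr
      exact hC p
  refine Metric.tendsto_atTop.2 fun ε hε => ?_
  obtain ⟨N, hN⟩ := eventually_atTop.1 (Metric.tendstoUniformly_iff.1 h3 (ε / 2) (half_pos hε))
  refine ⟨N, fun n hn => ?_⟩
  rw [dist_eq_norm]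
  refine (E.norm_fc_sub_fc_le (hpart n) hu.exp (half_pos hε).le fun p => ?_).trans_lt
    (half_lt_self hε)
  have h4 := (hN n hn p).le
  rw [dist_eq_norm, norm_sub_rev] at h4
  have h5 : Complex.exp (u p) = ∑' k : ℕ, ((k.factorial : ℂ)⁻¹) * u p ^ k := by
    rw [Complex.exp_eq_exp_ℂ, NormedSpace.exp_eq_tsum ℂ]
    simp only [smul_eq_mul]
  rwa [h5]

end SpectralMeasure

end FunctionalCalculus

/-! ### Riemann sums over tagged partitions and the representation as a function of P. -/

section Representation

open MeasureTheory Filter Topology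

namespace IsTaggedPartition

variable {d : ℕ} {δ : ℝ} {Δ : ℕ → Set (EuclideanSpace ℝ (Fin d))}
  {t : ℕ → EuclideanSpace ℝ (Fin d)}

theorem exists_index (h : IsTaggedPartition δ Δ t) (p : EuclideanSpace ℝ (Fin d)) :
    ∃ j, p ∈ Δ j :=
  Set.mem_iUnion.1 (h.cover ▸ Set.mem_univ p)

/-- The function sending a point to the tag of the piece containing it. -/
def tagMap (h : IsTaggedPartition δ Δ t) (p : EuclideanSpace ℝ (Fin d)) :
    EuclideanSpace ℝ (Fin d) :=
  t (h.exists_index p).choose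

theorem tagMap_eq (h : IsTaggedPartition δ Δ t) {j : ℕ} {p : EuclideanSpace ℝ (Fin d)}
    (hp : p ∈ Δ j) : h.tagMap p = t j := by
  by_contra hne
  refine Set.disjoint_left.1 (h.disjoint (i := (h.exists_index p).choose) (j := j) ?_)
    (h.exists_index p).choose_spec hp
  rintro hj
  exact hne (congrArg t hj)

theorem dist_tagMap_le (h : IsTaggedPartition δ Δ t) (p : EuclideanSpace ℝ (Fin d)) :
    dist (h.tagMap p) p ≤ δ :=
  h.mesh _ _ (h.tag _ ⟨p, (h.exists_index p).choose_spec⟩) _ (h.exists_index p).choose_spec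

theorem measurable_tagMap (h : IsTaggedPartition δ Δ t) : Measurable h.tagMap := by
  intro S _
  have : h.tagMap ⁻¹' S = ⋃ j ∈ {j | t j ∈ S}, Δ j := by
    ext p
    obtain ⟨j, hj⟩ := h.exists_index p
    simp only [Set.mem_preimage, Set.mem_iUnion, Set.mem_ofPred_eq]
    constructor
    · intro hp
      exact ⟨j, by rwa [← h.tagMap_eq hj], hj⟩
    · rintro ⟨i, hi, hip⟩
      rwa [h.tagMap_eq hip]
  rw [this]
  exact MeasurableSet.biUnion (Set.to_countable _) fun j _ => h.measurable j

theorem nonneg (h : IsTaggedPartition δ Δ t) : 0 ≤ δ :=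
  dist_nonneg.trans (h.dist_tagMap_le 0)

end IsTaggedPartition

variable {d : ℕ} {H : Type*} [NormedAddCommGroup H] [InnerProductSpace ℂ H] [CompleteSpace H]

/-- A Riemann sum is exactly `fc` of `u` composed with the tag map, which is uniformly close to `u`
by uniform continuity. -/
theorem SpectralMeasure.HasIntegral.eq_fc {E : SpectralMeasure d H}
    {u : EuclideanSpace ℝ (Fin d) → ℂ} (hu : IsBddMeas u) (hc : UniformContinuous u) {ψ v : H}
    (h : E.HasIntegral (fun p => u p • ψ) v) : v = E.fc u ψ := by
  refine dist_le_zero.1 (le_of_forall_pos_le_add fun ε hε => ?_)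
  have hψ : 0 < 2 * (‖ψ‖ + 1) := by positivity
  obtain ⟨δ, hδ, h⟩ := h (ε / 2) (half_pos hε)
  obtain ⟨δ', hδ', hc⟩ := Metric.uniformContinuous_iff.1 hc (ε / (2 * (‖ψ‖ + 1)))
    (div_pos hε hψ)
  obtain ⟨Δ, t, ht⟩ := exists_isTaggedPartition d (lt_min hδ (half_pos hδ'))
  obtain ⟨s, hs, hsv⟩ := h Δ t ⟨ht.1, ht.2, ht.3,
    fun j p hp q hq => (ht.4 j p hp q hq).trans (min_le_left _ _), ht.5⟩
  have hτ : IsBddMeas fun p => u (ht.tagMap p) := by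
    obtain ⟨C, hC⟩ := hu.bound
    exact ⟨hu.1.comp ht.measurable_tagMap, C, fun p => hC _⟩
  have h1 : s = E.fc (fun p => u (ht.tagMap p)) ψ := by
    refine hs.unique ?_
    have := E.hasSum_proj ht.measurable ht.disjoint ht.cover (E.fc (fun p => u (ht.tagMap p)) ψ)
    convert this using 2 with j
    rw [← mul_apply_eq_comp, ← (E.fc_comm_proj hτ (ht.measurable j)).eq,
      E.fc_mul_proj_const hτ (ht.measurable j) (c := u (t j)) fun p hp => by rw [ht.tagMap_eq hp]]
    simp
  have h2 : ‖E.fc (fun p => u (ht.tagMap p)) - E.fc u‖ ≤ ε / (2 * (‖ψ‖ + 1)) := by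
    refine E.norm_fc_sub_fc_le hτ hu (div_pos hε hψ).le fun p => ?_
    rw [← dist_eq_norm]
    refine (hc ((ht.dist_tagMap_le p).trans_lt ?_)).le
    exact (min_le_right _ _).trans_lt (half_lt_self hδ')
  have h3 : dist s (E.fc u ψ) ≤ ε / 2 := by
    rw [h1, dist_eq_norm, ← sub_apply]
    refine (ContinuousLinearMap.le_of_opNorm_le _ h2 ψ).trans ?_
    rw [div_mul_eq_mul_div, div_le_iff₀ hψ]
    nlinarith [norm_nonneg ψ]
  have := dist_triangle_left v (E.fc u ψ) s
  linarith

theorem isBddMeas_cexp_I_mul {f : EuclideanSpace ℝ (Fin d) → ℝ} (hf : Measurable f) :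
    IsBddMeas fun p => Complex.exp (Complex.I * (f p : ℂ)) :=
  IsBddMeas.of_bound (C := 1) (by fun_prop) fun p => by
    rw [mul_comm, Complex.norm_exp_ofReal_mul_I]

theorem norm_cexp_I_mul_sub_one_le (x : ℝ) : ‖Complex.exp (Complex.I * (x : ℂ)) - 1‖ ≤ |x| := by
  simpa using Real.norm_exp_I_mul_ofReal_sub_one_le (x := x)

theorem norm_cexp_I_mul_sub_le (x y : ℝ) :
    ‖Complex.exp (Complex.I * (x : ℂ)) - Complex.exp (Complex.I * (y : ℂ))‖ ≤ |x - y| := by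
  have e : Complex.exp (Complex.I * (x : ℂ)) - Complex.exp (Complex.I * (y : ℂ)) =
      Complex.exp (Complex.I * (y : ℂ)) * (Complex.exp (Complex.I * ((x - y : ℝ) : ℂ)) - 1) := by
    rw [mul_sub, ← Complex.exp_add, mul_one]
    congr 2
    push_cast
    ring
  rw [e, norm_mul, mul_comm Complex.I (y : ℂ), Complex.norm_exp_ofReal_mul_I, one_mul]
  exact norm_cexp_I_mul_sub_one_le _

theorem measurable_bilin_left (B : LinearMap.BilinForm ℝ (EuclideanSpace ℝ (Fin d)))
    (x : EuclideanSpace ℝ (Fin d)) : Measurable fun p => B p x :=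
  (LinearMap.continuous_of_finiteDimensional (B.flip x)).measurable

namespace IsSpectralResolution

variable {B : LinearMap.BilinForm ℝ (EuclideanSpace ℝ (Fin d))} {U : UnitaryRep d H}
  {E : SpectralMeasure d H}

theorem apply_eq_fc (hE : IsSpectralResolution B U E) (x : EuclideanSpace ℝ (Fin d)) (ψ : H) :
    U x ψ = E.fc (fun p => Complex.exp (Complex.I * (B p x : ℂ))) ψ := by
  refine (hE x ψ).eq_fc (isBddMeas_cexp_I_mul (measurable_bilin_left B x)) ?_
  have h1 : UniformContinuous fun p => B p x :=
    (LinearMap.toContinuousLinearMap (B.flip x)).uniformContinuous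
  have h2 : UniformContinuous fun y : ℝ => Complex.exp (Complex.I * (y : ℂ)) :=
    LipschitzWith.uniformContinuous (K := 1) (LipschitzWith.of_dist_le_mul fun y z => by
      simpa [dist_eq_norm] using norm_cexp_I_mul_sub_le y z)
  exact h2.comp h1

end IsSpectralResolution

end Representation

/-! ### Schur multipliers as exponentials of left and right multiplications. -/

section SchurMultiplier

open NormedSpace

section Algebra

variable {A : Type*} [NormedRing A] [NormedAlgebra ℂ A]

/-- Left multiplication as a bounded operator on a normed algebra. -/
def leftMul (a : A) : A →L[ℂ] A := ContinuousLinearMap.mul ℂ A a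

/-- Right multiplication as a bounded operator on a normed algebra. -/
def rightMul (a : A) : A →L[ℂ] A := (ContinuousLinearMap.mul ℂ A).flip a

@[simp] theorem leftMul_apply (a x : A) : leftMul a x = a * x := rfl

@[simp] theorem rightMul_apply (a x : A) : rightMul a x = x * a := rfl

theorem norm_leftMul_le (a : A) : ‖leftMul a‖ ≤ ‖a‖ :=
  ContinuousLinearMap.opNorm_mul_apply_le ℂ A a

theorem norm_rightMul_le (a : A) : ‖rightMul a‖ ≤ ‖a‖ :=
  ContinuousLinearMap.opNorm_le_bound _ (norm_nonneg _) fun x => by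
    rw [rightMul_apply, mul_comm ‖a‖]
    exact norm_mul_le _ _

theorem leftMul_commute_rightMul (a b : A) : Commute (leftMul a) (rightMul b) := by
  ext x
  simp [mul_assoc]

theorem leftMul_commute {a b : A} (h : Commute a b) : Commute (leftMul a) (leftMul b) := by
  ext x
  simp only [mul_apply_eq_comp, leftMul_apply]
  rw [← mul_assoc, h.eq, mul_assoc]

theorem rightMul_commute {a b : A} (h : Commute a b) : Commute (rightMul a) (rightMul b) := by
  ext x
  simp only [mul_apply_eq_comp, rightMul_apply]
  rw [mul_assoc, ← h.eq, mul_assoc]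

variable [CompleteSpace A]

theorem norm_exp_sub_one_le_exp_norm_sub_one (x : A) : ‖exp x - 1‖ ≤ Real.exp ‖x‖ - 1 := by
  have h1 := (hasSum_nat_add_iff' 1).2 (exp_series_hasSum_exp' (𝕂 := ℂ) x)
  have h2 := (hasSum_nat_add_iff' 1).2 (exp_series_hasSum_exp' (𝕂 := ℝ) ‖x‖)
  rw [← Real.exp_eq_exp_ℝ] at h2
  simp only [Finset.range_one, Finset.sum_singleton, Nat.factorial_zero, Nat.cast_one, inv_one,
    pow_zero, one_smul] at h1 h2
  refine h1.norm_le_of_bounded h2 fun k => ?_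
  rw [norm_smul, norm_inv, Complex.norm_natCast, smul_eq_mul]
  gcongr
  exact norm_pow_le' x k.succ_pos

theorem exp_add_eq_mul_exp {x y : A} (h : Commute x y) : exp (x + y) = exp x * exp y :=
  exp_add_of_commute_of_mem_ball (𝕂 := ℂ) h ((expSeries_radius_eq_top ℂ A).symm ▸ edist_lt_top _ _)
    ((expSeries_radius_eq_top ℂ A).symm ▸ edist_lt_top _ _)

/-- Only `y` is assumed to commute with `P`: factors `x` are converted into `y` one at a time,
moving `P` past the powers of `y` already obtained. In the applications `P` is multiplication by a
spectral projection on whose set one factor of the symbol is constant. -/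
theorem mul_exp_eq_mul_exp {P x y : A} (h : P * x = P * y) (hy : Commute P y) :
    P * exp x = P * exp y := by
  have hk : ∀ k : ℕ, P * x ^ k = P * y ^ k := by
    intro k
    induction k with
    | zero => simp
    | succ k ih =>
      rw [pow_succ, ← mul_assoc, ih, (hy.pow_right k).eq, mul_assoc, h, ← mul_assoc,
        ← (hy.pow_right k).eq, mul_assoc, pow_succ]
  have h1 := (exp_series_hasSum_exp' (𝕂 := ℂ) x).mul_left P
  have h2 := (exp_series_hasSum_exp' (𝕂 := ℂ) y).mul_left P
  simp only [mul_smul_comm, hk] at h1 h2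
  exact h1.unique h2

theorem exp_leftMul_apply (a x : A) : exp (leftMul a) x = exp a * x := by
  have hk : ∀ k : ℕ, (leftMul a ^ k) x = a ^ k * x := by
    intro k
    induction k with
    | zero => simp
    | succ k ih => rw [pow_succ', mul_apply_eq_comp, ih, leftMul_apply, pow_succ', mul_assoc]
  have h1 := (exp_series_hasSum_exp' (𝕂 := ℂ) (leftMul a)).mapL
    (ContinuousLinearMap.apply ℂ A x)
  have h2 := (exp_series_hasSum_exp' (𝕂 := ℂ) a).mul_right x
  simp only [ContinuousLinearMap.apply_apply, smul_apply, hk, smul_mul_assoc]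
    at h1 h2
  exact h1.unique h2

theorem exp_rightMul_apply (a x : A) : exp (rightMul a) x = x * exp a := by
  have hk : ∀ k : ℕ, (rightMul a ^ k) x = x * a ^ k := by
    intro k
    induction k with
    | zero => simp
    | succ k ih => rw [pow_succ', mul_apply_eq_comp, ih, rightMul_apply, pow_succ, mul_assoc]
  have h1 := (exp_series_hasSum_exp' (𝕂 := ℂ) (rightMul a)).mapL
    (ContinuousLinearMap.apply ℂ A x)
  have h2 := (exp_series_hasSum_exp' (𝕂 := ℂ) a).mul_left x
  simp only [ContinuousLinearMap.apply_apply, smul_apply, hk, mul_smul_comm]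
    at h1 h2
  exact h1.unique h2

end Algebra

variable {d : ℕ} {H : Type*} [NormedAddCommGroup H] [InnerProductSpace ℂ H] [CompleteSpace H]

namespace SpectralMeasure

variable (E : SpectralMeasure d H)

/-- The double operator integral with symbol `∑ a, u a (p) * v a (q)`. -/
def schurGen (u v : Fin d → EuclideanSpace ℝ (Fin d) → ℂ) : (H →L[ℂ] H) →L[ℂ] (H →L[ℂ] H) :=
  ∑ a, leftMul (E.fc (u a)) * rightMul (E.fc (v a))

/-- The double operator integral with symbol `exp (∑ a, u a (p) * v a (q))`. -/
def schur (u v : Fin d → EuclideanSpace ℝ (Fin d) → ℂ) : (H →L[ℂ] H) →L[ℂ] (H →L[ℂ] H) :=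
  exp (E.schurGen u v)

variable {u v u' v' : Fin d → EuclideanSpace ℝ (Fin d) → ℂ}

theorem leftMul_commute_schurGen {f : EuclideanSpace ℝ (Fin d) → ℂ} (hf : IsBddMeas f)
    (hu : ∀ a, IsBddMeas (u a)) : Commute (leftMul (E.fc f)) (E.schurGen u v) :=
  Commute.sum_right _ _ _ fun a _ =>
    (leftMul_commute (E.fc_comm hf (hu a))).mul_right (leftMul_commute_rightMul _ _)

theorem rightMul_commute_schurGen {f : EuclideanSpace ℝ (Fin d) → ℂ} (hf : IsBddMeas f)
    (hv : ∀ a, IsBddMeas (v a)) : Commute (rightMul (E.fc f)) (E.schurGen u v) :=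
  Commute.sum_right _ _ _ fun a _ =>
    (leftMul_commute_rightMul _ _).symm.mul_right (rightMul_commute (E.fc_comm hf (hv a)))

theorem schurGen_commute (hu : ∀ a, IsBddMeas (u a)) (hv : ∀ a, IsBddMeas (v a))
    (hu' : ∀ a, IsBddMeas (u' a)) (hv' : ∀ a, IsBddMeas (v' a)) :
    Commute (E.schurGen u v) (E.schurGen u' v') :=
  Commute.sum_left _ _ _ fun a _ =>
    (E.leftMul_commute_schurGen (hu a) hu').mul_left (E.rightMul_commute_schurGen (hv a) hv')

/-- All generators commute, so adding exponents of symbols composes the multipliers. This is the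
tool for splitting off constants and small perturbations from one variable. -/
theorem schur_add_left (hu : ∀ a, IsBddMeas (u a)) (hv : ∀ a, IsBddMeas (v a))
    (hu' : ∀ a, IsBddMeas (u' a)) :
    E.schur (fun a p => u a p + u' a p) v = E.schur u v * E.schur u' v := by
  rw [schur, schur, schur, ← exp_add_eq_mul_exp (E.schurGen_commute hu hv hu' hv)]
  congr 1
  simp only [schurGen, ← Finset.sum_add_distrib]
  refine Finset.sum_congr rfl fun a _ => ?_
  rw [E.fc_add (hu a) (hu' a), ← add_mul]
  ext1 X
  simp [add_mul]

theorem schur_add_right (hu : ∀ a, IsBddMeas (u a)) (hv : ∀ a, IsBddMeas (v a))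
    (hv' : ∀ a, IsBddMeas (v' a)) :
    E.schur u (fun a p => v a p + v' a p) = E.schur u v * E.schur u v' := by
  rw [schur, schur, schur, ← exp_add_eq_mul_exp (E.schurGen_commute hu hv hu hv')]
  congr 1
  simp only [schurGen, ← Finset.sum_add_distrib]
  refine Finset.sum_congr rfl fun a _ => ?_
  rw [E.fc_add (hv a) (hv' a), ← mul_add]
  ext1 X
  simp [mul_add]

theorem fc_mul_schur {f : EuclideanSpace ℝ (Fin d) → ℂ} (hf : IsBddMeas f)
    (hu : ∀ a, IsBddMeas (u a)) (X : H →L[ℂ] H) :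
    E.fc f * E.schur u v X = E.schur u v (E.fc f * X) :=
  congr($((E.leftMul_commute_schurGen (v := v) hf hu).exp_right.eq) X)

theorem schur_mul_fc {f : EuclideanSpace ℝ (Fin d) → ℂ} (hf : IsBddMeas f)
    (hv : ∀ a, IsBddMeas (v a)) (X : H →L[ℂ] H) :
    E.schur u v X * E.fc f = E.schur u v (X * E.fc f) :=
  congr($((E.rightMul_commute_schurGen (u := u) hf hv).exp_right.eq) X)

theorem norm_schurGen_le (hu : ∀ a, IsBddMeas (u a)) (hv : ∀ a, IsBddMeas (v a)) {M N : ℝ}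
    (hM : 0 ≤ M) (hN : 0 ≤ N) (huM : ∀ a p, ‖u a p‖ ≤ M) (hvN : ∀ a p, ‖v a p‖ ≤ N) :
    ‖E.schurGen u v‖ ≤ d * (M * N) := by
  refine (norm_sum_le_of_le _ fun a _ => (norm_mul_le _ _).trans (mul_le_mul
    ((norm_leftMul_le _).trans (E.norm_fc_le (hu a) hM (huM a)))
    ((norm_rightMul_le _).trans (E.norm_fc_le (hv a) hN (hvN a))) (norm_nonneg _) hM)).trans ?_
  simp

theorem norm_schur_sub_one_le (hu : ∀ a, IsBddMeas (u a)) (hv : ∀ a, IsBddMeas (v a)) {M N : ℝ}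
    (hM : 0 ≤ M) (hN : 0 ≤ N) (huM : ∀ a p, ‖u a p‖ ≤ M) (hvN : ∀ a p, ‖v a p‖ ≤ N) :
    ‖E.schur u v - 1‖ ≤ Real.exp (d * (M * N)) - 1 :=
  (norm_exp_sub_one_le_exp_norm_sub_one _).trans
    (sub_le_sub_right (Real.exp_le_exp.2 (E.norm_schurGen_le hu hv hM hN huM hvN)) 1)

theorem norm_schur_apply_sub_le (hu : ∀ a, IsBddMeas (u a)) (hv : ∀ a, IsBddMeas (v a)) {M N : ℝ}
    (hM : 0 ≤ M) (hN : 0 ≤ N) (huM : ∀ a p, ‖u a p‖ ≤ M) (hvN : ∀ a p, ‖v a p‖ ≤ N)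
    (X : H →L[ℂ] H) : ‖E.schur u v X - X‖ ≤ (Real.exp (d * (M * N)) - 1) * ‖X‖ := by
  simpa using (E.schur u v - 1).le_of_opNorm_le (E.norm_schur_sub_one_le hu hv hM hN huM hvN) X

theorem norm_schur_apply_le (hu : ∀ a, IsBddMeas (u a)) (hv : ∀ a, IsBddMeas (v a)) {M N : ℝ}
    (hM : 0 ≤ M) (hN : 0 ≤ N) (huM : ∀ a p, ‖u a p‖ ≤ M) (hvN : ∀ a p, ‖v a p‖ ≤ N)
    (X : H →L[ℂ] H) : ‖E.schur u v X‖ ≤ Real.exp (d * (M * N)) * ‖X‖ := by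
  have h1 := E.norm_schur_apply_sub_le hu hv hM hN huM hvN X
  have h2 := norm_le_norm_sub_add (E.schur u v X) X
  linarith

/-- On a set where the left factor of the symbol is constant, the double operator integral is
multiplication from the right. -/
theorem proj_mul_schur (hv : ∀ a, IsBddMeas (v a)) (hu : ∀ a, IsBddMeas (u a))
    {S : Set (EuclideanSpace ℝ (Fin d))} (hS : MeasurableSet S) {c : Fin d → ℂ}
    (h : ∀ a, ∀ p ∈ S, u a p = c a) (X : H →L[ℂ] H) :
    E.proj S * E.schur u v X = E.proj S * X * E.fc fun q => Complex.exp (∑ a, c a * v a q) := by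
  have hs : IsBddMeas fun q => ∑ a, c a * v a q :=
    IsBddMeas.sum _ fun a _ => (hv a).const_mul _
  have h1 : leftMul (E.proj S) * E.schurGen u v =
      leftMul (E.proj S) * rightMul (E.fc fun q => ∑ a, c a * v a q) := by
    rw [E.fc_sum _ fun a _ => (hv a).const_mul _, schurGen]
    ext1 Y
    simp only [mul_apply_eq_comp, leftMul_apply, rightMul_apply, sum_apply, Finset.mul_sum]
    refine Finset.sum_congr rfl fun a _ => ?_
    rw [← mul_assoc, ← (E.fc_comm_proj (hu a) hS).eq, E.fc_mul_proj_const (hu a) hS (h a),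
      E.fc_const_mul (hv a)]
    simp
  have h2 := mul_exp_eq_mul_exp h1 (leftMul_commute_rightMul _ _)
  have h3 := congr($h2 X)
  simp only [mul_apply_eq_comp, leftMul_apply, exp_rightMul_apply] at h3
  rw [schur, h3, E.exp_fc hs, mul_assoc]

/-- On a set where the right factor of the symbol is constant, the double operator integral is
multiplication from the left. -/
theorem schur_mul_proj (hu : ∀ a, IsBddMeas (u a)) (hv : ∀ a, IsBddMeas (v a))
    {S : Set (EuclideanSpace ℝ (Fin d))} (hS : MeasurableSet S) {c : Fin d → ℂ}
    (h : ∀ a, ∀ p ∈ S, v a p = c a) (X : H →L[ℂ] H) :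
    E.schur u v X * E.proj S =
      (E.fc fun q => Complex.exp (∑ a, u a q * c a)) * X * E.proj S := by
  have hs : IsBddMeas fun q => ∑ a, u a q * c a :=
    IsBddMeas.sum _ fun a _ => (hu a).mul (IsBddMeas.const _)
  have h1 : rightMul (E.proj S) * E.schurGen u v =
      rightMul (E.proj S) * leftMul (E.fc fun q => ∑ a, u a q * c a) := by
    rw [E.fc_sum _ fun a _ => (hu a).mul (IsBddMeas.const _), schurGen]
    ext1 Y
    simp only [mul_apply_eq_comp, leftMul_apply, rightMul_apply, sum_apply, Finset.sum_mul]
    refine Finset.sum_congr rfl fun a _ => ?_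
    simp only [mul_comm _ (c a)]
    rw [mul_assoc, mul_assoc, E.fc_mul_proj_const (hv a) hS (h a), E.fc_const_mul (hu a)]
    simp [mul_assoc]
  have h2 := mul_exp_eq_mul_exp h1 (leftMul_commute_rightMul _ _).symm
  have h3 := congr($h2 X)
  simp only [mul_apply_eq_comp, rightMul_apply, exp_leftMul_apply] at h3
  rw [schur, h3, E.exp_fc hs]

end SpectralMeasure

end SchurMultiplier

/-! ### Lattice weights and the partition of momentum space into unit cubes. -/

section Lattice

variable {d : ℕ}

/-- The weight `1 + ‖n‖` of a lattice point. -/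
def wt (n : Fin d → ℤ) : ℝ := 1 + ‖n‖

theorem one_le_wt (n : Fin d → ℤ) : 1 ≤ wt n := le_add_of_nonneg_right (norm_nonneg n)

theorem wt_pos (n : Fin d → ℤ) : 0 < wt n := one_pos.trans_le (one_le_wt n)

/-- A Peetre-type inequality: decay in m - n can be traded for decay in m at the cost of the same
power of `wt n`. -/
theorem wt_le_mul_sub (m n : Fin d → ℤ) : wt m ≤ wt n * wt (m - n) := by
  have h : ‖m‖ ≤ ‖n‖ + ‖m - n‖ := by simpa using norm_add_le n (m - n)
  unfold wt
  nlinarith [norm_nonneg n, norm_nonneg (m - n)]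

theorem wt_sub_comm (m n : Fin d → ℤ) : wt (m - n) = wt (n - m) := by
  rw [wt, wt, norm_sub_rev]

theorem abs_coord_le_wt (n : Fin d → ℤ) (a : Fin d) : |(n a : ℝ)| ≤ wt n - 1 := by
  have := norm_le_pi_norm n a
  rw [Int.norm_eq_abs] at this
  unfold wt
  linarith

theorem wt_le_one_add_sum (n : Fin d → ℤ) : wt n ≤ 1 + ∑ a, |(n a : ℝ)| := by
  refine add_le_add_right ((pi_norm_le_iff_of_nonneg (by positivity)).2 fun a => ?_) 1
  rw [Int.norm_eq_abs]
  exact Finset.single_le_sum (f := fun a => |(n a : ℝ)|) (fun _ _ => abs_nonneg _)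
    (Finset.mem_univ a)

theorem summable_inv_one_add_abs_sq : Summable fun k : ℤ => ((1 + |(k : ℝ)|) ^ 2)⁻¹ := by
  have h : Summable fun n : ℕ => ((1 + (n : ℝ)) ^ 2)⁻¹ := by
    have := (summable_nat_add_iff 1).2 (Real.summable_one_div_nat_pow.2 one_lt_two)
    simpa [add_comm] using this
  refine Summable.of_nat_of_neg ?_ ?_ <;> simpa using h

/-- Since `wt n` dominates every 1 + |n_a|, the power 2d dominates the product of the squares (1 +
|n_a|)², which factors into d convergent one-dimensional series. -/
theorem summable_inv_wt_pow : Summable fun n : Fin d → ℤ => (wt n ^ (2 * d))⁻¹ := by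
  classical
  have hprod : Summable fun n : Fin d → ℤ => ∏ a, ((1 + |(n a : ℝ)|) ^ 2)⁻¹ := by
    refine summable_of_sum_le (c := ∏ _a : Fin d, ∑' k : ℤ, ((1 + |(k : ℝ)|) ^ 2)⁻¹)
      (fun n => Finset.prod_nonneg fun a _ => by positivity) fun s => ?_
    have hsub : s ⊆ Fintype.piFinset fun a => s.image fun n => n a := fun n hn =>
      Fintype.mem_piFinset.2 fun a => Finset.mem_image_of_mem _ hn
    refine (Finset.sum_le_sum_of_subset_of_nonneg hsub fun n _ _ =>
      Finset.prod_nonneg fun a _ => by positivity).trans ?_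
    rw [← Finset.prod_univ_sum (fun a => s.image fun n => n a)
      fun _ (k : ℤ) => ((1 + |(k : ℝ)|) ^ 2)⁻¹]
    refine Finset.prod_le_prod (fun a _ => Finset.sum_nonneg fun k _ => by positivity) fun a _ => ?_
    exact summable_inv_one_add_abs_sq.sum_le_tsum _ fun k _ => by positivity
  refine hprod.of_nonneg_of_le (fun n => inv_nonneg.2 (pow_nonneg (wt_pos n).le _)) fun n => ?_
  rw [Finset.prod_inv_distrib]
  refine inv_anti₀ (Finset.prod_pos fun a _ => by positivity) ?_
  rw [pow_mul]
  have h : ∏ a, (1 + |(n a : ℝ)|) ^ 2 ≤ ∏ _a : Fin d, wt n ^ 2 :=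
    Finset.prod_le_prod (fun a _ => by positivity) fun a _ => by
      have := abs_coord_le_wt n a
      gcongr
      linarith
  simpa using h

/-- The half-open unit cube with lower corner `n`. -/
def cell (n : Fin d → ℤ) : Set (EuclideanSpace ℝ (Fin d)) := {p | ∀ a, ⌊p a⌋ = n a}

theorem measurableSet_cell (n : Fin d → ℤ) : MeasurableSet (cell n) := by
  have : cell n = ⋂ a, (fun p : EuclideanSpace ℝ (Fin d) => ⌊p a⌋) ⁻¹' {n a} := by
    ext p
    simp [cell]
  rw [this]
  refine MeasurableSet.iInter fun a => ?_
  have h : Measurable fun p : EuclideanSpace ℝ (Fin d) => ⌊p a⌋ :=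
    Int.measurable_floor.comp (by fun_prop)
  exact h (measurableSet_singleton _)

theorem disjoint_cell : Pairwise fun m n : Fin d → ℤ => Disjoint (cell m) (cell n) := by
  intro m n hmn
  refine Set.disjoint_left.2 fun p hp hp' => hmn (funext fun a => ?_)
  exact (hp a).symm.trans (hp' a)

theorem iUnion_cell : ⋃ n : Fin d → ℤ, cell n = Set.univ :=
  Set.eq_univ_of_forall fun p => Set.mem_iUnion.2 ⟨fun a => ⌊p a⌋, fun _ => rfl⟩

theorem abs_sub_le_of_mem_cell {n : Fin d → ℤ} {p : EuclideanSpace ℝ (Fin d)} (hp : p ∈ cell n)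
    (a : Fin d) : |p a - n a| ≤ 1 := by
  rw [← hp a, abs_le]
  constructor <;> linarith [Int.floor_le (p a), Int.lt_floor_add_one (p a)]

theorem abs_le_wt_of_mem_cell {n : Fin d → ℤ} {p : EuclideanSpace ℝ (Fin d)} (hp : p ∈ cell n)
    (a : Fin d) : |p a| ≤ wt n := by
  have h1 := abs_sub_le_of_mem_cell hp a
  have h2 := abs_coord_le_wt n a
  have h3 : |p a| ≤ |p a - n a| + |(n a : ℝ)| := by simpa using abs_add_le (p a - n a) (n a)
  linarith

theorem norm_sq_le_of_mem_cell {n : Fin d → ℤ} {p : EuclideanSpace ℝ (Fin d)} (hp : p ∈ cell n) :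
    1 + ‖p‖ ^ 2 ≤ (1 + d) * wt n ^ 2 := by
  rw [EuclideanSpace.norm_sq_eq]
  have h1 : ∑ a, ‖p a‖ ^ 2 ≤ ∑ _a : Fin d, wt n ^ 2 := Finset.sum_le_sum fun a _ => by
    have := abs_le_wt_of_mem_cell hp a
    rw [Real.norm_eq_abs]
    gcongr
  have h2 : 1 ≤ wt n ^ 2 := one_le_pow₀ (one_le_wt n)
  simp only [Finset.sum_const, Finset.card_univ, Fintype.card_fin, nsmul_eq_mul] at h1
  linarith

end Lattice

/-! ### Rapidly decaying vectors and matrices indexed by cubes. -/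

section RapidDecay

variable {d : ℕ} {H : Type*} [NormedAddCommGroup H] [InnerProductSpace ℂ H] [CompleteSpace H]

namespace SpectralMeasure

variable (E : SpectralMeasure d H)

/-- The spectral projection of a unit cube. -/
def block (n : Fin d → ℤ) : H →L[ℂ] H := E.proj (cell n)

theorem block_mul_self (n : Fin d → ℤ) : E.block n * E.block n = E.block n :=
  E.proj_mul_self (measurableSet_cell n)

theorem block_mul_of_ne {m n : Fin d → ℤ} (h : m ≠ n) : E.block m * E.block n = 0 :=
  E.proj_mul_of_disjoint (measurableSet_cell m) (measurableSet_cell n) (disjoint_cell h)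

theorem norm_block_le (n : Fin d → ℤ) : ‖E.block n‖ ≤ 1 := E.norm_proj_le (measurableSet_cell n)

theorem norm_block_apply_le (n : Fin d → ℤ) (ψ : H) : ‖E.block n ψ‖ ≤ ‖ψ‖ :=
  E.norm_proj_apply_le (measurableSet_cell n) ψ

theorem hasSum_block (ψ : H) : HasSum (fun n => E.block n ψ) ψ :=
  E.hasSum_proj measurableSet_cell disjoint_cell iUnion_cell ψ

theorem eq_of_block_eq {φ ψ : H} (h : ∀ n, E.block n φ = E.block n ψ) : φ = ψ :=
  E.eq_of_proj_eq measurableSet_cell disjoint_cell iUnion_cell h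

theorem eq_of_mul_block_eq {A A' : H →L[ℂ] H} (h : ∀ n, A * E.block n = A' * E.block n) : A = A' :=
  E.eq_of_mul_proj_eq measurableSet_cell disjoint_cell iUnion_cell h

/-- Vectors whose spectral components decay rapidly. -/
def Rapid (ψ : H) : Prop := ∀ k : ℕ, ∃ C, ∀ n, wt n ^ k * ‖E.block n ψ‖ ≤ C

/-- Matrices of operators between the spectral subspaces of the unit cubes with rapid decay off
the diagonal and at most polynomial growth along it. -/
structure RapidMat (K : (Fin d → ℤ) → (Fin d → ℤ) → (H →L[ℂ] H)) : Prop where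
  block_mul : ∀ m n, E.block m * K m n = K m n
  mul_block : ∀ m n, K m n * E.block n = K m n
  bound : ∃ a : ℕ, ∀ k : ℕ, ∃ C, ∀ m n, wt (m - n) ^ k * ‖K m n‖ ≤ C * wt n ^ a

/-- The operator given by a rapidly decaying matrix. -/
def apply (K : (Fin d → ℤ) → (Fin d → ℤ) → (H →L[ℂ] H)) (ψ : H) : H :=
  ∑' x : (Fin d → ℤ) × (Fin d → ℤ), K x.1 x.2 ψ

variable {E} {K : (Fin d → ℤ) → (Fin d → ℤ) → (H →L[ℂ] H)} {ψ : H}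

theorem rapid_block (n : Fin d → ℤ) (ψ : H) : E.Rapid (E.block n ψ) := by
  intro k
  refine ⟨wt n ^ k * ‖ψ‖, fun m => ?_⟩
  rw [← mul_apply_eq_comp]
  rcases eq_or_ne m n with rfl | h
  · rw [E.block_mul_self]
    gcongr
    · exact pow_nonneg (wt_pos m).le _
    · exact E.norm_block_apply_le _ _
  · rw [E.block_mul_of_ne h]
    simpa using mul_nonneg (pow_nonneg (wt_pos n).le _) (norm_nonneg ψ)

theorem Rapid.norm_le (h : E.Rapid ψ) (k : ℕ) :
    ∃ C, 0 ≤ C ∧ ∀ n, ‖E.block n ψ‖ ≤ C * (wt n ^ k)⁻¹ := by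
  obtain ⟨C, hC⟩ := h k
  refine ⟨C, (mul_nonneg (pow_nonneg (wt_pos 0).le _) (norm_nonneg _)).trans (hC 0), fun n => ?_⟩
  rw [← div_eq_mul_inv, le_div_iff₀ (pow_pos (wt_pos n) _), mul_comm]
  exact hC n

namespace RapidMat

theorem norm_le (h : E.RapidMat K) :
    ∃ a : ℕ, ∀ k : ℕ, ∃ C, 0 ≤ C ∧ ∀ m n, ‖K m n‖ ≤ C * wt n ^ a * (wt (m - n) ^ k)⁻¹ := by
  obtain ⟨a, ha⟩ := h.bound
  refine ⟨a, fun k => ?_⟩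
  obtain ⟨C, hC⟩ := ha k
  refine ⟨C, ?_, fun m n => ?_⟩
  · have := (mul_nonneg (pow_nonneg (wt_pos _).le _) (norm_nonneg _)).trans (hC 0 0)
    exact nonneg_of_mul_nonneg_left this (pow_pos (wt_pos _) _)
  · rw [← div_eq_mul_inv, le_div_iff₀ (pow_pos (wt_pos _) _), mul_comm]
    exact hC m n

theorem norm_apply_le (h : E.RapidMat K) (m n : Fin d → ℤ) (ψ : H) :
    ‖K m n ψ‖ ≤ ‖K m n‖ * ‖E.block n ψ‖ := by
  conv_lhs => rw [← h.mul_block]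
  exact (K m n).le_opNorm _

theorem exists_norm_mul_le (h : E.RapidMat K) (hψ : E.Rapid ψ) (j : ℕ) :
    ∃ C, 0 ≤ C ∧ ∀ m n, ‖K m n‖ * ‖E.block n ψ‖ ≤ C * ((wt m ^ j)⁻¹ * (wt n ^ j)⁻¹) := by
  obtain ⟨a, ha⟩ := h.norm_le
  obtain ⟨C, hC0, hC⟩ := ha j
  obtain ⟨C', hC0', hC'⟩ := hψ.norm_le (a + j + j)
  refine ⟨C * C', mul_nonneg hC0 hC0', fun m n => ?_⟩
  have h1 := mul_le_mul (hC m n) (hC' n) (norm_nonneg _)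
    (mul_nonneg (mul_nonneg hC0 (pow_nonneg (wt_pos n).le _))
      (inv_nonneg.2 (pow_nonneg (wt_pos _).le _)))
  refine h1.trans ?_
  have hn := wt_pos n
  have hm := wt_pos m
  have hmn := wt_pos (m - n)
  have h2 : (wt (m - n) ^ j)⁻¹ * (wt n ^ j)⁻¹ ≤ (wt m ^ j)⁻¹ := by
    rw [← mul_inv, ← mul_pow]
    have := wt_le_mul_sub m n
    rw [mul_comm] at this
    gcongr
  calc C * wt n ^ a * (wt (m - n) ^ j)⁻¹ * (C' * (wt n ^ (a + j + j))⁻¹)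
      = C * C' * (((wt (m - n) ^ j)⁻¹ * (wt n ^ j)⁻¹) * (wt n ^ j)⁻¹) := by
        rw [pow_add, pow_add]
        field_simp
    _ ≤ _ := by gcongr

theorem summable_norm (h : E.RapidMat K) (hψ : E.Rapid ψ) :
    Summable fun x : (Fin d → ℤ) × (Fin d → ℤ) => ‖K x.1 x.2‖ * ‖E.block x.2 ψ‖ := by
  obtain ⟨C, _, hC⟩ := h.exists_norm_mul_le hψ (2 * d)
  refine Summable.of_nonneg_of_le (fun x => by positivity) (fun x => hC x.1 x.2) ?_
  exact (summable_inv_wt_pow.mul_of_nonneg summable_inv_wt_pow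
    (fun n => inv_nonneg.2 (pow_nonneg (wt_pos n).le _))
    fun n => inv_nonneg.2 (pow_nonneg (wt_pos n).le _)).mul_left C

theorem summable (h : E.RapidMat K) (hψ : E.Rapid ψ) :
    Summable fun x : (Fin d → ℤ) × (Fin d → ℤ) => K x.1 x.2 ψ :=
  Summable.of_norm_bounded (h.summable_norm hψ) fun x => h.norm_apply_le x.1 x.2 ψ

theorem summable_row (h : E.RapidMat K) (hψ : E.Rapid ψ) (m : Fin d → ℤ) :
    Summable fun n => K m n ψ :=
  (h.summable hψ).prod_factor m

theorem block_apply (h : E.RapidMat K) (hψ : E.Rapid ψ) (m : Fin d → ℤ) :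
    E.block m (apply K ψ) = ∑' n, K m n ψ := by
  rw [apply, (h.summable hψ).tsum_prod, ContinuousLinearMap.map_tsum _ (h.summable hψ).prod,
    tsum_eq_single m]
  · rw [ContinuousLinearMap.map_tsum _ (h.summable_row hψ m)]
    exact tsum_congr fun n => congr($(h.block_mul m n) ψ)
  · intro m' hm
    rw [ContinuousLinearMap.map_tsum _ (h.summable_row hψ m')]
    refine (tsum_congr fun n => ?_).trans tsum_zero
    rw [← h.block_mul, ← mul_apply_eq_comp, ← mul_assoc, E.block_mul_of_ne hm.symm, zero_mul]
    rfl

theorem rapid_apply (h : E.RapidMat K) (hψ : E.Rapid ψ) : E.Rapid (apply K ψ) := by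
  intro k
  -- The k powers are the decay to be proved in m; the 2d powers make the sum over n converge.
  obtain ⟨C, hC0, hC⟩ := h.exists_norm_mul_le hψ (2 * d + k)
  have hs : Summable fun n : Fin d → ℤ => (wt n ^ (2 * d + k))⁻¹ := by
    refine Summable.of_nonneg_of_le (fun n => inv_nonneg.2 (pow_nonneg (wt_pos n).le _))
      (fun n => ?_) summable_inv_wt_pow
    exact inv_anti₀ (pow_pos (wt_pos n) _) (pow_le_pow_right₀ (one_le_wt n) (Nat.le_add_right _ _))
  refine ⟨C * ∑' n : Fin d → ℤ, (wt n ^ (2 * d + k))⁻¹, fun m => ?_⟩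
  rw [h.block_apply hψ]
  have h1 : ‖∑' n, K m n ψ‖ ≤ ∑' n, C * ((wt m ^ (2 * d + k))⁻¹ * (wt n ^ (2 * d + k))⁻¹) :=
    tsum_of_norm_bounded ((hs.mul_left _).mul_left C).hasSum fun n =>
      (h.norm_apply_le m n ψ).trans (hC m n)
  rw [tsum_mul_left, tsum_mul_left] at h1
  have h2 : wt m ^ k * (wt m ^ (2 * d + k))⁻¹ ≤ 1 := by
    rw [← div_eq_mul_inv, div_le_one (pow_pos (wt_pos m) _)]
    exact pow_le_pow_right₀ (one_le_wt m) (Nat.le_add_left _ _)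
  have h3 : 0 ≤ C * ∑' n : Fin d → ℤ, (wt n ^ (2 * d + k))⁻¹ :=
    mul_nonneg hC0 (tsum_nonneg fun n => inv_nonneg.2 (pow_nonneg (wt_pos n).le _))
  calc wt m ^ k * ‖∑' n, K m n ψ‖
      ≤ wt m ^ k * (C * ((wt m ^ (2 * d + k))⁻¹ * ∑' n : Fin d → ℤ, (wt n ^ (2 * d + k))⁻¹)) :=
        mul_le_mul_of_nonneg_left h1 (pow_nonneg (wt_pos m).le _)
    _ = wt m ^ k * (wt m ^ (2 * d + k))⁻¹ * (C * ∑' n : Fin d → ℤ, (wt n ^ (2 * d + k))⁻¹) := by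
        ring
    _ ≤ _ := mul_le_of_le_one_left h3 h2

/-- Along a fixed row, decay in m - n is decay in n, and a extra powers of it beat the polynomial
growth `wt n ^ a`. -/
theorem exists_row_norm_le (h : E.RapidMat K) (m : Fin d → ℤ) (j : ℕ) :
    ∃ C, ∀ n, ‖K m n‖ ≤ C * (wt n ^ j)⁻¹ := by
  obtain ⟨a, ha⟩ := h.norm_le
  obtain ⟨C, hC0, hC⟩ := ha (a + j)
  refine ⟨C * wt m ^ (a + j), fun n => (hC m n).trans ?_⟩
  have hn := wt_pos n
  have hm := wt_pos m
  have hmn := wt_pos (m - n)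
  have h1 : wt n ^ (a + j) ≤ wt m ^ (a + j) * wt (m - n) ^ (a + j) := by
    rw [← mul_pow, wt_sub_comm]
    have := wt_le_mul_sub n m
    gcongr
  rw [mul_assoc, mul_assoc]
  refine mul_le_mul_of_nonneg_left ?_ hC0
  rw [← div_eq_mul_inv, ← div_eq_mul_inv, div_le_div_iff₀ (pow_pos hmn _) (pow_pos hn _), ← pow_add]
  exact h1

theorem exists_col_norm_le (h : E.RapidMat K) (r : Fin d → ℤ) : ∃ C, ∀ n, ‖K n r‖ ≤ C := by
  obtain ⟨a, ha⟩ := h.norm_le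
  obtain ⟨C, hC0, hC⟩ := ha 0
  exact ⟨C * wt r ^ a, fun n => by simpa using hC n r⟩

end RapidMat

end SpectralMeasure

end RapidDecay

/-! ### Smooth orbits and decay of spectral components. -/

section Orbits

open Filter Topology Asymptotics

/-- The bootstrap behind both decay theorems: one factor of the weight is paid for by one derivative
`D a`, and as `S` is stable under derivatives this can be repeated k times. -/
theorem exists_pow_mul_le {d : ℕ} {Y ι : Type*} {w : ι → ℝ} (hw : ∀ i, 0 ≤ w i) {N : ι → Y → ℝ}
    {S : Set Y} {D : Fin d → Y → Y} (hD : ∀ y ∈ S, ∀ a, D a y ∈ S)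
    (hN : ∀ y ∈ S, ∃ C, ∀ i, N i y ≤ C) {c : ℝ} (hc : 0 ≤ c)
    (h : ∀ y ∈ S, ∀ i, w i * N i y ≤ ∑ a, N i (D a y) + c * N i y) (k : ℕ) :
    ∀ y ∈ S, ∃ C, ∀ i, w i ^ k * N i y ≤ C := by
  induction k with
  | zero => simpa using hN
  | succ k ih =>
    intro y hy
    obtain ⟨C, hC⟩ := ih y hy
    choose C' hC' using fun a => ih (D a y) (hD y hy a)
    refine ⟨∑ a, C' a + c * C, fun i => ?_⟩
    calc w i ^ (k + 1) * N i y = w i ^ k * (w i * N i y) := by ring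
      _ ≤ w i ^ k * (∑ a, N i (D a y) + c * N i y) :=
        mul_le_mul_of_nonneg_left (h y hy i) (pow_nonneg (hw i) k)
      _ = ∑ a, w i ^ k * N i (D a y) + c * (w i ^ k * N i y) := by
        rw [mul_add, Finset.mul_sum]
        ring
      _ ≤ _ := add_le_add (Finset.sum_le_sum fun a _ => hC' a i)
        (mul_le_mul_of_nonneg_left (hC i) hc)

section Abstract

variable {d : ℕ} {Y : Type*} [NormedAddCommGroup Y] [NormedSpace ℂ Y]

theorem fderiv_orbit {W : EuclideanSpace ℝ (Fin d) → (Y →L[ℂ] Y)}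
    (hW : ∀ x z y, W (x + z) y = W x (W z y)) {y : Y} (hy : ContDiff ℝ ∞ fun x => W x y)
    (x h : EuclideanSpace ℝ (Fin d)) :
    fderiv ℝ (fun x => W x y) x h = W x (fderiv ℝ (fun x => W x y) 0 h) := by
  have hd : Differentiable ℝ fun x => W x y := hy.differentiable (by simp)
  have h1 : HasFDerivAt (fun z => W (x + z) y) (fderiv ℝ (fun x => W x y) x) 0 := by
    have h3 : HasFDerivAt (fun x => W x y) (fderiv ℝ (fun x => W x y) x) (x + 0) := by
      rw [add_zero]
      exact (hd x).hasFDerivAt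
    exact (hasFDerivAt_comp_add_left x).2 h3
  have h2 : HasFDerivAt (fun z => W x (W z y))
      (((W x).restrictScalars ℝ).comp (fderiv ℝ (fun x => W x y) 0)) 0 :=
    ((W x).restrictScalars ℝ).hasFDerivAt.comp 0 (hd 0).hasFDerivAt
  simp only [hW] at h1
  exact congr($(h1.unique h2) h)

/-- By the group law the derivative of an orbit at x is the translate of its derivative at 0, so
derivative vectors have smooth orbits again. This is the stability required by `exists_pow_mul_le`.
-/
theorem contDiff_orbit_fderiv {W : EuclideanSpace ℝ (Fin d) → (Y →L[ℂ] Y)}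
    (hW : ∀ x z y, W (x + z) y = W x (W z y)) {y : Y} (hy : ContDiff ℝ ∞ fun x => W x y)
    (h : EuclideanSpace ℝ (Fin d)) :
    ContDiff ℝ ∞ fun x => W x (fderiv ℝ (fun x => W x y) 0 h) := by
  simp only [← fderiv_orbit hW hy]
  exact (hy.fderiv_right (m := ∞) (by simp)).clm_apply contDiff_const

theorem hasDerivAt_orbit {W : EuclideanSpace ℝ (Fin d) → (Y →L[ℂ] Y)} {y : Y}
    (hy : ContDiff ℝ ∞ fun x => W x y) (h : EuclideanSpace ℝ (Fin d)) :
    HasDerivAt (fun t : ℝ => W (t • h) y) (fderiv ℝ (fun x => W x y) 0 h) 0 := by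
  have hd : Differentiable ℝ fun x => W x y := hy.differentiable (by simp)
  have h1 : HasDerivAt (fun t : ℝ => t • h) h 0 := by
    simpa using (hasDerivAt_id (0 : ℝ)).smul_const h
  have h2 : HasFDerivAt (fun x => W x y) (fderiv ℝ (fun x => W x y) 0) ((0 : ℝ) • h) := by
    rw [zero_smul]
    exact (hd 0).hasFDerivAt
  exact h2.comp_hasDerivAt 0 h1

end Abstract

/-- For |x| ≤ 1 this is Taylor's bound; for |x| ≥ 1 the crude estimate |x| + |x| ≤ 2x² suffices. -/
theorem norm_cexp_I_mul_sub_one_sub_le (x : ℝ) :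
    ‖Complex.exp (Complex.I * (x : ℂ)) - 1 - Complex.I * (x : ℂ)‖ ≤ 2 * x ^ 2 := by
  have hx : ‖Complex.I * (x : ℂ)‖ = |x| := by simp
  rcases le_total |x| 1 with h | h
  · refine (Complex.norm_exp_sub_one_sub_id_le (by rwa [hx])).trans ?_
    rw [hx, sq_abs]
    nlinarith [sq_nonneg x]
  · refine (norm_sub_le _ _).trans ?_
    have := norm_cexp_I_mul_sub_one_le x
    rw [hx]
    nlinarith [sq_abs x]

variable {d : ℕ}

theorem exists_bilin_bound (B : LinearMap.BilinForm ℝ (EuclideanSpace ℝ (Fin d))) :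
    ∃ c, 0 ≤ c ∧ ∀ p x, |B p x| ≤ c * ‖p‖ * ‖x‖ := by
  let B' : EuclideanSpace ℝ (Fin d) →L[ℝ] EuclideanSpace ℝ (Fin d) →L[ℝ] ℝ :=
    LinearMap.toContinuousLinearMap
      ((LinearMap.toContinuousLinearMap :
        (EuclideanSpace ℝ (Fin d) →ₗ[ℝ] ℝ) ≃ₗ[ℝ] _).toLinearMap ∘ₗ B)
  exact ⟨‖B'‖, B'.opNorm_nonneg, fun p x => B'.le_opNorm₂ p x⟩

theorem norm_le_of_mem_cell {n : Fin d → ℤ} {p : EuclideanSpace ℝ (Fin d)} (hp : p ∈ cell n) :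
    ‖p‖ ≤ (1 + d) * wt n := by
  have h := norm_sq_le_of_mem_cell hp
  have hn := wt_pos n
  refine le_of_sq_le_sq ?_ (by positivity)
  have : (1 + d : ℝ) * wt n ^ 2 ≤ ((1 + d) * wt n) ^ 2 := by
    rw [mul_pow]
    gcongr
    nlinarith [(Nat.cast_nonneg d : (0 : ℝ) ≤ d)]
  linarith

theorem exists_bilin_cell_bound (B : LinearMap.BilinForm ℝ (EuclideanSpace ℝ (Fin d))) :
    ∃ c, 0 ≤ c ∧ ∀ n, ∀ p ∈ cell n, ∀ x, |B p x| ≤ c * ‖x‖ * wt n := by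
  obtain ⟨c, hc0, hc⟩ := exists_bilin_bound B
  refine ⟨c * (1 + d), by positivity, fun n p hp x => (hc p x).trans ?_⟩
  calc c * ‖p‖ * ‖x‖ ≤ c * ((1 + d) * wt n) * ‖x‖ := by
        gcongr
        exact norm_le_of_mem_cell hp
    _ = _ := by ring

/-- The character `p ↦ exp (i B(p, x))`. -/
def phase (B : LinearMap.BilinForm ℝ (EuclideanSpace ℝ (Fin d))) (x p : EuclideanSpace ℝ (Fin d)) :
    ℂ := Complex.exp (Complex.I * (B p x : ℂ))

theorem isBddMeas_phase (B : LinearMap.BilinForm ℝ (EuclideanSpace ℝ (Fin d)))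
    (x : EuclideanSpace ℝ (Fin d)) : IsBddMeas (phase B x) :=
  isBddMeas_cexp_I_mul (measurable_bilin_left B x)

theorem isBddMeas_indicator_of_le {f : EuclideanSpace ℝ (Fin d) → ℂ} (hf : Measurable f)
    {n : Fin d → ℤ} {C : ℝ} (hC : 0 ≤ C) (h : ∀ p ∈ cell n, ‖f p‖ ≤ C) :
    IsBddMeas ((cell n).indicator f) :=
  IsBddMeas.of_bound (hf.indicator (measurableSet_cell n)) (C := C) fun p => by
    by_cases hp : p ∈ cell n
    · simpa [hp] using h p hp
    · simpa [hp] using hC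

/-- The infinitesimal character `p ↦ i B(p, x)`, cut off to a unit cube. -/
def cellLin (B : LinearMap.BilinForm ℝ (EuclideanSpace ℝ (Fin d))) (n : Fin d → ℤ)
    (x : EuclideanSpace ℝ (Fin d)) : EuclideanSpace ℝ (Fin d) → ℂ :=
  (cell n).indicator fun p => Complex.I * (B p x : ℂ)

theorem measurable_I_mul_bilin (B : LinearMap.BilinForm ℝ (EuclideanSpace ℝ (Fin d)))
    (x : EuclideanSpace ℝ (Fin d)) : Measurable fun p => Complex.I * (B p x : ℂ) :=
  (Complex.measurable_ofReal.comp (measurable_bilin_left B x)).const_mul _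

theorem isBddMeas_cellLin (B : LinearMap.BilinForm ℝ (EuclideanSpace ℝ (Fin d))) (n : Fin d → ℤ)
    (x : EuclideanSpace ℝ (Fin d)) : IsBddMeas (cellLin B n x) := by
  obtain ⟨c, hc0, hc⟩ := exists_bilin_cell_bound B
  refine isBddMeas_indicator_of_le (measurable_I_mul_bilin B x) (C := c * ‖x‖ * wt n)
    (mul_nonneg (mul_nonneg hc0 (norm_nonneg x)) (wt_pos n).le) fun p hp => ?_
  simpa using hc n p hp x

theorem isBddMeas_cell_coord_sub (n : Fin d → ℤ) (a : Fin d) :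
    IsBddMeas ((cell n).indicator fun p => (p a : ℂ) - n a) :=
  isBddMeas_indicator_of_le ((Complex.measurable_ofReal.comp (by fun_prop)).sub_const _) zero_le_one
    fun p hp => by
      have := abs_sub_le_of_mem_cell hp a
      rw [← Real.norm_eq_abs, ← Complex.norm_real] at this
      simpa using this

variable {H : Type*} [NormedAddCommGroup H] [InnerProductSpace ℂ H] [CompleteSpace H]

namespace SpectralMeasure

variable (E : SpectralMeasure d H) (B : LinearMap.BilinForm ℝ (EuclideanSpace ℝ (Fin d)))

/-- The unitary group `x ↦ exp (i B(P, x))` of the spectral measure. -/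
def trans (x : EuclideanSpace ℝ (Fin d)) : H →L[ℂ] H := E.fc (phase B x)

theorem trans_add (x y : EuclideanSpace ℝ (Fin d)) :
    E.trans B (x + y) = E.trans B x * E.trans B y := by
  rw [trans, trans, trans, ← E.fc_mul (isBddMeas_phase B x) (isBddMeas_phase B y)]
  congr 1
  ext p
  rw [phase, phase, phase, ← Complex.exp_add, map_add]
  push_cast
  ring_nf

theorem trans_zero : E.trans B 0 = 1 := by
  have : phase B 0 = fun _ => (1 : ℂ) := by
    ext p
    simp [phase]
  rw [trans, this, E.fc_const, one_smul]

theorem trans_mul_trans_neg (x : EuclideanSpace ℝ (Fin d)) : E.trans B x * E.trans B (-x) = 1 := by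
  rw [← E.trans_add, add_neg_cancel, E.trans_zero]

theorem trans_neg_mul_trans (x : EuclideanSpace ℝ (Fin d)) : E.trans B (-x) * E.trans B x = 1 := by
  rw [← E.trans_add, neg_add_cancel, E.trans_zero]

theorem norm_phase (x p : EuclideanSpace ℝ (Fin d)) : ‖phase B x p‖ = 1 := by
  rw [phase, mul_comm, Complex.norm_exp_ofReal_mul_I]

theorem norm_trans_le (x : EuclideanSpace ℝ (Fin d)) : ‖E.trans B x‖ ≤ 1 :=
  E.norm_fc_le (isBddMeas_phase B x) zero_le_one fun p => (norm_phase B x p).le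

theorem trans_comm_proj (x : EuclideanSpace ℝ (Fin d)) {S : Set (EuclideanSpace ℝ (Fin d))}
    (hS : MeasurableSet S) : Commute (E.trans B x) (E.proj S) :=
  E.fc_comm_proj (isBddMeas_phase B x) hS

theorem trans_comm_block (x : EuclideanSpace ℝ (Fin d)) (n : Fin d → ℤ) :
    Commute (E.trans B x) (E.block n) :=
  E.trans_comm_proj B x (measurableSet_cell n)

/-- The generator in direction `x` of the unitary group, cut off to a unit cube. -/
def gen (n : Fin d → ℤ) (x : EuclideanSpace ℝ (Fin d)) : H →L[ℂ] H := E.fc (cellLin B n x)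

theorem fc_indicator_mul_block {f : EuclideanSpace ℝ (Fin d) → ℂ} {n : Fin d → ℤ}
    (hf : IsBddMeas ((cell n).indicator f)) :
    E.fc ((cell n).indicator f) * E.block n = E.fc ((cell n).indicator f) := by
  rw [block, E.fc_mul_proj hf (measurableSet_cell n), Set.indicator_indicator, Set.inter_self]

theorem block_mul_fc_indicator {f : EuclideanSpace ℝ (Fin d) → ℂ} {n : Fin d → ℤ}
    (hf : IsBddMeas ((cell n).indicator f)) :
    E.block n * E.fc ((cell n).indicator f) = E.fc ((cell n).indicator f) := by
  rw [block, ← (E.fc_comm_proj hf (measurableSet_cell n)).eq]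
  exact E.fc_indicator_mul_block hf

theorem gen_smul (n : Fin d → ℤ) (t : ℝ) (x : EuclideanSpace ℝ (Fin d)) :
    E.gen B n (t • x) = t • E.gen B n x := by
  rw [gen, gen, ← Complex.coe_smul, ← E.fc_const_mul (isBddMeas_cellLin B n x)]
  congr 1
  ext p
  by_cases hp : p ∈ cell n
  · simp [cellLin, hp]
    ring
  · simp [cellLin, hp]

/-- Second-order Taylor expansion of the group on one cube, where P is bounded by a multiple of `wt
n`; the constant is the same for all cubes. -/
theorem exists_norm_trans_sub_le : ∃ c, 0 ≤ c ∧ ∀ n x,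
    ‖E.trans B x * E.block n - E.block n - E.gen B n x‖ ≤ c * (‖x‖ * wt n) ^ 2 := by
  obtain ⟨c, hc0, hc⟩ := exists_bilin_cell_bound B
  refine ⟨2 * c ^ 2, by positivity, fun n x => ?_⟩
  have hp := (isBddMeas_phase B x).indicator (measurableSet_cell n)
  have h1 := IsBddMeas.indicator_one (measurableSet_cell n)
  rw [gen, trans, block, E.fc_mul_proj (isBddMeas_phase B x) (measurableSet_cell n),
    ← E.fc_indicator_one (measurableSet_cell n), ← E.fc_sub hp h1]
  refine E.norm_fc_sub_fc_le (hp.sub h1) (isBddMeas_cellLin B n x) (by positivity) fun p => ?_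
  by_cases hp : p ∈ cell n
  · simp only [cellLin, hp, Set.indicator_of_mem, Pi.one_apply]
    refine (norm_cexp_I_mul_sub_one_sub_le _).trans ?_
    have := hc n p hp x
    calc 2 * B p x ^ 2 = 2 * |B p x| ^ 2 := by rw [sq_abs]
      _ ≤ 2 * (c * ‖x‖ * wt n) ^ 2 := by gcongr
      _ = _ := by ring
  · simp only [cellLin, hp, not_false_eq_true, Set.indicator_of_notMem, sub_zero, norm_zero]
    positivity

theorem hasDerivAt_trans_mul_block (n : Fin d → ℤ) (x : EuclideanSpace ℝ (Fin d)) :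
    HasDerivAt (fun t : ℝ => E.trans B (t • x) * E.block n) (E.gen B n x) 0 := by
  obtain ⟨c, hc0, hc⟩ := E.exists_norm_trans_sub_le B
  rw [hasDerivAt_iff_isLittleO]
  have h : (fun t : ℝ => E.trans B (t • x) * E.block n - E.block n - t • E.gen B n x)
      =O[𝓝 0] fun t : ℝ => t ^ 2 := by
    refine IsBigO.of_bound (c * (‖x‖ * wt n) ^ 2) (Eventually.of_forall fun t => ?_)
    rw [← E.gen_smul]
    refine (hc n (t • x)).trans (le_of_eq ?_)
    rw [norm_smul, norm_pow]
    ring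
  have h2 := h.trans_isLittleO (isLittleO_pow_id one_lt_two)
  simpa [E.trans_zero] using h2

/-- On a unit cube the coordinate p_a is n_a up to an error of norm at most one, so a derivative in
this direction measures n_a. -/
theorem gen_eq_of_forall {n : Fin d → ℤ} {x : EuclideanSpace ℝ (Fin d)} {a : Fin d}
    (h : ∀ p, B p x = p a) : E.gen B n x =
      Complex.I • ((n a : ℂ) • E.block n + E.fc ((cell n).indicator fun p => (p a : ℂ) - n a)) := by
  have h1 := IsBddMeas.indicator_one (measurableSet_cell n)
  have h2 := isBddMeas_cell_coord_sub n a
  rw [gen, block, ← E.fc_indicator_one (measurableSet_cell n), ← E.fc_const_mul h1,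
    ← E.fc_add (h1.const_mul _) h2, ← E.fc_const_mul ((h1.const_mul _).add h2)]
  congr 1
  ext p
  by_cases hp : p ∈ cell n <;> simp [cellLin, hp, h]

theorem norm_fc_coord_sub_le (n : Fin d → ℤ) (a : Fin d) :
    ‖E.fc ((cell n).indicator fun p => (p a : ℂ) - n a)‖ ≤ 1 := by
  refine E.norm_fc_le (isBddMeas_cell_coord_sub n a) zero_le_one fun p => ?_
  by_cases hp : p ∈ cell n
  · have := abs_sub_le_of_mem_cell hp a
    rw [← Real.norm_eq_abs, ← Complex.norm_real] at this
    simpa [hp] using this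
  · simp [hp]

variable {B}

/-- Nondegeneracy enters here: every coordinate of momentum is the pairing with some translation, so
derivatives of orbits control all coordinates. -/
theorem exists_dual_basis (hB : B.Nondegenerate) (hs : B.IsSymm) :
    ∃ x : Fin d → EuclideanSpace ℝ (Fin d), ∀ a p, B p (x a) = p a := by
  refine ⟨fun a => (LinearMap.BilinForm.toDual B hB).symm (EuclideanSpace.proj a).toLinearMap,
    fun a p => ?_⟩
  rw [← hs.eq]
  simp [LinearMap.BilinForm.apply_toDual_symm_apply]

variable {E}

/-- Vectors with a smooth orbit have rapidly decaying spectral components. -/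
theorem rapid_of_contDiff (hB : B.Nondegenerate) (hs : B.IsSymm) {ψ : H}
    (hψ : ContDiff ℝ ∞ fun x => E.trans B x ψ) : E.Rapid ψ := by
  obtain ⟨x, hx⟩ := exists_dual_basis hB hs
  have hW : ∀ x z y, E.trans B (x + z) y = E.trans B x (E.trans B z y) := fun x z y => by
    rw [E.trans_add]
    rfl
  -- `D a` differentiates the orbit along the dual vector `x a`. In the constant 1 + d, the 1 is the
  -- one in `wt n` and each coordinate adds 1 for its distance from n_a.
  refine fun k => exists_pow_mul_le (w := wt) (fun n => (wt_pos n).le)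
    (N := fun n φ => ‖E.block n φ‖) (S := {φ | ContDiff ℝ ∞ fun x => E.trans B x φ})
    (D := fun a φ => fderiv ℝ (fun x => E.trans B x φ) 0 (x a)) (c := 1 + d)
    (fun φ hφ a => contDiff_orbit_fderiv hW hφ (x a))
    (fun φ _ => ⟨‖φ‖, fun n => E.norm_block_apply_le n φ⟩) (by positivity) (fun φ hφ n => ?_) k ψ hψ
  have key : ∀ a, |(n a : ℝ)| * ‖E.block n φ‖ ≤
      ‖E.block n (fderiv ℝ (fun x => E.trans B x φ) 0 (x a))‖ + ‖E.block n φ‖ := by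
    intro a
    have h1 : HasDerivAt (fun t : ℝ => E.block n (E.trans B (t • x a) φ))
        (E.block n (fderiv ℝ (fun x => E.trans B x φ) 0 (x a))) 0 :=
      ((E.block n).restrictScalars ℝ).hasFDerivAt.comp_hasDerivAt 0 (hasDerivAt_orbit hφ (x a))
    have h2 : HasDerivAt (fun t : ℝ => (E.trans B (t • x a) * E.block n) φ)
        (E.gen B n (x a) φ) 0 :=
      ((ContinuousLinearMap.apply ℂ H φ).restrictScalars ℝ).hasFDerivAt.comp_hasDerivAt 0
        (E.hasDerivAt_trans_mul_block B n (x a))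
    simp only [(E.trans_comm_block B _ n).eq, mul_apply_eq_comp] at h2
    rw [h1.unique h2, E.gen_eq_of_forall B (hx a)]
    have h3 : ‖E.fc ((cell n).indicator fun p => (p a : ℂ) - n a) φ‖ ≤ ‖E.block n φ‖ := by
      rw [← E.fc_indicator_mul_block (isBddMeas_cell_coord_sub n a)]
      simpa using (E.fc ((cell n).indicator fun p => (p a : ℂ) - n a)).le_of_opNorm_le
        (E.norm_fc_coord_sub_le n a) (E.block n φ)
    have h4 := norm_sub_le ((n a : ℂ) • E.block n φ +
      E.fc ((cell n).indicator fun p => (p a : ℂ) - n a) φ)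
      (E.fc ((cell n).indicator fun p => (p a : ℂ) - n a) φ)
    rw [add_sub_cancel_right, norm_smul, Complex.norm_intCast] at h4
    simp only [smul_apply, add_apply, norm_smul, Complex.norm_I, one_mul]
    linarith
  have h5 := Finset.sum_le_sum fun a (_ : a ∈ Finset.univ) => key a
  rw [← Finset.sum_mul, Finset.sum_add_distrib, Finset.sum_const, Finset.card_univ,
    Fintype.card_fin, nsmul_eq_mul] at h5
  have h6 := mul_le_mul_of_nonneg_right (wt_le_one_add_sum n) (norm_nonneg (E.block n φ))
  linarith

end SpectralMeasure

end Orbits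

/-! ### Smooth vectors are the rapidly decaying ones. -/

section SmoothVectors

open Filter Topology Asymptotics

variable {d : ℕ} {H : Type*} [NormedAddCommGroup H] [InnerProductSpace ℂ H] [CompleteSpace H]

namespace SpectralMeasure

variable (E : SpectralMeasure d H) (B : LinearMap.BilinForm ℝ (EuclideanSpace ℝ (Fin d)))

/-- The block diagonal matrix with the given diagonal. -/
def diagMat (A : (Fin d → ℤ) → (H →L[ℂ] H)) (m n : Fin d → ℤ) : H →L[ℂ] H :=
  if m = n then A m else 0

variable {E}

theorem rapidMat_diagMat {A : (Fin d → ℤ) → (H →L[ℂ] H)} (h1 : ∀ n, E.block n * A n = A n)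
    (h2 : ∀ n, A n * E.block n = A n) {C : ℝ} {a : ℕ} (hA : ∀ n, ‖A n‖ ≤ C * wt n ^ a) :
    E.RapidMat (diagMat A) where
  block_mul m n := by
    unfold diagMat
    split_ifs with h
    · exact h1 m
    · simp
  mul_block m n := by
    unfold diagMat
    split_ifs with h
    · rw [← h]
      exact h2 m
    · simp
  bound := by
    refine ⟨a, fun k => ⟨C, fun m n => ?_⟩⟩
    unfold diagMat
    split_ifs with h
    · subst h
      simpa [wt] using hA m
    · have := (norm_nonneg _).trans (hA n)
      simpa using this

theorem block_apply_diagMat {A : (Fin d → ℤ) → (H →L[ℂ] H)} (h : E.RapidMat (diagMat A)) {ψ : H}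
    (hψ : E.Rapid ψ) (n : Fin d → ℤ) : E.block n (apply (diagMat A) ψ) = A n ψ := by
  rw [h.block_apply hψ, tsum_eq_single n]
  · simp [diagMat]
  · intro m hm
    simp [diagMat, hm.symm]

theorem block_mul_gen (n : Fin d → ℤ) (x : EuclideanSpace ℝ (Fin d)) :
    E.block n * E.gen B n x = E.gen B n x :=
  E.block_mul_fc_indicator (isBddMeas_cellLin B n x)

theorem gen_mul_block (n : Fin d → ℤ) (x : EuclideanSpace ℝ (Fin d)) :
    E.gen B n x * E.block n = E.gen B n x :=
  E.fc_indicator_mul_block (isBddMeas_cellLin B n x)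

theorem rapidMat_gen (x : EuclideanSpace ℝ (Fin d)) :
    E.RapidMat (diagMat fun n => E.gen B n x) := by
  obtain ⟨c, hc0, hc⟩ := exists_bilin_cell_bound B
  refine rapidMat_diagMat (fun n => block_mul_gen B n x) (fun n => gen_mul_block B n x)
    (C := c * ‖x‖) (a := 1) fun n => ?_
  have hC : 0 ≤ c * ‖x‖ * wt n ^ 1 :=
    mul_nonneg (mul_nonneg hc0 (norm_nonneg x)) (pow_nonneg (wt_pos n).le _)
  refine E.norm_fc_le (isBddMeas_cellLin B n x) hC fun p => ?_
  by_cases hp : p ∈ cell n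
  · simpa [cellLin, hp] using hc n p hp x
  · simpa [cellLin, hp] using hC

theorem gen_eq_sum (n : Fin d → ℤ) (x : EuclideanSpace ℝ (Fin d)) :
    E.gen B n x = ∑ a, x a • E.gen B n (EuclideanSpace.single a 1) := by
  simp only [← E.gen_smul]
  unfold gen
  rw [← E.fc_sum _ fun a _ => isBddMeas_cellLin B n _]
  congr 1
  ext p
  have hx : x = ∑ a, x a • EuclideanSpace.single a (1 : ℝ) := by
    have := (EuclideanSpace.basisFun (Fin d) ℝ).sum_repr x
    simpa using this.symm
  by_cases hp : p ∈ cell n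
  · simp only [cellLin, hp, Set.indicator_of_mem]
    conv_lhs => rw [hx]
    simp only [map_sum, Complex.ofReal_sum, Finset.mul_sum]
  · simp [cellLin, hp]

theorem hasFDerivAt_trans_zero {ψ : H} (hψ : E.Rapid ψ) :
    HasFDerivAt (fun x => E.trans B x ψ)
      (∑ a, (EuclideanSpace.proj a : EuclideanSpace ℝ (Fin d) →L[ℝ] ℝ).smulRight
        (apply (diagMat fun n => E.gen B n (EuclideanSpace.single a 1)) ψ)) 0 := by
  obtain ⟨c, hc0, hc⟩ := E.exists_norm_trans_sub_le B
  -- Two powers absorb the weight in the quadratic Taylor remainder, 2d make the sum over cubes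
  -- converge.
  obtain ⟨C, hC0, hC⟩ := hψ.norm_le (2 * d + 2)
  set f' := ∑ a, (EuclideanSpace.proj a : EuclideanSpace ℝ (Fin d) →L[ℝ] ℝ).smulRight
    (apply (diagMat fun n => E.gen B n (EuclideanSpace.single a 1)) ψ) with hf'
  have hblock : ∀ n x, E.block n (E.trans B x ψ - ψ - f' x) =
      (E.trans B x * E.block n - E.block n - E.gen B n x) (E.block n ψ) := by
    intro n x
    have h1 : E.block n (f' x) = E.gen B n x ψ := by
      rw [gen_eq_sum, hf']
      simp only [sum_apply, ContinuousLinearMap.smulRight_apply, map_sum, smul_apply]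
      refine Finset.sum_congr rfl fun a _ => ?_
      rw [← Complex.coe_smul, map_smul, block_apply_diagMat (rapidMat_gen B _) hψ, Complex.coe_smul]
      rfl
    rw [map_sub, map_sub, h1]
    simp only [sub_apply, mul_apply_eq_comp]
    rw [← mul_apply_eq_comp (E.block n) (E.block n), E.block_mul_self,
      ← mul_apply_eq_comp (E.gen B n x), gen_mul_block,
      ← mul_apply_eq_comp (E.block n) (E.trans B x), ← (E.trans_comm_block B x n).eq]
    rfl
  have hnorm : ∀ x, ‖E.trans B x ψ - ψ - f' x‖ ≤
      (∑' n : Fin d → ℤ, c * C * (wt n ^ (2 * d))⁻¹) * ‖x‖ ^ 2 := by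
    intro x
    rw [← (E.hasSum_block (E.trans B x ψ - ψ - f' x)).tsum_eq, ← tsum_mul_right]
    refine tsum_of_norm_bounded ((summable_inv_wt_pow.mul_left (c * C)).mul_right _).hasSum
      fun n => ?_
    rw [hblock]
    refine (ContinuousLinearMap.le_of_opNorm_le _ (hc n x) _).trans ?_
    have hn := wt_pos n
    calc c * (‖x‖ * wt n) ^ 2 * ‖E.block n ψ‖
        ≤ c * (‖x‖ * wt n) ^ 2 * (C * (wt n ^ (2 * d + 2))⁻¹) := by gcongr; exact hC n
      _ = _ := by
        rw [pow_add]
        field_simp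
  rw [hasFDerivAt_iff_isLittleO]
  have h : (fun x => E.trans B x ψ - ψ - f' x) =O[𝓝 0]
      fun x : EuclideanSpace ℝ (Fin d) => ‖x‖ ^ 2 :=
    IsBigO.of_bound _ (Eventually.of_forall fun x => by simpa using hnorm x)
  have h2 := h.trans_isLittleO (isLittleO_norm_pow_id one_lt_two)
  simpa [E.trans_zero] using h2

theorem hasFDerivAt_trans {ψ : H} (hψ : E.Rapid ψ) (x : EuclideanSpace ℝ (Fin d)) :
    HasFDerivAt (fun x => E.trans B x ψ)
      (∑ a, (EuclideanSpace.proj a : EuclideanSpace ℝ (Fin d) →L[ℝ] ℝ).smulRight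
        (E.trans B x (apply (diagMat fun n => E.gen B n (EuclideanSpace.single a 1)) ψ))) x := by
  have h0 := hasFDerivAt_trans_zero B hψ
  have h1 : HasFDerivAt (fun z => E.trans B x (E.trans B z ψ))
      (((E.trans B x).restrictScalars ℝ).comp
        (∑ a, (EuclideanSpace.proj a : EuclideanSpace ℝ (Fin d) →L[ℝ] ℝ).smulRight
          (apply (diagMat fun n => E.gen B n (EuclideanSpace.single a 1)) ψ))) 0 :=
    ((E.trans B x).restrictScalars ℝ).hasFDerivAt.comp 0 h0
  have h2 : (fun z => E.trans B x (E.trans B z ψ)) = fun z => E.trans B (x + z) ψ := by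
    ext z
    rw [E.trans_add]
    rfl
  rw [h2] at h1
  have h3 := (hasFDerivAt_comp_add_left (f := fun x => E.trans B x ψ) x).1 h1
  rw [add_zero] at h3
  refine h3.congr_fderiv ?_
  ext y
  simp

/-- The derivative of the orbit is built from orbits of the generators applied to ψ. The generators
have rapidly decaying matrices and so preserve rapid decay, which drives the induction. -/
theorem contDiff_of_rapid {ψ : H} (hψ : E.Rapid ψ) : ContDiff ℝ ∞ fun x => E.trans B x ψ := by
  rw [contDiff_infty]
  intro k
  induction k generalizing ψ with
  | zero =>
    rw [Nat.cast_zero, contDiff_zero]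
    exact continuous_iff_continuousAt.2 fun x => (hasFDerivAt_trans B hψ x).continuousAt
  | succ k ih =>
    rw [Nat.cast_succ]
    refine contDiff_succ_iff_hasFDerivAt.2 ⟨_, ?_, hasFDerivAt_trans B hψ⟩
    refine ContDiff.sum fun a _ => ?_
    exact (ContinuousLinearMap.smulRightL ℝ (EuclideanSpace ℝ (Fin d)) H
      (EuclideanSpace.proj a)).contDiff.comp (ih ((rapidMat_gen B _).rapid_apply hψ))

end SpectralMeasure

variable {B : LinearMap.BilinForm ℝ (EuclideanSpace ℝ (Fin d))} {U : UnitaryRep d H}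
  {E : SpectralMeasure d H}

theorem IsSpectralResolution.apply_eq_trans (hE : IsSpectralResolution B U E)
    (x : EuclideanSpace ℝ (Fin d)) (ψ : H) : U x ψ = E.trans B x ψ :=
  hE.apply_eq_fc x ψ

theorem IsSpectralResolution.symm_apply_eq_trans (hE : IsSpectralResolution B U E)
    (x : EuclideanSpace ℝ (Fin d)) (ψ : H) : (U x).symm ψ = E.trans B (-x) ψ := by
  rw [LinearIsometryEquiv.symm_apply_eq, hE.apply_eq_trans, ← mul_apply_eq_comp,
    E.trans_mul_trans_neg]
  rfl

/-- The smooth vectors are those with rapidly decaying spectral components. -/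
theorem IsSpectralResolution.mem_smoothVectors_iff (hE : IsSpectralResolution B U E)
    (hB : B.Nondegenerate) (hs : B.IsSymm) {ψ : H} : ψ ∈ smoothVectors U ↔ E.Rapid ψ := by
  have h : ψ ∈ smoothVectors U ↔ ContDiff ℝ ∞ fun x => E.trans B x ψ := by
    simp only [← hE.apply_eq_trans]
    rfl
  rw [h]
  exact ⟨SpectralMeasure.rapid_of_contDiff hB hs, SpectralMeasure.contDiff_of_rapid B⟩

end SmoothVectors

/-! ### Operators in 𝔉 as rapidly decaying matrices. -/

section SmoothOperators

open Filter Topology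

variable {d : ℕ} {H : Type*} [NormedAddCommGroup H] [InnerProductSpace ℂ H] [CompleteSpace H]

namespace SpectralMeasure

variable {E : SpectralMeasure d H} {B : LinearMap.BilinForm ℝ (EuclideanSpace ℝ (Fin d))}

theorem gen_neg (n : Fin d → ℤ) (x : EuclideanSpace ℝ (Fin d)) :
    E.gen B n (-x) = -E.gen B n x := by
  rw [← neg_one_smul ℝ x, E.gen_smul, neg_one_smul]

/-- Operators with a smooth orbit have matrix elements decaying rapidly off the diagonal. -/
theorem exists_norm_block_mul_mul_block_le (hB : B.Nondegenerate) (hs : B.IsSymm) {T : H →L[ℂ] H}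
    (hT : ContDiff ℝ ∞ fun x => E.trans B x * T * E.trans B (-x)) (k : ℕ) :
    ∃ C, ∀ m n, wt (m - n) ^ k * ‖E.block m * T * E.block n‖ ≤ C := by
  obtain ⟨x, hx⟩ := exists_dual_basis hB hs
  -- Conjugation is itself a group of bounded maps on the bounded operators, so the orbit lemmas
  -- apply with operators in the role of vectors.
  set W : EuclideanSpace ℝ (Fin d) → ((H →L[ℂ] H) →L[ℂ] (H →L[ℂ] H)) := fun z =>
    leftMul (E.trans B z) * rightMul (E.trans B (-z)) with hWdef
  have hWa : ∀ z X, W z X = E.trans B z * X * E.trans B (-z) := fun z X => by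
    simp [hWdef, mul_assoc]
  have hW : ∀ z z' X, W (z + z') X = W z (W z' X) := fun z z' X => by
    rw [hWa, hWa, hWa, neg_add_rev, E.trans_add, E.trans_add]
    simp only [mul_assoc]
  simp only [← hWa] at hT
  suffices h : ∃ C, ∀ i : (Fin d → ℤ) × (Fin d → ℤ),
      wt (i.1 - i.2) ^ k * ‖E.block i.1 * T * E.block i.2‖ ≤ C by
    obtain ⟨C, hC⟩ := h
    exact ⟨C, fun m n => hC (m, n)⟩
  have hN : ∀ (X : H →L[ℂ] H) (m n : Fin d → ℤ), ‖E.block m * X * E.block n‖ ≤ ‖X‖ :=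
    fun X m n => by
      calc ‖E.block m * X * E.block n‖ ≤ ‖E.block m‖ * ‖X‖ * ‖E.block n‖ := norm_mul₃_le
        _ ≤ 1 * ‖X‖ * 1 := by
          gcongr
          · exact E.norm_block_le m
          · exact E.norm_block_le n
        _ = ‖X‖ := by ring
  -- The constant is 1 + 2d because each coordinate now has rounding errors from both cubes.
  refine exists_pow_mul_le (w := fun i : (Fin d → ℤ) × (Fin d → ℤ) => wt (i.1 - i.2))
    (fun i => (wt_pos _).le)
    (N := fun i X => ‖E.block i.1 * X * E.block i.2‖) (S := {X | ContDiff ℝ ∞ fun z => W z X})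
    (D := fun a X => fderiv ℝ (fun z => W z X) 0 (x a)) (c := 1 + 2 * d)
    (fun X hX a => contDiff_orbit_fderiv hW hX (x a))
    (fun X _ => ⟨‖X‖, fun i => hN X i.1 i.2⟩) (by positivity) ?_ k T hT
  rintro X hX ⟨m, n⟩
  have key : ∀ a, |(((m - n) a : ℤ) : ℝ)| * ‖E.block m * X * E.block n‖ ≤
      ‖E.block m * (fderiv ℝ (fun z => W z X) 0 (x a)) * E.block n‖ +
        2 * ‖E.block m * X * E.block n‖ := by
    intro a
    have h1 : HasDerivAt (fun t : ℝ => E.block m * W (t • x a) X * E.block n)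
        (E.block m * (fderiv ℝ (fun z => W z X) 0 (x a)) * E.block n) 0 :=
      ((hasDerivAt_orbit hX (x a)).const_mul (E.block m)).mul_const (E.block n)
    have h2 : HasDerivAt (fun t : ℝ => (E.trans B (t • x a) * E.block m) * X *
        (E.trans B (t • -x a) * E.block n))
        (E.gen B m (x a) * X * (E.trans B ((0 : ℝ) • -x a) * E.block n) +
          (E.trans B ((0 : ℝ) • x a) * E.block m) * X * E.gen B n (-x a)) 0 :=
      ((E.hasDerivAt_trans_mul_block B m (x a)).mul_const X).mul
        (E.hasDerivAt_trans_mul_block B n (-x a))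
    have h3 : (fun t : ℝ => E.block m * W (t • x a) X * E.block n) = fun t : ℝ =>
        (E.trans B (t • x a) * E.block m) * X * (E.trans B (t • -x a) * E.block n) := by
      ext1 t
      rw [hWa, smul_neg, (E.trans_comm_block B _ m).eq]
      simp only [mul_assoc]
    rw [h3] at h1
    let r : (Fin d → ℤ) → (H →L[ℂ] H) := fun l =>
      E.fc ((cell l).indicator fun p => (p a : ℂ) - l a)
    have hrd : ∀ l, E.fc ((cell l).indicator fun p => (p a : ℂ) - l a) = r l := fun l => rfl
    have hr1 : ∀ l, ‖r l‖ ≤ 1 := fun l => E.norm_fc_coord_sub_le l a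
    have hrb : ∀ l, r l * E.block l = r l := fun l =>
      E.fc_indicator_mul_block (isBddMeas_cell_coord_sub l a)
    have hbr : ∀ l, E.block l * r l = r l := fun l =>
      E.block_mul_fc_indicator (isBddMeas_cell_coord_sub l a)
    set Z := E.block m * X * E.block n with hZ
    -- The derivative of conjugation is the commutator with iP_a; between cubes m and n this is
    -- multiplication by i(m_a - n_a) up to the bounded errors `r m` and `r n`.
    have h4 : E.block m * (fderiv ℝ (fun z => W z X) 0 (x a)) * E.block n =
        Complex.I • ((((m - n) a : ℤ) : ℂ) • Z + (r m * Z - Z * r n)) := by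
      rw [h1.unique h2, zero_smul, zero_smul, E.trans_zero, one_mul, one_mul, gen_neg,
        E.gen_eq_of_forall B (hx a), E.gen_eq_of_forall B (hx a), hrd, hrd]
      have e1 : r m * X * E.block n = r m * Z := by
        rw [hZ, mul_assoc (E.block m), ← mul_assoc (r m), hrb, mul_assoc]
      have e2 : E.block m * X * r n = Z * r n := by
        rw [hZ, mul_assoc (E.block m * X), hbr]
      rw [smul_mul_assoc, smul_mul_assoc, add_mul, add_mul, e1, mul_neg, mul_smul_comm, mul_add, e2,
        smul_mul_assoc, smul_mul_assoc, mul_smul_comm, ← hZ, Pi.sub_apply, Int.cast_sub, sub_smul]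
      module
    have h5 : ‖r m * Z - Z * r n‖ ≤ 2 * ‖Z‖ := by
      refine (norm_sub_le _ _).trans ?_
      have e1 : ‖r m * Z‖ ≤ 1 * ‖Z‖ := (norm_mul_le _ _).trans (by gcongr; exact hr1 m)
      have e2 : ‖Z * r n‖ ≤ ‖Z‖ * 1 := (norm_mul_le _ _).trans (by gcongr; exact hr1 n)
      linarith
    rw [h4, norm_smul, Complex.norm_I, one_mul]
    have h6 := norm_sub_le ((((m - n) a : ℤ) : ℂ) • Z + (r m * Z - Z * r n)) (r m * Z - Z * r n)
    rw [add_sub_cancel_right, norm_smul, Complex.norm_intCast] at h6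
    linarith
  have h5 := Finset.sum_le_sum fun a (_ : a ∈ Finset.univ) => key a
  rw [← Finset.sum_mul, Finset.sum_add_distrib, Finset.sum_const, Finset.card_univ,
    Fintype.card_fin, nsmul_eq_mul] at h5
  have h6 := mul_le_mul_of_nonneg_right (wt_le_one_add_sum (m - n))
    (norm_nonneg (E.block m * X * E.block n))
  simp only
  linarith

/-- The function `p ↦ (1 + ‖p‖ ^ 2) ^ (-k)`. -/
def damping (k : ℕ) (p : EuclideanSpace ℝ (Fin d)) : ℂ := (((1 + ‖p‖ ^ 2) ^ k : ℝ)⁻¹ : ℝ)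

theorem continuous_damping (k : ℕ) : Continuous (damping (d := d) k) := by
  refine Complex.continuous_ofReal.comp (Continuous.inv₀ (by fun_prop) fun p => ?_)
  positivity

theorem isBddMeas_damping (k : ℕ) : IsBddMeas (damping (d := d) k) := by
  refine IsBddMeas.of_bound (continuous_damping k).measurable (C := 1) fun p => ?_
  rw [damping, Complex.norm_real, Real.norm_of_nonneg (by positivity)]
  refine inv_le_one_of_one_le₀ (one_le_pow₀ ?_)
  nlinarith [sq_nonneg ‖p‖]

theorem uniformContinuous_damping (k : ℕ) : UniformContinuous (damping (d := d) k) := by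
  -- For k = 0 the function is constant and does not vanish at infinity.
  rcases Nat.eq_zero_or_pos k with rfl | hk
  · have : damping (d := d) 0 = fun _ => 1 := by
      ext p
      simp [damping]
    rw [this]
    exact uniformContinuous_const
  · refine (continuous_damping k).uniformContinuous_of_tendsto_cocompact (x := 0) ?_
    have h1 : Tendsto (fun p : EuclideanSpace ℝ (Fin d) => 1 + ‖p‖ ^ 2) (cocompact _) atTop :=
      tendsto_atTop_add_const_left _ _
        ((tendsto_pow_atTop two_ne_zero).comp tendsto_norm_cocompact_atTop)
    have h2 := ((tendsto_pow_atTop hk.ne').comp h1).inv_tendsto_atTop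
    rw [← Complex.ofReal_zero]
    exact (Complex.continuous_ofReal.tendsto 0).comp h2

/-- The inverse of the damping function, cut off to a unit cube. -/
def cellGrowth (k : ℕ) (n : Fin d → ℤ) : EuclideanSpace ℝ (Fin d) → ℂ :=
  (cell n).indicator fun p => (((1 + ‖p‖ ^ 2) ^ k : ℝ) : ℂ)

theorem norm_cellGrowth_le (k : ℕ) (n : Fin d → ℤ) (p : EuclideanSpace ℝ (Fin d)) :
    ‖cellGrowth k n p‖ ≤ (1 + d) ^ k * wt n ^ (2 * k) := by
  have hn := wt_pos n
  by_cases hp : p ∈ cell n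
  · rw [cellGrowth, Set.indicator_of_mem hp, Complex.norm_real, Real.norm_of_nonneg (by positivity),
      pow_mul, ← mul_pow]
    exact pow_le_pow_left₀ (by positivity) (norm_sq_le_of_mem_cell hp) k
  · rw [cellGrowth, Set.indicator_of_notMem hp, norm_zero]
    positivity

theorem isBddMeas_cellGrowth (k : ℕ) (n : Fin d → ℤ) : IsBddMeas (cellGrowth k n) := by
  refine IsBddMeas.of_bound ?_ (norm_cellGrowth_le k n)
  have h : Continuous fun p : EuclideanSpace ℝ (Fin d) => (((1 + ‖p‖ ^ 2) ^ k : ℝ) : ℂ) :=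
    Complex.continuous_ofReal.comp (by fun_prop)
  exact h.measurable.indicator (measurableSet_cell n)

theorem norm_fc_cellGrowth_le (k : ℕ) (n : Fin d → ℤ) :
    ‖E.fc (cellGrowth k n)‖ ≤ (1 + d) ^ k * wt n ^ (2 * k) :=
  E.norm_fc_le (isBddMeas_cellGrowth k n)
    ((norm_nonneg _).trans (norm_cellGrowth_le k n 0)) (norm_cellGrowth_le k n)

theorem fc_cellGrowth_mul_fc_damping (k : ℕ) (n : Fin d → ℤ) :
    E.fc (cellGrowth k n) * E.fc (damping k) = E.block n := by
  rw [← E.fc_mul (isBddMeas_cellGrowth k n) (isBddMeas_damping k), block,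
    ← E.fc_indicator_one (measurableSet_cell n)]
  congr 1
  ext p
  have h : ((1 + ‖p‖ ^ 2) ^ k : ℝ) ≠ 0 := by positivity
  by_cases hp : p ∈ cell n
  · rw [cellGrowth, Set.indicator_of_mem hp, Set.indicator_of_mem hp, damping, ← Complex.ofReal_mul,
      mul_inv_cancel₀ h]
    simp
  · simp [cellGrowth, hp]

theorem block_mul_fc_cellGrowth (k : ℕ) (n : Fin d → ℤ) :
    E.block n * E.fc (cellGrowth k n) = E.fc (cellGrowth k n) :=
  E.block_mul_fc_indicator (isBddMeas_cellGrowth k n)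

theorem fc_cellGrowth_mul_block (k : ℕ) (n : Fin d → ℤ) :
    E.fc (cellGrowth k n) * E.block n = E.fc (cellGrowth k n) :=
  E.fc_indicator_mul_block (isBddMeas_cellGrowth k n)

theorem rapidMat_cellGrowth (k : ℕ) : E.RapidMat (diagMat fun n => E.fc (cellGrowth k n)) :=
  rapidMat_diagMat (block_mul_fc_cellGrowth k) (fc_cellGrowth_mul_block k) (norm_fc_cellGrowth_le k)

theorem rapidMat_cellGrowth_mul_mul (hB : B.Nondegenerate) (hs : B.IsSymm) {T : H →L[ℂ] H}
    (hT : ContDiff ℝ ∞ fun x => E.trans B x * T * E.trans B (-x)) (j : ℕ) :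
    E.RapidMat fun m n => E.fc (cellGrowth j m) * T * E.fc (cellGrowth j n) where
  block_mul m n := by rw [← mul_assoc, ← mul_assoc, block_mul_fc_cellGrowth]
  mul_block m n := by rw [mul_assoc, fc_cellGrowth_mul_block]
  bound := by
    refine ⟨2 * j + 2 * j, fun k => ?_⟩
    -- The extra 2j powers pay for replacing the growth `wt m ^ (2 * j)` of the left factor by `wt n
    -- ^ (2 * j)`.
    obtain ⟨C, hC⟩ := exists_norm_block_mul_mul_block_le hB hs hT (k + 2 * j)
    refine ⟨(1 + d) ^ j * (1 + d) ^ j * C, fun m n => ?_⟩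
    have hn := wt_pos n
    have hm := wt_pos m
    have hmn := wt_pos (m - n)
    have e : E.fc (cellGrowth j m) * T * E.fc (cellGrowth j n) =
        E.fc (cellGrowth j m) * (E.block m * T * E.block n) * E.fc (cellGrowth j n) := by
      conv_lhs => rw [← fc_cellGrowth_mul_block j m, ← block_mul_fc_cellGrowth j n]
      simp only [mul_assoc]
    rw [e]
    have h1 : wt m ^ (2 * j) ≤ wt n ^ (2 * j) * wt (m - n) ^ (2 * j) := by
      rw [← mul_pow]
      have := wt_le_mul_sub m n
      gcongr
    calc wt (m - n) ^ k *
          ‖E.fc (cellGrowth j m) * (E.block m * T * E.block n) * E.fc (cellGrowth j n)‖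
        ≤ wt (m - n) ^ k * (((1 + d) ^ j * (wt n ^ (2 * j) * wt (m - n) ^ (2 * j))) *
          ‖E.block m * T * E.block n‖ * ((1 + d) ^ j * wt n ^ (2 * j))) := by
          refine mul_le_mul_of_nonneg_left (norm_mul₃_le.trans ?_) (by positivity)
          gcongr
          · refine (norm_fc_cellGrowth_le j m).trans ?_
            gcongr
          · exact norm_fc_cellGrowth_le j n
      _ = (1 + d) ^ j * (1 + d) ^ j * (wt (m - n) ^ (k + 2 * j) * ‖E.block m * T * E.block n‖) *
          wt n ^ (2 * j + 2 * j) := by ring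
      _ ≤ _ := by
          gcongr
          exact hC m n

theorem rapid_trans {ψ : H} (hψ : E.Rapid ψ) (x : EuclideanSpace ℝ (Fin d)) :
    E.Rapid (E.trans B x ψ) := by
  intro k
  obtain ⟨C, hC⟩ := hψ k
  refine ⟨C, fun n => le_trans ?_ (hC n)⟩
  have h : E.block n (E.trans B x ψ) = E.trans B x (E.block n ψ) :=
    congr($((E.trans_comm_block B x n).symm.eq) ψ)
  rw [h]
  refine mul_le_mul_of_nonneg_left ?_ (pow_nonneg (wt_pos n).le _)
  simpa using (E.trans B x).le_of_opNorm_le (E.norm_trans_le B x) (E.block n ψ)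

end SpectralMeasure

open SpectralMeasure

variable {B : LinearMap.BilinForm ℝ (EuclideanSpace ℝ (Fin d))} {U : UnitaryRep d H}
  {E : SpectralMeasure d H}

theorem IsSpectralResolution.mem_graph_adjointAction_iff (hE : IsSpectralResolution B U E)
    (x : EuclideanSpace ℝ (Fin d)) (F : H →ₗ.[ℂ] H) (ψ v : H) :
    (ψ, v) ∈ (adjointAction U x F).graph ↔
      (E.trans B (-x) ψ, E.trans B (-x) v) ∈ F.graph := by
  simp only [LinearPMap.mem_graph_iff, ← hE.symm_apply_eq_trans]
  constructor
  · rintro ⟨⟨y, hy⟩, h1, h2⟩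
    refine ⟨⟨(U x).symm y, hy⟩, by simpa using congrArg (U x).symm h1, ?_⟩
    rw [← h2]
    exact ((U x).symm_apply_apply _).symm
  · rintro ⟨⟨y, hy⟩, h1, h2⟩
    have h1 : y = (U x).symm ψ := h1
    subst h1
    refine ⟨⟨ψ, hy⟩, rfl, ?_⟩
    have h3 : U x (F ⟨(U x).symm ψ, hy⟩) = v := by
      rw [h2, LinearIsometryEquiv.apply_symm_apply]
    exact h3

/-- A smooth operator acts on smooth vectors through a rapidly decaying matrix. -/
theorem IsSpectralResolution.exists_rapidMat (hE : IsSpectralResolution B U E)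
    (hB : B.Nondegenerate) (hs : B.IsSymm) {F : H →ₗ.[ℂ] H} (hF : F ∈ smoothOperators U E) :
    ∃ K, E.RapidMat K ∧ ∀ ψ, E.Rapid ψ → (ψ, apply K ψ) ∈ F.graph := by
  obtain ⟨-, k, T, hT, hTF⟩ := hF
  have hsmul : ∀ (p : EuclideanSpace ℝ (Fin d)) (ψ : H),
      ((1 + ‖p‖ ^ 2) ^ k : ℝ)⁻¹ • ψ = damping k p • ψ := fun p ψ => by
    rw [damping, Complex.coe_smul]
  simp only [hsmul, hE.mem_smoothVectors_iff hB hs] at hTF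
  have hspec : ∀ x ψ, E.Rapid ψ → ∃ b, (E.trans B (-x) (E.fc (damping k) ψ), E.trans B (-x) b) ∈
      F.graph ∧ T x ψ = E.fc (damping k) b := by
    intro x ψ hψ
    obtain ⟨a, b, ha, hab, hb⟩ := hTF x ψ hψ
    rw [ha.eq_fc (isBddMeas_damping k) (uniformContinuous_damping k),
      hE.mem_graph_adjointAction_iff] at hab
    exact ⟨b, hab, hb.eq_fc (isBddMeas_damping k) (uniformContinuous_damping k)⟩
  have hcomm : ∀ x φ, E.trans B x (E.fc (damping k) φ) = E.fc (damping k) (E.trans B x φ) :=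
    fun x φ => congr($((E.fc_comm (isBddMeas_phase B x) (isBddMeas_damping k)).eq) φ)
  -- `T x` and `T 0` are both read off from the single-valued graph of F, and the damping commutes
  -- with translations. It suffices to compare them on vectors supported in one cube, which are
  -- smooth.
  have hcov : ∀ x, T x = E.trans B x * T 0 * E.trans B (-x) := by
    intro x
    refine E.eq_of_mul_block_eq fun n => ContinuousLinearMap.ext fun φ => ?_
    change T x (E.block n φ) = E.trans B x (T 0 (E.trans B (-x) (E.block n φ)))
    obtain ⟨b, hb, hTb⟩ := hspec x _ (rapid_block n φ)
    obtain ⟨b', hb', hTb'⟩ := hspec 0 _ (rapid_trans (B := B) (rapid_block n φ) (-x))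
    rw [neg_zero, E.trans_zero, one_apply_eq_self, one_apply_eq_self, ← hcomm] at hb'
    have hbb : b' = E.trans B (-x) b := LinearPMap.mem_graph_snd_inj _ hb' hb rfl
    rw [hTb, hTb', hbb, ← hcomm, ← mul_apply_eq_comp (E.trans B x), E.trans_mul_trans_neg,
      one_apply_eq_self]
  have hT0 : ContDiff ℝ ∞ fun x => E.trans B x * T 0 * E.trans B (-x) := by
    simpa only [← hcov] using hT
  have hK := rapidMat_cellGrowth_mul_mul hB hs hT0 k
  refine ⟨_, hK, fun ψ hψ => ?_⟩
  have hG := rapidMat_cellGrowth (E := E) k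
  -- φ is (1 + |P|²)^k ψ, still rapidly decaying, so ψ is the damping of a smooth vector and `T 0`
  -- determines the value of F at ψ.
  have hφ : E.Rapid (apply (diagMat fun n => E.fc (cellGrowth k n)) ψ) := hG.rapid_apply hψ
  have hφb := block_apply_diagMat hG hψ
  set φ := apply (diagMat fun n => E.fc (cellGrowth k n)) ψ with hφdef
  have hdφ : E.fc (damping k) φ = ψ := by
    refine E.eq_of_block_eq fun n => ?_
    have h1 : E.block n (E.fc (damping k) φ) = E.fc (damping k) (E.block n φ) :=
      congr($((E.fc_comm_proj (isBddMeas_damping k) (measurableSet_cell n)).symm.eq) φ)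
    rw [h1, hφb, ← mul_apply_eq_comp,
      (E.fc_comm (isBddMeas_damping k) (isBddMeas_cellGrowth k n)).eq, fc_cellGrowth_mul_fc_damping]
  obtain ⟨b, hb, hTb⟩ := hspec 0 φ hφ
  rw [neg_zero, E.trans_zero, one_apply_eq_self, one_apply_eq_self, hdφ] at hb
  convert hb using 2
  refine E.eq_of_block_eq fun m => ?_
  rw [hK.block_apply hψ]
  have h2 : HasSum (fun n => (E.fc (cellGrowth k m) * T 0) (E.block n φ))
      ((E.fc (cellGrowth k m) * T 0) φ) :=
    (E.fc (cellGrowth k m) * T 0).hasSum (E.hasSum_block φ)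
  simp only [hφb] at h2
  refine h2.tsum_eq.trans ?_
  rw [mul_apply_eq_comp, hTb, ← mul_apply_eq_comp, fc_cellGrowth_mul_fc_damping]

theorem IsSpectralResolution.mem_graph_adjointAction (hE : IsSpectralResolution B U E)
    {F : H →ₗ.[ℂ] H} {K : (Fin d → ℤ) → (Fin d → ℤ) → (H →L[ℂ] H)}
    (hK : ∀ ψ, E.Rapid ψ → (ψ, apply K ψ) ∈ F.graph) (x : EuclideanSpace ℝ (Fin d)) {ψ : H}
    (hψ : E.Rapid ψ) :
    (ψ, E.trans B x (apply K (E.trans B (-x) ψ))) ∈ (adjointAction U x F).graph := by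
  rw [hE.mem_graph_adjointAction_iff, ← mul_apply_eq_comp, E.trans_neg_mul_trans, one_apply_eq_self]
  exact hK _ (rapid_trans hψ _)

end SmoothOperators

/-! ### The multiplier exp(iσ(f(p), g(q))) between two cubes and its estimates. -/

section WarpMap

variable {d : ℕ} {H : Type*} [NormedAddCommGroup H] [InnerProductSpace ℂ H] [CompleteSpace H]

/-- The lower corner of a unit cube. -/
def corner (n : Fin d → ℤ) : EuclideanSpace ℝ (Fin d) := WithLp.toLp 2 fun a => (n a : ℝ)

theorem norm_le_of_abs_le {x : EuclideanSpace ℝ (Fin d)} {M : ℝ} (hM : 0 ≤ M)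
    (h : ∀ a, |x a| ≤ M) : ‖x‖ ≤ (1 + d) * M := by
  refine le_of_sq_le_sq ?_ (by positivity)
  rw [EuclideanSpace.norm_sq_eq]
  have h1 : ∑ a, ‖x a‖ ^ 2 ≤ ∑ _a : Fin d, M ^ 2 := Finset.sum_le_sum fun a _ => by
    rw [Real.norm_eq_abs]
    exact pow_le_pow_left₀ (abs_nonneg _) (h a) 2
  simp only [Finset.sum_const, Finset.card_univ, Fintype.card_fin, nsmul_eq_mul] at h1
  have hd : (0 : ℝ) ≤ d := Nat.cast_nonneg d
  nlinarith [sq_nonneg M, mul_nonneg hd (sq_nonneg M), mul_nonneg (mul_nonneg hd hd) (sq_nonneg M)]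

theorem norm_corner_le (n : Fin d → ℤ) : ‖corner n‖ ≤ (1 + d) * wt n :=
  norm_le_of_abs_le (wt_pos n).le fun a => (abs_coord_le_wt n a).trans (by linarith)

theorem norm_sub_corner_le {n : Fin d → ℤ} {p : EuclideanSpace ℝ (Fin d)} (hp : p ∈ cell n) :
    ‖p - corner n‖ ≤ 1 + d := by
  simpa using norm_le_of_abs_le (x := p - corner n) zero_le_one fun a =>
    abs_sub_le_of_mem_cell hp a

/-- Borel maps that are bounded on each unit cube. -/
structure CellBdd (f : EuclideanSpace ℝ (Fin d) → EuclideanSpace ℝ (Fin d)) : Prop where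
  measurable : Measurable f
  bound : ∀ n, ∃ C, ∀ p ∈ cell n, ‖f p‖ ≤ C

namespace CellBdd

variable {f g : EuclideanSpace ℝ (Fin d) → EuclideanSpace ℝ (Fin d)}

theorem add (hf : CellBdd f) (hg : CellBdd g) : CellBdd fun p => f p + g p := by
  refine ⟨hf.1.add hg.1, fun n => ?_⟩
  obtain ⟨C, hC⟩ := hf.2 n
  obtain ⟨C', hC'⟩ := hg.2 n
  exact ⟨C + C', fun p hp => (norm_add_le _ _).trans (add_le_add (hC p hp) (hC' p hp))⟩

theorem neg (hf : CellBdd f) : CellBdd fun p => -f p :=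
  ⟨hf.1.neg, fun n => by simpa using hf.2 n⟩

theorem sub (hf : CellBdd f) (hg : CellBdd g) : CellBdd fun p => f p - g p := by
  simpa [sub_eq_add_neg] using hf.add hg.neg

theorem const (x : EuclideanSpace ℝ (Fin d)) : CellBdd fun _ : EuclideanSpace ℝ (Fin d) => x :=
  ⟨measurable_const, fun _ => ⟨‖x‖, fun _ _ => le_rfl⟩⟩

theorem id : CellBdd fun p : EuclideanSpace ℝ (Fin d) => p :=
  ⟨measurable_id, fun n => ⟨(1 + d) * wt n, fun _ hp => norm_le_of_mem_cell hp⟩⟩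

end CellBdd

/-- Borel maps within distance `δ` of the identity. -/
structure IsNear (δ : ℝ) (f : EuclideanSpace ℝ (Fin d) → EuclideanSpace ℝ (Fin d)) : Prop where
  measurable : Measurable f
  dist_le : ∀ p, ‖f p - p‖ ≤ δ

namespace IsNear

variable {f : EuclideanSpace ℝ (Fin d) → EuclideanSpace ℝ (Fin d)} {δ : ℝ}

theorem cellBdd (hf : IsNear δ f) : CellBdd f := by
  have h : CellBdd fun p => f p - p := ⟨hf.1.sub measurable_id, fun n => ⟨δ, fun p _ => hf.2 p⟩⟩
  simpa using h.add CellBdd.id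

theorem id (hδ : 0 ≤ δ) : IsNear δ fun p : EuclideanSpace ℝ (Fin d) => p :=
  ⟨measurable_id, fun p => by simpa using hδ⟩

theorem mono (hf : IsNear δ f) {δ' : ℝ} (h : δ ≤ δ') : IsNear δ' f :=
  ⟨hf.1, fun p => (hf.2 p).trans h⟩

theorem norm_sub_corner_le (hf : IsNear 1 f) {n : Fin d → ℤ} {p : EuclideanSpace ℝ (Fin d)}
    (hp : p ∈ cell n) : ‖f p - corner n‖ ≤ 2 + d := by
  have h1 := norm_add_le (f p - p) (p - corner n)
  rw [sub_add_sub_cancel] at h1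
  linarith [hf.2 p, Warped.norm_sub_corner_le hp]

end IsNear

theorem IsTaggedPartition.isNear {δ : ℝ} {Δ : ℕ → Set (EuclideanSpace ℝ (Fin d))}
    {t : ℕ → EuclideanSpace ℝ (Fin d)} (h : IsTaggedPartition δ Δ t) : IsNear δ h.tagMap :=
  ⟨h.measurable_tagMap, fun p => by simpa [dist_eq_norm] using h.dist_tagMap_le p⟩

theorem measurable_bilin_comp (σ : LinearMap.BilinForm ℝ (EuclideanSpace ℝ (Fin d)))
    {f g : EuclideanSpace ℝ (Fin d) → EuclideanSpace ℝ (Fin d)} (hf : Measurable f)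
    (hg : Measurable g) : Measurable fun p => σ (f p) (g p) := by
  have h : ∀ p, σ (f p) (g p) = ∑ a, f p a * σ (EuclideanSpace.single a 1) (g p) := by
    intro p
    have hx := (EuclideanSpace.basisFun (Fin d) ℝ).sum_repr (f p)
    conv_lhs => rw [← hx]
    simp
  simp only [h]
  refine Finset.measurable_sum _ fun a _ => Measurable.mul ?_ ?_
  · exact (by fun_prop : Measurable fun x : EuclideanSpace ℝ (Fin d) => x a).comp hf
  · exact (LinearMap.continuous_of_finiteDimensional
      (σ (EuclideanSpace.single a 1))).measurable.comp hg

theorem bilin_eq_sum (σ : LinearMap.BilinForm ℝ (EuclideanSpace ℝ (Fin d)))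
    (x y : EuclideanSpace ℝ (Fin d)) : σ x y = ∑ a, x a * σ (EuclideanSpace.single a 1) y := by
  have hx := (EuclideanSpace.basisFun (Fin d) ℝ).sum_repr x
  conv_lhs => rw [← hx]
  simp

/-- The left factor of the symbol of `warpMap`. -/
def cellLeft (f : EuclideanSpace ℝ (Fin d) → EuclideanSpace ℝ (Fin d)) (m : Fin d → ℤ)
    (a : Fin d) : EuclideanSpace ℝ (Fin d) → ℂ :=
  (cell m).indicator fun p => Complex.I * (f p a : ℂ)

/-- The right factor of the symbol of `warpMap`. -/
def cellRight (σ : LinearMap.BilinForm ℝ (EuclideanSpace ℝ (Fin d)))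
    (g : EuclideanSpace ℝ (Fin d) → EuclideanSpace ℝ (Fin d)) (n : Fin d → ℤ)
    (a : Fin d) : EuclideanSpace ℝ (Fin d) → ℂ :=
  (cell n).indicator fun q => (σ (EuclideanSpace.single a 1) (g q) : ℂ)

variable {σ : LinearMap.BilinForm ℝ (EuclideanSpace ℝ (Fin d))}
  {f g f' g' : EuclideanSpace ℝ (Fin d) → EuclideanSpace ℝ (Fin d)} {m n : Fin d → ℤ}

theorem norm_cellLeft_le {M : ℝ} (hM : 0 ≤ M) (h : ∀ p ∈ cell m, ‖f p‖ ≤ M) (a : Fin d)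
    (p : EuclideanSpace ℝ (Fin d)) : ‖cellLeft f m a p‖ ≤ M := by
  by_cases hp : p ∈ cell m
  · rw [cellLeft, Set.indicator_of_mem hp, norm_mul, Complex.norm_I, one_mul, Complex.norm_real]
    exact (PiLp.norm_apply_le (f p) a).trans (h p hp)
  · rwa [cellLeft, Set.indicator_of_notMem hp, norm_zero]

theorem norm_cellRight_le {c N : ℝ} (hc : 0 ≤ c) (hσ : ∀ x y, |σ x y| ≤ c * ‖x‖ * ‖y‖) (hN : 0 ≤ N)
    (h : ∀ q ∈ cell n, ‖g q‖ ≤ N) (a : Fin d) (q : EuclideanSpace ℝ (Fin d)) :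
    ‖cellRight σ g n a q‖ ≤ c * N := by
  by_cases hq : q ∈ cell n
  · rw [cellRight, Set.indicator_of_mem hq, Complex.norm_real, Real.norm_eq_abs]
    refine (hσ _ _).trans ?_
    rw [PiLp.norm_single, norm_one, mul_one]
    exact mul_le_mul_of_nonneg_left (h q hq) hc
  · rw [cellRight, Set.indicator_of_notMem hq, norm_zero]
    positivity

theorem CellBdd.cellLeft (hf : CellBdd f) (m : Fin d → ℤ) (a : Fin d) :
    IsBddMeas (cellLeft f m a) := by
  obtain ⟨C, hC⟩ := hf.2 m
  refine IsBddMeas.of_bound (C := max C 0) ?_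
    (norm_cellLeft_le (le_max_right _ _) (fun p hp => (hC p hp).trans (le_max_left _ _)) a)
  refine Measurable.indicator ?_ (measurableSet_cell m)
  refine (Complex.measurable_ofReal.comp ?_).const_mul _
  exact (by fun_prop : Measurable fun x : EuclideanSpace ℝ (Fin d) => x a).comp hf.1

theorem CellBdd.cellRight (hg : CellBdd g) (σ : LinearMap.BilinForm ℝ (EuclideanSpace ℝ (Fin d)))
    (n : Fin d → ℤ) (a : Fin d) : IsBddMeas (cellRight σ g n a) := by
  obtain ⟨c, hc0, hc⟩ := exists_bilin_bound σ
  obtain ⟨C, hC⟩ := hg.2 n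
  refine IsBddMeas.of_bound (C := c * max C 0) ?_
    (norm_cellRight_le hc0 hc (le_max_right _ _) (fun p hp => (hC p hp).trans (le_max_left _ _)) a)
  refine Measurable.indicator ?_ (measurableSet_cell n)
  exact Complex.measurable_ofReal.comp ((LinearMap.continuous_of_finiteDimensional
      (σ (EuclideanSpace.single a 1))).measurable.comp hg.1)

namespace SpectralMeasure

variable (E : SpectralMeasure d H)

variable (σ f g m n) in
/-- The double operator integral with symbol `exp (i σ(f(p), g(q)))` between two unit cubes. -/
def warpMap : (H →L[ℂ] H) →L[ℂ] (H →L[ℂ] H) := E.schur (cellLeft f m) (cellRight σ g n)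

theorem warpMap_add_left (hf : CellBdd f) (hf' : CellBdd f') (hg : CellBdd g) :
    E.warpMap σ (fun p => f p + f' p) g m n = E.warpMap σ f g m n * E.warpMap σ f' g m n := by
  rw [warpMap, warpMap, warpMap, ← E.schur_add_left (hf.cellLeft m) (hg.cellRight σ n)
    (hf'.cellLeft m)]
  congr 1
  ext a p
  by_cases hp : p ∈ cell m
  · simp only [cellLeft, hp, Set.indicator_of_mem, PiLp.add_apply, Complex.ofReal_add, mul_add]
  · simp [cellLeft, hp]

theorem warpMap_add_right (hf : CellBdd f) (hg : CellBdd g) (hg' : CellBdd g') :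
    E.warpMap σ f (fun q => g q + g' q) m n = E.warpMap σ f g m n * E.warpMap σ f g' m n := by
  rw [warpMap, warpMap, warpMap, ← E.schur_add_right (hf.cellLeft m) (hg.cellRight σ n)
    (hg'.cellRight σ n)]
  congr 1
  ext a p
  by_cases hp : p ∈ cell n
  · simp only [cellRight, hp, Set.indicator_of_mem, map_add, Complex.ofReal_add]
  · simp [cellRight, hp]

theorem warpMap_neg_mul_warpMap (hf : CellBdd f) (hg : CellBdd g) :
    E.warpMap σ f g m n * E.warpMap (-σ) f g m n = 1 := by
  have h1 : E.warpMap (-σ) f g m n = E.warpMap σ f (fun q => -g q) m n := by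
    rw [warpMap, warpMap]
    congr 1
    ext a p
    by_cases hp : p ∈ cell n <;> simp [cellRight, hp]
  have h2 : cellRight σ (fun _ => (0 : EuclideanSpace ℝ (Fin d))) n = fun _ _ => (0 : ℂ) := by
    ext a p
    simp [cellRight]
  rw [h1, ← E.warpMap_add_right hf hg hg.neg]
  simp only [add_neg_cancel]
  rw [warpMap, h2, schur, schurGen]
  have h3 : E.fc (fun _ => (0 : ℂ)) = 0 := by rw [E.fc_const, zero_smul]
  have h4 : rightMul (0 : H →L[ℂ] H) = 0 := by
    ext1 X
    simp
  simp only [h3, h4, mul_zero, Finset.sum_const_zero, NormedSpace.exp_zero]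

theorem block_mul_warpMap (hf : CellBdd f) (X : H →L[ℂ] H) (l : Fin d → ℤ) :
    E.block l * E.warpMap σ f g m n X = E.warpMap σ f g m n (E.block l * X) := by
  rw [block, ← E.fc_indicator_one (measurableSet_cell l)]
  exact E.fc_mul_schur (IsBddMeas.indicator_one (measurableSet_cell l)) (hf.cellLeft m) X

theorem warpMap_mul_block (hg : CellBdd g) (X : H →L[ℂ] H) (l : Fin d → ℤ) :
    E.warpMap σ f g m n X * E.block l = E.warpMap σ f g m n (X * E.block l) := by
  rw [block, ← E.fc_indicator_one (measurableSet_cell l)]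
  exact E.schur_mul_fc (IsBddMeas.indicator_one (measurableSet_cell l)) (hg.cellRight σ n) X

/-- Where g is constant the symbol depends on p alone, so the multiplier is multiplication from the
left. The condition on `X` removes the cut-off to `cell m` from the resulting unitary. -/
theorem warpMap_mul_proj (hf : CellBdd f) (hg : CellBdd g) {X : H →L[ℂ] H} (hX : E.block m * X = X)
    {S : Set (EuclideanSpace ℝ (Fin d))} (hS : MeasurableSet S) (hSn : S ⊆ cell n)
    {y : EuclideanSpace ℝ (Fin d)} (hy : ∀ q ∈ S, g q = y) :
    E.warpMap σ f g m n X * E.proj S =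
      E.fc (fun p => Complex.exp (Complex.I * (σ (f p) y : ℂ))) * X * E.proj S := by
  rw [warpMap, E.schur_mul_proj (hf.cellLeft m) (hg.cellRight σ n) hS
    (c := fun a => (σ (EuclideanSpace.single a 1) y : ℂ)) fun a q hq => by
      rw [cellRight, Set.indicator_of_mem (hSn hq), hy q hq]]
  congr 1
  rw [← hX, ← mul_assoc, ← mul_assoc, block,
    E.fc_mul_proj_congr (IsBddMeas.exp (IsBddMeas.sum _ fun a _ =>
      (hf.cellLeft m a).mul (IsBddMeas.const _)))
      (isBddMeas_cexp_I_mul (measurable_bilin_comp σ hf.1 measurable_const)) (measurableSet_cell m)]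
  intro p hp
  rw [bilin_eq_sum]
  simp only [cellLeft, Set.indicator_of_mem hp, Complex.ofReal_sum, Complex.ofReal_mul,
    Finset.mul_sum, mul_assoc]

theorem proj_mul_warpMap (hf : CellBdd f) (hg : CellBdd g) {X : H →L[ℂ] H} (hX : X * E.block n = X)
    {S : Set (EuclideanSpace ℝ (Fin d))} (hS : MeasurableSet S) (hSm : S ⊆ cell m)
    {x : EuclideanSpace ℝ (Fin d)} (hx : ∀ p ∈ S, f p = x) :
    E.proj S * E.warpMap σ f g m n X =
      E.proj S * X * E.fc (fun q => Complex.exp (Complex.I * (σ x (g q) : ℂ))) := by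
  have h1 := IsBddMeas.exp (IsBddMeas.sum Finset.univ fun a _ =>
      (hg.cellRight σ n a).const_mul (Complex.I * (x a : ℂ)))
  have h2 := isBddMeas_cexp_I_mul (measurable_bilin_comp σ (measurable_const (a := x)) hg.1)
  rw [warpMap, E.proj_mul_schur (hg.cellRight σ n) (hf.cellLeft m) hS
    (c := fun a => Complex.I * (x a : ℂ)) fun a q hq => by
      rw [cellLeft, Set.indicator_of_mem (hSm hq), hx q hq]]
  rw [← hX, mul_assoc, mul_assoc, mul_assoc, mul_assoc, block,
    ← (E.fc_comm_proj h1 (measurableSet_cell n)).eq,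
    ← (E.fc_comm_proj h2 (measurableSet_cell n)).eq,
    E.fc_mul_proj_congr h1 h2 (measurableSet_cell n)]
  intro p hp
  rw [bilin_eq_sum]
  simp only [cellRight, Set.indicator_of_mem hp, Complex.ofReal_sum, Complex.ofReal_mul,
    Finset.mul_sum, mul_assoc]

theorem norm_fc_cexp_I_le {h : EuclideanSpace ℝ (Fin d) → ℝ} (hh : Measurable h) :
    ‖E.fc fun p => Complex.exp (Complex.I * (h p : ℂ))‖ ≤ 1 :=
  E.norm_fc_le (isBddMeas_cexp_I_mul hh) zero_le_one fun p => by
    rw [mul_comm, Complex.norm_exp_ofReal_mul_I]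

theorem norm_fc_cexp_I_mul_sub_le {h : EuclideanSpace ℝ (Fin d) → ℝ} (hh : Measurable h) {M : ℝ}
    (hM : 0 ≤ M) (hhM : ∀ p ∈ cell m, |h p| ≤ M) {X : H →L[ℂ] H} (hX : E.block m * X = X) :
    ‖(E.fc fun p => Complex.exp (Complex.I * (h p : ℂ))) * X - X‖ ≤ M * ‖X‖ := by
  have hb := isBddMeas_cexp_I_mul hh
  have h1 := hb.indicator (measurableSet_cell m)
  have h2 := IsBddMeas.indicator_one (measurableSet_cell m)
  have e : (E.fc fun p => Complex.exp (Complex.I * (h p : ℂ))) * X - X =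
      (E.fc ((cell m).indicator fun p => Complex.exp (Complex.I * (h p : ℂ))) -
        E.fc ((cell m).indicator 1)) * X := by
    rw [sub_mul, ← E.fc_mul_proj hb (measurableSet_cell m), E.fc_indicator_one
      (measurableSet_cell m), mul_assoc]
    change _ = _ * (E.block m * X) - E.block m * X
    rw [hX]
  rw [e]
  refine (norm_mul_le _ _).trans (mul_le_mul_of_nonneg_right ?_ (norm_nonneg X))
  refine E.norm_fc_sub_fc_le h1 h2 hM fun p => ?_
  by_cases hp : p ∈ cell m
  · simp only [hp, Set.indicator_of_mem, Pi.one_apply]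
    exact (norm_cexp_I_mul_sub_one_le _).trans (hhM p hp)
  · simpa [hp] using hM

theorem norm_mul_fc_cexp_I_sub_le {h : EuclideanSpace ℝ (Fin d) → ℝ} (hh : Measurable h) {M : ℝ}
    (hM : 0 ≤ M) (hhM : ∀ p ∈ cell n, |h p| ≤ M) {X : H →L[ℂ] H} (hX : X * E.block n = X) :
    ‖X * (E.fc fun p => Complex.exp (Complex.I * (h p : ℂ))) - X‖ ≤ M * ‖X‖ := by
  have hb := isBddMeas_cexp_I_mul hh
  have h1 := hb.indicator (measurableSet_cell n)
  have h2 := IsBddMeas.indicator_one (measurableSet_cell n)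
  have e : X * (E.fc fun p => Complex.exp (Complex.I * (h p : ℂ))) - X =
      X * (E.fc ((cell n).indicator fun p => Complex.exp (Complex.I * (h p : ℂ))) -
        E.fc ((cell n).indicator 1)) := by
    rw [mul_sub, ← E.fc_mul_proj hb (measurableSet_cell n), E.fc_indicator_one
      (measurableSet_cell n), (E.fc_comm_proj hb (measurableSet_cell n)).eq, ← mul_assoc]
    change _ = X * E.block n * _ - X * E.block n
    rw [hX]
  rw [e, mul_comm M]
  refine (norm_mul_le _ _).trans (mul_le_mul_of_nonneg_left ?_ (norm_nonneg X))
  refine E.norm_fc_sub_fc_le h1 h2 hM fun p => ?_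
  by_cases hp : p ∈ cell n
  · simp only [hp, Set.indicator_of_mem, Pi.one_apply]
    exact (norm_cexp_I_mul_sub_one_le _).trans (hhM p hp)
  · simpa [hp] using hM

theorem warpMap_const_right (hf : CellBdd f) (y : EuclideanSpace ℝ (Fin d)) {X : H →L[ℂ] H}
    (hX : E.block m * X = X) (hX' : X * E.block n = X) :
    E.warpMap σ f (fun _ => y) m n X =
      E.fc (fun p => Complex.exp (Complex.I * (σ (f p) y : ℂ))) * X := by
  have h := E.warpMap_mul_proj (σ := σ) hf (CellBdd.const y) hX (measurableSet_cell n) le_rfl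
    fun _ _ => rfl
  change _ * E.block n = _ * E.block n at h
  rwa [E.warpMap_mul_block (CellBdd.const y), hX', mul_assoc, hX'] at h

theorem warpMap_const_left (x : EuclideanSpace ℝ (Fin d)) (hg : CellBdd g) {X : H →L[ℂ] H}
    (hX : E.block m * X = X) (hX' : X * E.block n = X) :
    E.warpMap σ (fun _ => x) g m n X =
      X * E.fc (fun q => Complex.exp (Complex.I * (σ x (g q) : ℂ))) := by
  have h := E.proj_mul_warpMap (σ := σ) (CellBdd.const x) hg hX' (measurableSet_cell m) le_rfl
    fun _ _ => rfl
  change E.block m * _ = E.block m * _ * _ at h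
  rwa [E.block_mul_warpMap (CellBdd.const x), hX] at h

section Estimates

variable {c M N : ℝ}

theorem norm_warpMap_sub_le (hc : 0 ≤ c) (hσ : ∀ x y, |σ x y| ≤ c * ‖x‖ * ‖y‖) (hf : CellBdd f)
    (hg : CellBdd g) (hM : 0 ≤ M) (hN : 0 ≤ N) (hfM : ∀ p ∈ cell m, ‖f p‖ ≤ M)
    (hgN : ∀ q ∈ cell n, ‖g q‖ ≤ N) (X : H →L[ℂ] H) :
    ‖E.warpMap σ f g m n X - X‖ ≤ (Real.exp (d * (M * (c * N))) - 1) * ‖X‖ :=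
  E.norm_schur_apply_sub_le (hf.cellLeft m) (hg.cellRight σ n) hM (by positivity)
    (norm_cellLeft_le hM hfM) (norm_cellRight_le hc hσ hN hgN) X

theorem norm_warpMap_le (hc : 0 ≤ c) (hσ : ∀ x y, |σ x y| ≤ c * ‖x‖ * ‖y‖) (hf : CellBdd f)
    (hg : CellBdd g) (hM : 0 ≤ M) (hN : 0 ≤ N) (hfM : ∀ p ∈ cell m, ‖f p‖ ≤ M)
    (hgN : ∀ q ∈ cell n, ‖g q‖ ≤ N) (X : H →L[ℂ] H) :
    ‖E.warpMap σ f g m n X‖ ≤ Real.exp (d * (M * (c * N))) * ‖X‖ :=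
  E.norm_schur_apply_le (hf.cellLeft m) (hg.cellRight σ n) hM (by positivity)
    (norm_cellLeft_le hM hfM) (norm_cellRight_le hc hσ hN hgN) X

/-- The symbol factors as exp(iσ(f(p), g(q) - y)) exp(iσ(f(p), y)), and the second factor is a
unitary multiplying from the left. Hence large values of g on distant cubes do not spoil norm
bounds. -/
theorem warpMap_eq_center_right (hf : CellBdd f) (hg : CellBdd g) (y : EuclideanSpace ℝ (Fin d))
    {X : H →L[ℂ] H} (hX : E.block m * X = X) (hX' : X * E.block n = X) :
    E.warpMap σ f g m n X = E.warpMap σ f (fun q => g q - y) m n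
      (E.fc (fun p => Complex.exp (Complex.I * (σ (f p) y : ℂ))) * X) := by
  have h := E.warpMap_add_right (σ := σ) (m := m) (n := n) hf (hg.sub (CellBdd.const y))
    (CellBdd.const y)
  simp only [sub_add_cancel] at h
  rw [h, mul_apply_eq_comp, E.warpMap_const_right hf y hX hX']

theorem warpMap_eq_center_left (hf : CellBdd f) (hg : CellBdd g) (x : EuclideanSpace ℝ (Fin d))
    {X : H →L[ℂ] H} (hX : E.block m * X = X) (hX' : X * E.block n = X) :
    E.warpMap σ f g m n X = E.warpMap σ (fun p => f p - x) g m n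
      (X * E.fc (fun q => Complex.exp (Complex.I * (σ x (g q) : ℂ)))) := by
  have h := E.warpMap_add_left (σ := σ) (m := m) (n := n) (hf.sub (CellBdd.const x))
    (CellBdd.const x) hg
  simp only [sub_add_cancel] at h
  rw [h, mul_apply_eq_comp, E.warpMap_const_left x hg hX hX']

/-- For f small and g merely near the corner of its cube: the exponential term comes from the
centred multiplier, the linear term from the distance of the split-off unitary from 1. -/
theorem norm_warpMap_sub_le_of_right (hc : 0 ≤ c) (hσ : ∀ x y, |σ x y| ≤ c * ‖x‖ * ‖y‖)
    (hf : CellBdd f) (hg : CellBdd g) (hM : 0 ≤ M) (hN : 0 ≤ N) (hfM : ∀ p ∈ cell m, ‖f p‖ ≤ M)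
    (hgN : ∀ q ∈ cell n, ‖g q - corner n‖ ≤ N) {X : H →L[ℂ] H} (hX : E.block m * X = X)
    (hX' : X * E.block n = X) :
    ‖E.warpMap σ f g m n X - X‖ ≤
      (Real.exp (d * (M * (c * N))) - 1 + c * M * ‖corner n‖) * ‖X‖ := by
  have hmeas := measurable_bilin_comp σ hf.1 (measurable_const (a := corner n))
  set Y := E.fc (fun p => Complex.exp (Complex.I * (σ (f p) (corner n) : ℂ))) * X with hY
  have h1 : ‖Y - X‖ ≤ c * M * ‖corner n‖ * ‖X‖ :=
    E.norm_fc_cexp_I_mul_sub_le hmeas (by positivity) (fun p hp => (hσ _ _).trans (by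
      gcongr
      exact hfM p hp)) hX
  have h2 : ‖Y‖ ≤ ‖X‖ := (norm_mul_le _ _).trans
    (mul_le_of_le_one_left (norm_nonneg _) (E.norm_fc_cexp_I_le hmeas))
  have h3 := E.norm_warpMap_sub_le hc hσ (m := m) (n := n) hf (hg.sub (CellBdd.const (corner n)))
    hM hN hfM hgN Y
  have h4 : 0 ≤ Real.exp (d * (M * (c * N))) - 1 :=
    sub_nonneg.2 (Real.one_le_exp (by positivity))
  rw [E.warpMap_eq_center_right hf hg (corner n) hX hX', ← hY]
  have h5 := norm_sub_le_norm_sub_add_norm_sub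
    (E.warpMap σ f (fun q => g q - corner n) m n Y) Y X
  have h6 := mul_le_mul_of_nonneg_left h2 h4
  rw [add_mul]
  linarith

theorem norm_warpMap_sub_le_of_left (hc : 0 ≤ c) (hσ : ∀ x y, |σ x y| ≤ c * ‖x‖ * ‖y‖)
    (hf : CellBdd f) (hg : CellBdd g) (hM : 0 ≤ M) (hN : 0 ≤ N)
    (hfM : ∀ p ∈ cell m, ‖f p - corner m‖ ≤ M) (hgN : ∀ q ∈ cell n, ‖g q‖ ≤ N) {X : H →L[ℂ] H}
    (hX : E.block m * X = X) (hX' : X * E.block n = X) :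
    ‖E.warpMap σ f g m n X - X‖ ≤
      (Real.exp (d * (M * (c * N))) - 1 + c * ‖corner m‖ * N) * ‖X‖ := by
  have hmeas := measurable_bilin_comp σ (measurable_const (a := corner m)) hg.1
  set Y := X * E.fc (fun q => Complex.exp (Complex.I * (σ (corner m) (g q) : ℂ))) with hY
  have h1 : ‖Y - X‖ ≤ c * ‖corner m‖ * N * ‖X‖ :=
    E.norm_mul_fc_cexp_I_sub_le hmeas (by positivity) (fun p hp => (hσ _ _).trans (by
      gcongr
      exact hgN p hp)) hX'
  have h2 : ‖Y‖ ≤ ‖X‖ := (norm_mul_le _ _).trans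
    (mul_le_of_le_one_right (norm_nonneg _) (E.norm_fc_cexp_I_le hmeas))
  have h3 := E.norm_warpMap_sub_le hc hσ (m := m) (n := n) (hf.sub (CellBdd.const (corner m))) hg
    hM hN hfM hgN Y
  have h4 : 0 ≤ Real.exp (d * (M * (c * N))) - 1 :=
    sub_nonneg.2 (Real.one_le_exp (by positivity))
  rw [E.warpMap_eq_center_left hf hg (corner m) hX hX', ← hY]
  have h5 := norm_sub_le_norm_sub_add_norm_sub
    (E.warpMap σ (fun p => f p - corner m) g m n Y) Y X
  have h6 := mul_le_mul_of_nonneg_left h2 h4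
  rw [add_mul]
  linarith

/-- Both corners are split off as unitary factors, so the bound involves only the deviations from
the corners and is the same for all cubes. -/
theorem norm_warpMap_le_of_center (hc : 0 ≤ c) (hσ : ∀ x y, |σ x y| ≤ c * ‖x‖ * ‖y‖)
    (hf : CellBdd f) (hg : CellBdd g) (hM : 0 ≤ M) (hN : 0 ≤ N)
    (hfM : ∀ p ∈ cell m, ‖f p - corner m‖ ≤ M) (hgN : ∀ q ∈ cell n, ‖g q - corner n‖ ≤ N)
    {X : H →L[ℂ] H} (hX : E.block m * X = X) (hX' : X * E.block n = X) :
    ‖E.warpMap σ f g m n X‖ ≤ Real.exp (d * (M * (c * N))) * ‖X‖ := by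
  have hmeas := measurable_bilin_comp σ (measurable_const (a := corner m)) hg.1
  have hmeas' := measurable_bilin_comp σ (hf.sub (CellBdd.const (corner m))).1
    (measurable_const (a := corner n))
  set Y := X * E.fc (fun q => Complex.exp (Complex.I * (σ (corner m) (g q) : ℂ))) with hY
  have hYb : E.block m * Y = Y := by rw [hY, ← mul_assoc, hX]
  have hYb' : Y * E.block n = Y := by
    rw [hY, mul_assoc, block, (E.fc_comm_proj (isBddMeas_cexp_I_mul hmeas) (measurableSet_cell n)).eq,
      ← mul_assoc]
    change X * E.block n * _ = _
    rw [hX']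
  rw [E.warpMap_eq_center_left hf hg (corner m) hX hX', ← hY,
    E.warpMap_eq_center_right (hf.sub (CellBdd.const _)) hg (corner n) hYb hYb']
  refine (E.norm_warpMap_le hc hσ (hf.sub (CellBdd.const _)) (hg.sub (CellBdd.const _)) hM hN hfM
    hgN _).trans (mul_le_mul_of_nonneg_left ?_ (Real.exp_pos _).le)
  refine (norm_mul_le _ _).trans ((mul_le_of_le_one_left (norm_nonneg _)
    (E.norm_fc_cexp_I_le hmeas')).trans ?_)
  exact (norm_mul_le _ _).trans
    (mul_le_of_le_one_right (norm_nonneg _) (E.norm_fc_cexp_I_le hmeas))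

theorem exp_mul_sub_one_le {K δ : ℝ} (hK : 0 ≤ K) (hδ : 0 ≤ δ) (hδ1 : δ ≤ 1) :
    Real.exp (K * δ) - 1 ≤ K * Real.exp K * δ := by
  have h1 := Real.add_one_le_exp (-(K * δ))
  have h2 : Real.exp (K * δ) * Real.exp (-(K * δ)) = 1 := by rw [← Real.exp_add]; simp
  have h3 := mul_le_mul_of_nonneg_left h1 (Real.exp_pos (K * δ)).le
  have h4 : Real.exp (K * δ) ≤ Real.exp K :=
    Real.exp_le_exp.2 (mul_le_of_le_one_right hK hδ1)
  have h5 := mul_le_mul_of_nonneg_left h4 (mul_nonneg hK hδ)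
  linarith

variable (σ) in
/-- The basic estimates on `warpMap` for maps close to the identity. -/
theorem exists_warpMap_bounds : ∃ C, 0 ≤ C ∧ ∀ (m n : Fin d → ℤ) (X : H →L[ℂ] H),
    E.block m * X = X → X * E.block n = X → ∀ f g, IsNear 1 f → IsNear 1 g →
      ‖E.warpMap σ f g m n X‖ ≤ C * ‖X‖ ∧
      (∀ δ, 0 ≤ δ → δ ≤ 1 → IsNear δ f →
        ‖E.warpMap σ f g m n X - E.warpMap σ (fun p => p) g m n X‖ ≤ C * δ * wt n * ‖X‖) ∧
      (∀ δ, 0 ≤ δ → δ ≤ 1 → IsNear δ g →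
        ‖E.warpMap σ f g m n X - E.warpMap σ f (fun q => q) m n X‖ ≤ C * δ * wt m * ‖X‖) := by
  obtain ⟨c, hc, hσ⟩ := exists_bilin_bound σ
  -- In K₀ both maps deviate from the corners of their cubes by at most 2 + d. In K₁ one deviation
  -- is dropped, to be replaced by δ when that map is a perturbation of size δ.
  set K₀ : ℝ := d * ((2 + d) * (c * (2 + d))) with hK₀
  set K₁ : ℝ := d * (c * (2 + d)) with hK₁
  have hK₀0 : 0 ≤ K₀ := by positivity
  have hK₁0 : 0 ≤ K₁ := by positivity
  set C₁ : ℝ := K₁ * Real.exp K₁ + c * (1 + d) with hC₁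
  have hC₁0 : 0 ≤ C₁ := by positivity
  have hid : IsNear 1 fun p : EuclideanSpace ℝ (Fin d) => p := IsNear.id zero_le_one
  have hbound : ∀ (m n : Fin d → ℤ) (X : H →L[ℂ] H),
      E.block m * X = X → X * E.block n = X → ∀ f g, IsNear 1 f → IsNear 1 g →
      ‖E.warpMap σ f g m n X‖ ≤ Real.exp K₀ * ‖X‖ := fun m n X hX hX' f g hf hg =>
    E.norm_warpMap_le_of_center hc hσ hf.cellBdd hg.cellBdd (by positivity) (by positivity)
      (fun p hp => hf.norm_sub_corner_le hp) (fun p hp => hg.norm_sub_corner_le hp) hX hX'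
  have hsmall : ∀ (l : Fin d → ℤ) (δ : ℝ), 0 ≤ δ → δ ≤ 1 →
      Real.exp (K₁ * δ) - 1 + c * δ * ‖corner l‖ ≤ C₁ * δ * wt l := by
    intro l δ hδ hδ1
    have h1 := exp_mul_sub_one_le hK₁0 hδ hδ1
    have h2 := mul_le_mul_of_nonneg_left (norm_corner_le l) (mul_nonneg hc hδ)
    have h3 : K₁ * Real.exp K₁ * δ * 1 ≤ K₁ * Real.exp K₁ * δ * wt l :=
      mul_le_mul_of_nonneg_left (one_le_wt l) (by positivity)
    rw [hC₁]
    linarith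
  refine ⟨max (Real.exp K₀) (C₁ * Real.exp K₀), le_max_of_le_left (Real.exp_pos _).le,
    fun m n X hX hX' f g hf hg => ⟨?_, fun δ hδ hδ1 hfδ => ?_, fun δ hδ hδ1 hgδ => ?_⟩⟩
  · exact (hbound m n X hX hX' f g hf hg).trans
      (mul_le_mul_of_nonneg_right (le_max_left _ _) (norm_nonneg X))
  · set Y := E.warpMap σ (fun p => p) g m n X with hY
    have hYX : ‖Y‖ ≤ Real.exp K₀ * ‖X‖ := hbound m n X hX hX' _ g hid hg
    have hYb : E.block m * Y = Y := by rw [hY, E.block_mul_warpMap CellBdd.id, hX]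
    have hYb' : Y * E.block n = Y := by rw [hY, E.warpMap_mul_block hg.cellBdd, hX']
    -- Writing f as (f - id) + id leaves a multiplier close to 1 acting on the operator `Y` for the
    -- untagged variable.
    have h1 : E.warpMap σ f g m n X = E.warpMap σ (fun p => f p - p) g m n Y := by
      have h := E.warpMap_add_left (σ := σ) (m := m) (n := n) (hf.cellBdd.sub CellBdd.id)
        CellBdd.id hg.cellBdd
      simp only [sub_add_cancel] at h
      rw [h, mul_apply_eq_comp]
    rw [h1]
    refine (E.norm_warpMap_sub_le_of_right hc hσ (hf.cellBdd.sub CellBdd.id) hg.cellBdd hδ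
      (N := 2 + d) (by positivity) (fun p _ => hfδ.2 p) (fun p hp => hg.norm_sub_corner_le hp) hYb
      hYb').trans ?_
    have e : (d : ℝ) * (δ * (c * (2 + d))) = K₁ * δ := by rw [hK₁]; ring
    rw [e]
    have hn := wt_pos n
    calc (Real.exp (K₁ * δ) - 1 + c * δ * ‖corner n‖) * ‖Y‖
        ≤ (C₁ * δ * wt n) * (Real.exp K₀ * ‖X‖) :=
          mul_le_mul (hsmall n δ hδ hδ1) hYX (norm_nonneg _) (by positivity)
      _ = (C₁ * Real.exp K₀) * δ * wt n * ‖X‖ := by ring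
      _ ≤ _ := by
          gcongr
          exact le_max_right _ _
  · set Y := E.warpMap σ f (fun q => q) m n X with hY
    have hYX : ‖Y‖ ≤ Real.exp K₀ * ‖X‖ := hbound m n X hX hX' f _ hf hid
    have hYb : E.block m * Y = Y := by rw [hY, E.block_mul_warpMap hf.cellBdd, hX]
    have hYb' : Y * E.block n = Y := by rw [hY, E.warpMap_mul_block CellBdd.id, hX']
    have h1 : E.warpMap σ f g m n X = E.warpMap σ f (fun q => g q - q) m n Y := by
      have h := E.warpMap_add_right (σ := σ) (m := m) (n := n) hf.cellBdd
        (hg.cellBdd.sub CellBdd.id) CellBdd.id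
      simp only [sub_add_cancel] at h
      rw [h, mul_apply_eq_comp]
    rw [h1]
    refine (E.norm_warpMap_sub_le_of_left hc hσ hf.cellBdd (hg.cellBdd.sub CellBdd.id)
      (M := 2 + d) (by positivity) hδ (fun p hp => hf.norm_sub_corner_le hp) (fun p _ => hgδ.2 p)
      hYb hYb').trans ?_
    have e : (d : ℝ) * ((2 + d) * (c * δ)) = K₁ * δ := by rw [hK₁]; ring
    have e' : c * ‖corner m‖ * δ = c * δ * ‖corner m‖ := by ring
    rw [e, e']
    have hm := wt_pos m
    calc (Real.exp (K₁ * δ) - 1 + c * δ * ‖corner m‖) * ‖Y‖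
        ≤ (C₁ * δ * wt m) * (Real.exp K₀ * ‖X‖) :=
          mul_le_mul (hsmall m δ hδ hδ1) hYX (norm_nonneg _) (by positivity)
      _ = (C₁ * Real.exp K₀) * δ * wt m * ‖X‖ := by ring
      _ ≤ _ := by
          gcongr
          exact le_max_right _ _

end Estimates

end SpectralMeasure

end WarpMap

/-! ### Convergence of the Riemann sums to the warped matrix. -/

section Warping

variable {d : ℕ} {H : Type*} [NormedAddCommGroup H] [InnerProductSpace ℂ H] [CompleteSpace H]
  {E : SpectralMeasure d H} {σ : LinearMap.BilinForm ℝ (EuclideanSpace ℝ (Fin d))}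
  {K K' : (Fin d → ℤ) → (Fin d → ℤ) → (H →L[ℂ] H)} {ψ : H}

/-- Antisymmetry gives σ(p, p) = 0, so only σ(p, τ(p) - p) is left. -/
theorem IsNear.abs_bilin_le {δ : ℝ} {τ : EuclideanSpace ℝ (Fin d) → EuclideanSpace ℝ (Fin d)}
    (hτ : IsNear δ τ) (hσ : ∀ p q, σ q p = -σ p q) {c : ℝ} (hc0 : 0 ≤ c)
    (hc : ∀ p x, |σ p x| ≤ c * ‖p‖ * ‖x‖) {m : Fin d → ℤ} {p : EuclideanSpace ℝ (Fin d)}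
    (hp : p ∈ cell m) : |σ p (τ p)| ≤ c * ((1 + d) * wt m) * δ := by
  have e : σ p (τ p) = σ p (τ p - p) := by
    have := hσ p p
    rw [map_sub]
    linarith
  rw [e]
  refine (hc _ _).trans ?_
  have := norm_le_of_mem_cell hp
  have := hτ.dist_le p
  have := wt_pos m
  gcongr

namespace SpectralMeasure

theorem RapidMat.of_norm_le (h : E.RapidMat K) (hl : ∀ m n, E.block m * K' m n = K' m n)
    (hr : ∀ m n, K' m n * E.block n = K' m n) {C : ℝ} (hC : 0 ≤ C)
    (hn : ∀ m n, ‖K' m n‖ ≤ C * ‖K m n‖) : E.RapidMat K' := by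
  refine ⟨hl, hr, ?_⟩
  obtain ⟨a, ha⟩ := h.bound
  refine ⟨a, fun k => ?_⟩
  obtain ⟨D, hD⟩ := ha k
  refine ⟨C * D, fun m n => ?_⟩
  calc wt (m - n) ^ k * ‖K' m n‖ ≤ wt (m - n) ^ k * (C * ‖K m n‖) :=
        mul_le_mul_of_nonneg_left (hn m n) (pow_nonneg (wt_pos _).le _)
    _ = C * (wt (m - n) ^ k * ‖K m n‖) := by ring
    _ ≤ C * (D * wt n ^ a) := mul_le_mul_of_nonneg_left (hD m n) hC
    _ = _ := by ring

variable (E σ K) in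
/-- The matrix of a warped convolution. -/
def warpMat (m n : Fin d → ℤ) : H →L[ℂ] H := E.warpMap σ (fun p => p) (fun q => q) m n (K m n)

theorem RapidMat.warpMat (h : E.RapidMat K) : E.RapidMat (E.warpMat σ K) := by
  obtain ⟨C, hC0, hC⟩ := E.exists_warpMap_bounds σ
  refine h.of_norm_le (fun m n => ?_) (fun m n => ?_) hC0 fun m n =>
    (hC m n (K m n) (h.block_mul m n) (h.mul_block m n) _ _ (IsNear.id zero_le_one)
      (IsNear.id zero_le_one)).1
  · rw [SpectralMeasure.warpMat, E.block_mul_warpMap CellBdd.id, h.block_mul]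
  · rw [SpectralMeasure.warpMat, E.warpMap_mul_block CellBdd.id, h.mul_block]

variable (E σ K) in
/-- The matrix of the Riemann sum for a warped convolution whose tags are given by `τ`. -/
def riemannMat (τ : EuclideanSpace ℝ (Fin d) → EuclideanSpace ℝ (Fin d)) (m n : Fin d → ℤ) :
    H →L[ℂ] H :=
  E.fc (fun p => Complex.exp (Complex.I * (σ p (τ p) : ℂ))) *
    E.warpMap σ τ (fun q => q) m n (K m n)

theorem RapidMat.riemannMat (h : E.RapidMat K)
    {τ : EuclideanSpace ℝ (Fin d) → EuclideanSpace ℝ (Fin d)} (hτ : IsNear 1 τ) :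
    E.RapidMat (E.riemannMat σ K τ) := by
  obtain ⟨C, hC0, hC⟩ := E.exists_warpMap_bounds σ
  have hm := measurable_bilin_comp σ measurable_id' hτ.measurable
  refine h.of_norm_le (fun m n => ?_) (fun m n => ?_) hC0 fun m n => ?_
  · rw [SpectralMeasure.riemannMat, ← mul_assoc, block,
      ← (E.fc_comm_proj (isBddMeas_cexp_I_mul hm) (measurableSet_cell m)).eq, mul_assoc]
    change _ * (E.block m * _) = _
    rw [E.block_mul_warpMap hτ.cellBdd, h.block_mul]
  · rw [SpectralMeasure.riemannMat, mul_assoc, E.warpMap_mul_block CellBdd.id, h.mul_block]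
  · exact (norm_mul_le _ _).trans ((mul_le_of_le_one_left (norm_nonneg _)
      (E.norm_fc_cexp_I_le hm)).trans (hC m n (K m n) (h.block_mul m n) (h.mul_block m n) _ _
        hτ (IsNear.id zero_le_one)).1)

/-- There are two errors: the phase σ(p, τ(p)), small by antisymmetry at the cost of a factor `wt
m`, and τ(p) in place of p in the multiplier, at the cost of a factor `wt n`. -/
theorem RapidMat.exists_norm_riemannMat_sub_le (h : E.RapidMat K) (hσ : ∀ p q, σ q p = -σ p q) :
    ∃ C, 0 ≤ C ∧ ∀ δ, 0 ≤ δ → δ ≤ 1 → ∀ τ, IsNear δ τ → ∀ m n,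
      ‖E.riemannMat σ K τ m n - E.warpMat σ K m n‖ ≤ C * δ * (wt m * wt n * ‖K m n‖) := by
  obtain ⟨C, hC0, hC⟩ := E.exists_warpMap_bounds σ
  obtain ⟨c, hc0, hc⟩ := exists_bilin_bound σ
  refine ⟨c * (1 + d) * C + C, by positivity, fun δ hδ hδ1 τ hτ m n => ?_⟩
  obtain ⟨h1, h2, -⟩ := hC m n (K m n) (h.block_mul m n) (h.mul_block m n) _ _
    (hτ.mono hδ1) (IsNear.id zero_le_one)
  have h2 := h2 δ hδ hδ1 hτ
  have hm := measurable_bilin_comp σ measurable_id' hτ.measurable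
  have hwm := one_le_wt m
  have hwn := one_le_wt n
  have h3 := E.norm_fc_cexp_I_mul_sub_le (m := m) hm (M := c * ((1 + d) * wt m) * δ) (by positivity)
    (fun p hp => hτ.abs_bilin_le hσ hc0 hc hp)
    (X := E.warpMap σ τ (fun q => q) m n (K m n))
    (by rw [E.block_mul_warpMap hτ.cellBdd, h.block_mul])
  refine (norm_sub_le_norm_sub_add_norm_sub _ (E.warpMap σ τ (fun q => q) m n (K m n)) _).trans ?_
  have h4 : c * ((1 + d) * wt m) * δ * ‖E.warpMap σ τ (fun q => q) m n (K m n)‖ ≤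
      c * (1 + d) * C * δ * (wt m * wt n * ‖K m n‖) := by
    calc _ ≤ c * ((1 + d) * wt m) * δ * (C * ‖K m n‖) := by gcongr
      _ = c * (1 + d) * C * δ * (wt m * 1 * ‖K m n‖) := by ring
      _ ≤ _ := by gcongr
  have h5 : C * δ * wt n * ‖K m n‖ ≤ C * δ * (wt m * wt n * ‖K m n‖) := by
    calc _ = C * δ * (1 * wt n * ‖K m n‖) := by ring
      _ ≤ _ := by gcongr
  rw [add_mul (c * (1 + d) * C), add_mul (c * (1 + d) * C * δ)]
  exact add_le_add (h3.trans h4) (h2.trans h5)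

theorem RapidMat.exists_norm_apply_riemannMat_sub_le (h : E.RapidMat K) (hψ : E.Rapid ψ)
    (hσ : ∀ p q, σ q p = -σ p q) :
    ∃ C, 0 ≤ C ∧ ∀ δ, 0 ≤ δ → δ ≤ 1 → ∀ τ, IsNear δ τ →
      ‖apply (E.riemannMat σ K τ) ψ - apply (E.warpMat σ K) ψ‖ ≤ C * δ := by
  obtain ⟨C, hC0, hC⟩ := h.exists_norm_riemannMat_sub_le hσ
  -- One power in each index cancels the weights in the approximation error; 2d are left for
  -- summability.
  obtain ⟨C', hC0', hC'⟩ := h.exists_norm_mul_le hψ (2 * d + 1)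
  set w : (Fin d → ℤ) × (Fin d → ℤ) → ℝ := fun x => (wt x.1 ^ (2 * d))⁻¹ * (wt x.2 ^ (2 * d))⁻¹
  have hw0 : ∀ x, 0 ≤ w x := fun x => mul_nonneg (inv_nonneg.2 (pow_nonneg (wt_pos _).le _))
    (inv_nonneg.2 (pow_nonneg (wt_pos _).le _))
  have hw : Summable w := summable_inv_wt_pow.mul_of_nonneg summable_inv_wt_pow
    (fun n => inv_nonneg.2 (pow_nonneg (wt_pos n).le _))
    fun n => inv_nonneg.2 (pow_nonneg (wt_pos n).le _)
  refine ⟨C * C' * ∑' x, w x, mul_nonneg (mul_nonneg hC0 hC0') (tsum_nonneg hw0),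
    fun δ hδ hδ1 τ hτ => ?_⟩
  have h1 := h.riemannMat (σ := σ) (hτ.mono hδ1)
  have h2 := h.warpMat (σ := σ)
  rw [apply, apply, ← (h1.summable hψ).tsum_sub (h2.summable hψ)]
  have e : C * C' * (∑' x, w x) * δ = ∑' x, C * C' * δ * w x := by
    rw [tsum_mul_left]
    ring
  rw [e]
  refine tsum_of_norm_bounded (hw.mul_left _).hasSum fun x => ?_
  obtain ⟨m, n⟩ := x
  have hm := wt_pos m
  have hn := wt_pos n
  have h3 : (E.riemannMat σ K τ m n) ψ - (E.warpMat σ K m n) ψ =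
      (E.riemannMat σ K τ m n - E.warpMat σ K m n) (E.block n ψ) := by
    rw [← mul_apply_eq_comp, sub_mul, h1.mul_block, h2.mul_block]
    rfl
  simp only [h3]
  calc _ ≤ C * δ * (wt m * wt n * ‖K m n‖) * ‖E.block n ψ‖ :=
        ContinuousLinearMap.le_of_opNorm_le _ (hC δ hδ hδ1 τ hτ m n) _
    _ = C * δ * (wt m * wt n) * (‖K m n‖ * ‖E.block n ψ‖) := by ring
    _ ≤ C * δ * (wt m * wt n) * (C' * ((wt m ^ (2 * d + 1))⁻¹ * (wt n ^ (2 * d + 1))⁻¹)) := by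
        exact mul_le_mul_of_nonneg_left (hC' m n) (by positivity)
    _ = C * C' * δ * ((wt m ^ (2 * d))⁻¹ * (wt n ^ (2 * d))⁻¹) := by
        rw [pow_succ, pow_succ]
        field_simp

theorem proj_mul_fc_cexp_eq {S : Set (EuclideanSpace ℝ (Fin d))} (hS : MeasurableSet S)
    {τ : EuclideanSpace ℝ (Fin d) → EuclideanSpace ℝ (Fin d)} (hτ : Measurable τ)
    {t : EuclideanSpace ℝ (Fin d)} (ht : ∀ p ∈ S, τ p = t) :
    E.proj S * E.fc (fun p => Complex.exp (Complex.I * (σ p (τ p) : ℂ))) =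
      E.proj S * E.trans σ t := by
  have hm := isBddMeas_cexp_I_mul (measurable_bilin_comp σ measurable_id' hτ)
  have hm' := isBddMeas_phase σ t
  rw [← (E.fc_comm_proj hm hS).eq, trans, ← (E.fc_comm_proj hm' hS).eq]
  refine E.fc_mul_proj_congr hm hm' hS fun p hp => ?_
  simp only [phase, ht p hp]

theorem fc_cexp_left_eq_trans (hσ : ∀ p q, σ q p = -σ p q) (t : EuclideanSpace ℝ (Fin d)) :
    E.fc (fun q => Complex.exp (Complex.I * (σ t q : ℂ))) = E.trans σ (-t) := by
  rw [trans]
  congr 1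
  ext q
  rw [phase, map_neg, hσ q t]

/-- On a piece with tag t the symbol is exp(iσ(p, t)) exp(iσ(t, q)), and σ(t, q) = -σ(q, t) makes
this exactly conjugation by `trans σ t`. -/
theorem RapidMat.proj_mul_riemannMat (h : E.RapidMat K) (hσ : ∀ p q, σ q p = -σ p q)
    {S : Set (EuclideanSpace ℝ (Fin d))} (hS : MeasurableSet S)
    {τ : EuclideanSpace ℝ (Fin d) → EuclideanSpace ℝ (Fin d)} (hτ : IsNear 1 τ)
    {t : EuclideanSpace ℝ (Fin d)} (ht : ∀ p ∈ S, τ p = t) (m n : Fin d → ℤ) :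
    E.proj S * E.riemannMat σ K τ m n =
      E.proj S * (E.trans σ t * K m n * E.trans σ (-t)) := by
  have hT : MeasurableSet (S ∩ cell m) := hS.inter (measurableSet_cell m)
  have hTm : S ∩ cell m ⊆ cell m := Set.inter_subset_right
  have htT : ∀ p ∈ S ∩ cell m, τ p = t := fun p hp => ht p hp.1
  have e : E.proj S * E.block m = E.proj (S ∩ cell m) :=
    (E.inter' _ _ hS (measurableSet_cell m)).symm
  have hl : E.block m * (E.trans σ t * K m n * E.trans σ (-t)) =
      E.trans σ t * K m n * E.trans σ (-t) := by
    rw [← mul_assoc, ← mul_assoc, ← (E.trans_comm_block σ t m).eq, mul_assoc (E.trans σ t),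
      h.block_mul]
  rw [← (h.riemannMat hτ).block_mul, ← mul_assoc, e, ← hl, ← mul_assoc, e,
    SpectralMeasure.riemannMat, ← mul_assoc, proj_mul_fc_cexp_eq hT hτ.measurable htT,
    ← (E.trans_comm_proj σ t hT).eq, mul_assoc, E.proj_mul_warpMap hτ.cellBdd CellBdd.id
      (h.mul_block m n) hT hTm htT, fc_cexp_left_eq_trans hσ]
  simp only [← mul_assoc]
  rw [(E.trans_comm_proj σ t hT).eq]

theorem RapidMat.proj_apply_riemannMat (h : E.RapidMat K) (hψ : E.Rapid ψ)
    (hσ : ∀ p q, σ q p = -σ p q)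
    {S : Set (EuclideanSpace ℝ (Fin d))} (hS : MeasurableSet S)
    {τ : EuclideanSpace ℝ (Fin d) → EuclideanSpace ℝ (Fin d)} (hτ : IsNear 1 τ)
    {t : EuclideanSpace ℝ (Fin d)} (ht : ∀ p ∈ S, τ p = t) :
    E.proj S (apply (E.riemannMat σ K τ) ψ) =
      E.proj S (E.trans σ t (apply K (E.trans σ (-t) ψ))) := by
  have hR := h.riemannMat (σ := σ) hτ
  have hψt : E.Rapid (E.trans σ (-t) ψ) := E.rapid_trans hψ (-t)
  have hcomm : ∀ m φ, E.block m (E.proj S φ) = E.proj S (E.block m φ) := fun m φ =>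
    congr($((E.proj_comm (measurableSet_cell m) hS).eq) φ)
  refine E.eq_of_block_eq fun m => ?_
  rw [hcomm, hcomm, hR.block_apply hψ, ← mul_apply_eq_comp (E.block m),
    ← (E.trans_comm_block σ t m).eq, mul_apply_eq_comp, h.block_apply hψt,
    ContinuousLinearMap.map_tsum _ (hR.summable_row hψ m),
    ContinuousLinearMap.map_tsum _ (h.summable_row hψt m),
    ContinuousLinearMap.map_tsum (E.proj S)
      (((E.trans σ t).hasSum (h.summable_row hψt m).hasSum).summable)]
  exact tsum_congr fun n => congr($(h.proj_mul_riemannMat hσ hS hτ ht m n) ψ)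

/-- With τ the tag map, `riemannMat` gives the Riemann sum exactly: its components on the pieces are
the summands. Convergence is then the O(δ) estimate. -/
theorem RapidMat.hasIntegral_warpMat (h : E.RapidMat K) (hψ : E.Rapid ψ)
    (hσ : ∀ p q, σ q p = -σ p q) :
    E.HasIntegral (fun p => E.trans σ p (apply K (E.trans σ (-p) ψ)))
      (apply (E.warpMat σ K) ψ) := by
  intro ε hε
  obtain ⟨C, hC0, hC⟩ := h.exists_norm_apply_riemannMat_sub_le hψ hσ
  have hpos : 0 < ε / (C + 1) := by positivity
  refine ⟨min 1 (ε / (C + 1)), lt_min one_pos hpos, fun Δ t ht => ?_⟩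
  have hδ0 := ht.nonneg
  have hδ1 : min 1 (ε / (C + 1)) ≤ 1 := min_le_left _ _
  refine ⟨apply (E.riemannMat σ K ht.tagMap) ψ, ?_, ?_⟩
  · have := E.hasSum_proj ht.measurable ht.disjoint ht.cover (apply (E.riemannMat σ K ht.tagMap) ψ)
    convert this using 2 with j
    exact (h.proj_apply_riemannMat hψ hσ (ht.measurable j) (ht.isNear.mono hδ1)
      fun p hp => ht.tagMap_eq hp).symm
  · rw [dist_eq_norm]
    refine (hC _ hδ0 hδ1 _ ht.isNear).trans ?_
    calc C * min 1 (ε / (C + 1)) ≤ (C + 1) * (ε / (C + 1)) := by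
          gcongr
          · linarith
          · exact min_le_right _ _
      _ = ε := by field_simp

end SpectralMeasure

end Warping

/-! ### The spectrum carries the whole spectral measure. -/

section Support

variable {d : ℕ} {H : Type*} [NormedAddCommGroup H] [InnerProductSpace ℂ H] [CompleteSpace H]

namespace SpectralMeasure

variable (E : SpectralMeasure d H)

theorem proj_iUnion_eq_zero {S : ℕ → Set (EuclideanSpace ℝ (Fin d))}
    (hS : ∀ j, MeasurableSet (S j)) (h : ∀ j, E.proj (S j) = 0) : E.proj (⋃ j, S j) = 0 := by
  have hm : ∀ j, MeasurableSet (disjointed S j) := fun j => MeasurableSet.disjointed hS j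
  have h0 : ∀ j, E.proj (disjointed S j) = 0 := fun j => by
    rw [← E.proj_mul_of_subset (hm j) (hS j) (disjointed_subset S j), h, mul_zero]
  ext ψ
  have h1 := E.iUnion' (disjointed S) hm (disjoint_disjointed S) ψ
  rw [iUnion_disjointed] at h1
  simp only [h0] at h1
  exact h1.unique hasSum_zero

/-- By the Lindelöf property the complement of the support is a countable union of open null sets.
-/
theorem proj_compl_support : E.proj E.supportᶜ = 0 := by
  obtain ⟨T, hTc, hTs, hT⟩ := TopologicalSpace.isOpen_sUnion_countable
    {S : Set (EuclideanSpace ℝ (Fin d)) | IsOpen S ∧ E.proj S = 0} fun S hS => hS.1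
  have h1 : E.supportᶜ = ⋃₀ T := by
    rw [hT]
    ext p
    simp only [support, Set.mem_compl_iff, Set.mem_ofPred_eq, not_forall, Set.mem_sUnion, ne_eq,
      not_not]
    constructor
    · rintro ⟨S, hS, hp, h0⟩
      exact ⟨S, ⟨hS, h0⟩, hp⟩
    · rintro ⟨S, ⟨hS, h0⟩, hp⟩
      exact ⟨S, hS, hp, h0⟩
  rw [h1]
  rcases T.eq_empty_or_nonempty with rfl | hne
  · rw [Set.sUnion_empty, E.proj_empty]
  · obtain ⟨S, rfl⟩ := hTc.exists_eq_range hne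
    rw [Set.sUnion_range]
    exact E.proj_iUnion_eq_zero (fun j => (hTs ⟨j, rfl⟩).1.measurableSet) fun j => (hTs ⟨j, rfl⟩).2

theorem isOpen_compl_support : IsOpen E.supportᶜ := by
  rw [isOpen_iff_forall_mem_open]
  intro p hp
  simp only [support, Set.mem_compl_iff, Set.mem_ofPred_eq, not_forall, ne_eq, not_not] at hp
  obtain ⟨S, hS, hpS, h0⟩ := hp
  exact ⟨S, fun q hq hq' => hq' S hS hq h0, hS, hpS⟩

/-- Up to null pieces, the tags of a partition can be taken in the support. -/
theorem exists_isTaggedPartition_support {δ : ℝ} (hδ : 0 < δ) :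
    ∃ (Δ : ℕ → Set (EuclideanSpace ℝ (Fin d))) (t : ℕ → EuclideanSpace ℝ (Fin d)),
      IsTaggedPartition δ Δ t ∧ ∀ j, t j ∈ E.support ∨ E.proj (Δ j) = 0 := by
  classical
  obtain ⟨Δ, t, h⟩ := exists_isTaggedPartition d hδ
  refine ⟨Δ, fun j => if hj : (Δ j ∩ E.support).Nonempty then hj.some else t j,
    ⟨h.1, h.2, h.3, h.4, fun j hj => ?_⟩, fun j => ?_⟩
  · by_cases hs : (Δ j ∩ E.support).Nonempty
    · simp only [dif_pos hs]
      exact hs.some_mem.1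
    · simp only [dif_neg hs]
      exact h.tag j hj
  · by_cases hs : (Δ j ∩ E.support).Nonempty
    · simp only [dif_pos hs]
      exact Or.inl hs.some_mem.2
    · right
      have hsub : Δ j ⊆ E.supportᶜ := fun p hp hp' => hs ⟨p, hp, hp'⟩
      rw [← E.proj_mul_of_subset (h.measurable j) E.isOpen_compl_support.measurableSet hsub,
        E.proj_compl_support, mul_zero]

end SpectralMeasure

end Support

/-! ### Products of rapidly decaying matrices. -/

section MatrixProduct

theorem tsum_apply_clm {H : Type*} [NormedAddCommGroup H] [NormedSpace ℂ H] {β : Type*}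
    {f : β → H →L[ℂ] H} (hf : Summable f) (φ : H) : (∑' b, f b) φ = ∑' b, f b φ :=
  (ContinuousLinearMap.map_tsum (ContinuousLinearMap.apply ℂ H φ) hf :)

variable {d : ℕ} {H : Type*} [NormedAddCommGroup H] [InnerProductSpace ℂ H] [CompleteSpace H]
  {E : SpectralMeasure d H} {σ : LinearMap.BilinForm ℝ (EuclideanSpace ℝ (Fin d))}
  {K L : (Fin d → ℤ) → (Fin d → ℤ) → (H →L[ℂ] H)} {ψ : H}

theorem tsum_comm_of_summable {V β γ : Type*} [NormedAddCommGroup V] [CompleteSpace V]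
    {f : β → γ → V} (h : Summable fun y : β × γ => f y.1 y.2) :
    ∑' b, ∑' c, f b c = ∑' c, ∑' b, f b c :=
  Summable.tsum_comm (f := fun c b => f b c) h.prod_symm

namespace SpectralMeasure.RapidMat

/-- A row of K decays in n while a column of L stays bounded, so the sum over the intermediate index
converges absolutely in norm. -/
theorem exists_summable_norm_mul_norm (hK : E.RapidMat K) (hL : E.RapidMat L) (m r : Fin d → ℤ) :
    Summable fun n => ‖K m n‖ * ‖L n r‖ := by
  obtain ⟨C, hC⟩ := hK.exists_row_norm_le m (2 * d)
  obtain ⟨C', hC'⟩ := hL.exists_col_norm_le r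
  refine Summable.of_nonneg_of_le (fun n => by positivity) (fun n => ?_)
    ((summable_inv_wt_pow (d := d)).mul_left C |>.mul_right C')
  exact mul_le_mul (hC n) (hC' n) (norm_nonneg _) ((norm_nonneg _).trans (hC n))

theorem summable_mul_mul (hK : E.RapidMat K) (hL : E.RapidMat L) (T : H →L[ℂ] H)
    (m r : Fin d → ℤ) : Summable fun n => K m n * T * L n r := by
  refine Summable.of_norm_bounded ((hK.exists_summable_norm_mul_norm hL m r).mul_left ‖T‖)
    fun n => ?_
  calc ‖K m n * T * L n r‖ ≤ ‖K m n‖ * ‖T‖ * ‖L n r‖ :=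
        (norm_mul_le _ _).trans (mul_le_mul_of_nonneg_right (norm_mul_le _ _) (norm_nonneg _))
    _ = _ := by ring

theorem summable_mul_mul_apply (hK : E.RapidMat K) (hL : E.RapidMat L) (hψ : E.Rapid ψ)
    {T : H →L[ℂ] H} (hT : ‖T‖ ≤ 1) (m : Fin d → ℤ) :
    Summable fun y : (Fin d → ℤ) × (Fin d → ℤ) => (K m y.1 * T * L y.1 y.2) ψ := by
  obtain ⟨C, hC⟩ := hK.exists_row_norm_le m 0
  refine Summable.of_norm_bounded ((hL.summable_norm hψ).mul_left C) fun y => ?_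
  have h1 : ‖K m y.1 * T‖ ≤ C := by
    refine (norm_mul_le _ _).trans ((mul_le_of_le_one_right (norm_nonneg _) hT).trans ?_)
    simpa using hC y.1
  have h2 : ‖(K m y.1 * T) (L y.1 y.2 ψ)‖ ≤ C * ‖L y.1 y.2 ψ‖ :=
    ContinuousLinearMap.le_of_opNorm_le _ h1 _
  exact h2.trans (mul_le_mul_of_nonneg_left (hL.norm_apply_le _ _ _) ((norm_nonneg _).trans h1))

theorem apply_trans_apply_eq_tsum (hK : E.RapidMat K) (hL : E.RapidMat L) (hψ : E.Rapid ψ)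
    (x : EuclideanSpace ℝ (Fin d)) (m n : Fin d → ℤ) :
    K m n (E.trans σ x (apply L ψ)) = ∑' r, (K m n * E.trans σ x * L n r) ψ := by
  have e : K m n * E.trans σ x = K m n * E.trans σ x * E.block n := by
    rw [mul_assoc, (E.trans_comm_block σ x n).eq, ← mul_assoc, hK.mul_block]
  calc K m n (E.trans σ x (apply L ψ)) = (K m n * E.trans σ x) (apply L ψ) := rfl
    _ = (K m n * E.trans σ x * E.block n) (apply L ψ) := by rw [← e]
    _ = (K m n * E.trans σ x) (∑' r, L n r ψ) := by
      rw [mul_apply_eq_comp (K m n * E.trans σ x), hL.block_apply hψ]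
    _ = _ := ContinuousLinearMap.map_tsum _ (hL.summable_row hψ n)

/-- Absolute convergence allows the intermediate sum to be done first, as a norm-convergent series
of operators. Comparing products of unbounded operators thereby reduces to comparing bounded matrix
entries. -/
theorem block_apply_trans_apply (hK : E.RapidMat K) (hL : E.RapidMat L) (hψ : E.Rapid ψ)
    (x : EuclideanSpace ℝ (Fin d)) (m : Fin d → ℤ) :
    E.block m (apply K (E.trans σ x (apply L ψ))) =
      ∑' r, (∑' n, K m n * E.trans σ x * L n r) ψ := by
  have hs := hK.summable_mul_mul_apply hL hψ (E.norm_trans_le σ x) m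
  calc E.block m (apply K (E.trans σ x (apply L ψ)))
      = ∑' n, K m n (E.trans σ x (apply L ψ)) :=
        hK.block_apply (E.rapid_trans (hL.rapid_apply hψ) x) m
    _ = ∑' n, ∑' r, (K m n * E.trans σ x * L n r) ψ :=
        tsum_congr fun n => hK.apply_trans_apply_eq_tsum hL hψ x m n
    _ = ∑' r, ∑' n, (K m n * E.trans σ x * L n r) ψ :=
        tsum_comm_of_summable (f := fun n r => (K m n * E.trans σ x * L n r) ψ) hs
    _ = ∑' r, (∑' n, K m n * E.trans σ x * L n r) ψ := tsum_congr fun r => (tsum_apply_clm (hK.summable_mul_mul hL (E.trans σ x) m r) ψ).symm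

theorem block_apply_trans_apply_block (hK : E.RapidMat K) (hL : E.RapidMat L)
    (x : EuclideanSpace ℝ (Fin d)) (m r : Fin d → ℤ) (φ : H) :
    E.block m (apply K (E.trans σ x (apply L (E.block r φ)))) =
      (∑' n, K m n * E.trans σ x * L n r) φ := by
  rw [hK.block_apply_trans_apply hL (rapid_block r φ)]
  have h : ∀ r', (∑' n, K m n * E.trans σ x * L n r') (E.block r φ) =
      (∑' n, K m n * E.trans σ x * L n r' * E.block r) φ := fun r' => by
    rw [(hK.summable_mul_mul hL (E.trans σ x) m r').tsum_mul_right]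
    rfl
  rw [tsum_eq_single r, h]
  · simp only [mul_assoc, hL.mul_block]
  · intro r' hr
    rw [h]
    have : ∀ n, K m n * E.trans σ x * L n r' * E.block r = 0 := fun n => by
      rw [← hL.mul_block, mul_assoc, mul_assoc (L n r'), E.block_mul_of_ne hr, mul_zero, mul_zero]
    simp [this]

end SpectralMeasure.RapidMat

end MatrixProduct

/-! ### Tagged products, the twist, and the commutation of warped matrices. -/

section Commutation

open Filter Topology

variable {d : ℕ} {H : Type*} [NormedAddCommGroup H] [InnerProductSpace ℂ H] [CompleteSpace H]
  {E : SpectralMeasure d H} {σ : LinearMap.BilinForm ℝ (EuclideanSpace ℝ (Fin d))}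
  {K L : (Fin d → ℤ) → (Fin d → ℤ) → (H →L[ℂ] H)} {m n r : Fin d → ℤ}

namespace SpectralMeasure

section Limits

variable {f g : ℕ → EuclideanSpace ℝ (Fin d) → EuclideanSpace ℝ (Fin d)} {X : ℕ → (H →L[ℂ] H)}
  {Y : H →L[ℂ] H}

theorem one_div_add_one_le_one (N : ℕ) : 1 / ((N : ℝ) + 1) ≤ 1 := by
  rw [div_le_one (by positivity)]
  linarith [(Nat.cast_nonneg N : (0 : ℝ) ≤ N)]

/-- With the cubes fixed, the weights in `exists_warpMap_bounds` are constants, so the O(δ)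
estimates give norm convergence. -/
theorem tendsto_warpMap (hf : ∀ N : ℕ, IsNear (1 / ((N : ℝ) + 1)) (f N))
    (hg : ∀ N : ℕ, IsNear (1 / ((N : ℝ) + 1)) (g N)) (hX : ∀ N, E.block m * X N = X N)
    (hX' : ∀ N, X N * E.block n = X N) (hY : E.block m * Y = Y) (hY' : Y * E.block n = Y)
    (h : Tendsto X atTop (𝓝 Y)) :
    Tendsto (fun N => E.warpMap σ (f N) (g N) m n (X N)) atTop
      (𝓝 (E.warpMap σ (fun p => p) (fun q => q) m n Y)) := by
  obtain ⟨C, hC0, hC⟩ := E.exists_warpMap_bounds σ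
  have hδ := tendsto_one_div_add_atTop_nhds_zero_nat (𝕜 := ℝ)
  rw [tendsto_iff_norm_sub_tendsto_zero] at h ⊢
  have hlim : Tendsto (fun N : ℕ => C * ‖X N - Y‖ + (C * (1 / ((N : ℝ) + 1)) * wt n * ‖Y‖ +
      C * (1 / ((N : ℝ) + 1)) * wt m * ‖Y‖)) atTop (𝓝 0) := by
    have := (h.const_mul C).add ((((hδ.const_mul C).mul_const (wt n)).mul_const ‖Y‖).add
      (((hδ.const_mul C).mul_const (wt m)).mul_const ‖Y‖))
    simpa using this
  refine squeeze_zero (fun N => norm_nonneg _) (fun N => ?_) hlim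
  have hN0 : 0 ≤ 1 / ((N : ℝ) + 1) := by positivity
  have hN1 := one_div_add_one_le_one N
  have hf1 := (hf N).mono hN1
  have hg1 := (hg N).mono hN1
  have h1 := (hC m n (X N - Y) (by rw [mul_sub, hX, hY]) (by rw [sub_mul, hX', hY']) _ _ hf1 hg1).1
  have h2 := (hC m n Y hY hY' _ _ hf1 hg1).2.1 _ hN0 hN1 (hf N)
  have h3 := (hC m n Y hY hY' _ _ (IsNear.id zero_le_one) hg1).2.2 _ hN0 hN1 (hg N)
  rw [map_sub] at h1
  refine (norm_sub_le_norm_sub_add_norm_sub _ (E.warpMap σ (f N) (g N) m n Y) _).trans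
    (add_le_add h1 ?_)
  exact (norm_sub_le_norm_sub_add_norm_sub _ (E.warpMap σ (fun p => p) (g N) m n Y) _).trans
    (add_le_add h2 h3)

theorem tendsto_of_norm_sub_le {Z : ℕ → (H →L[ℂ] H)} (h : Tendsto X atTop (𝓝 Y)) {C : ℝ}
    (hZ : ∀ N : ℕ, ‖Z N - X N‖ ≤ C * (1 / ((N : ℝ) + 1)) * ‖X N‖) : Tendsto Z atTop (𝓝 Y) := by
  have hδ := tendsto_one_div_add_atTop_nhds_zero_nat (𝕜 := ℝ)
  have hlim : Tendsto (fun N : ℕ => C * (1 / ((N : ℝ) + 1)) * ‖X N‖) atTop (𝓝 0) := by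
    simpa using (hδ.const_mul C).mul h.norm
  have h1 : Tendsto (fun N => Z N - X N) atTop (𝓝 0) := squeeze_zero_norm hZ hlim
  simpa using h1.add h

theorem tendsto_fc_cexp_mul (hσ : ∀ p q, σ q p = -σ p q)
    (hf : ∀ N : ℕ, IsNear (1 / ((N : ℝ) + 1)) (f N)) (hX : ∀ N, E.block m * X N = X N)
    (h : Tendsto X atTop (𝓝 Y)) :
    Tendsto (fun N => E.fc (fun p => Complex.exp (Complex.I * (σ p (f N p) : ℂ))) * X N) atTop
      (𝓝 Y) := by
  obtain ⟨c, hc0, hc⟩ := exists_bilin_bound σ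
  have hm := wt_pos m
  exact tendsto_of_norm_sub_le h fun N => E.norm_fc_cexp_I_mul_sub_le
    (measurable_bilin_comp σ measurable_id' (hf N).measurable) (by positivity)
    (fun p hp => (hf N).abs_bilin_le hσ hc0 hc hp) (hX N)

theorem tendsto_mul_fc_cexp (hσ : ∀ p q, σ q p = -σ p q)
    (hf : ∀ N : ℕ, IsNear (1 / ((N : ℝ) + 1)) (f N)) (hX : ∀ N, X N * E.block n = X N)
    (h : Tendsto X atTop (𝓝 Y)) :
    Tendsto (fun N => X N * E.fc (fun p => Complex.exp (Complex.I * (σ p (f N p) : ℂ)))) atTop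
      (𝓝 Y) := by
  obtain ⟨c, hc0, hc⟩ := exists_bilin_bound σ
  have hm := wt_pos n
  exact tendsto_of_norm_sub_le h fun N => E.norm_mul_fc_cexp_I_sub_le
    (measurable_bilin_comp σ measurable_id' (hf N).measurable) (by positivity)
    (fun p hp => (hf N).abs_bilin_le hσ hc0 hc hp) (hX N)

end Limits

variable {τ : EuclideanSpace ℝ (Fin d) → EuclideanSpace ℝ (Fin d)}
  {S T : Set (EuclideanSpace ℝ (Fin d))} {s t : EuclideanSpace ℝ (Fin d)} {X : H →L[ℂ] H}

theorem trans_neg_left (x : EuclideanSpace ℝ (Fin d)) : E.trans (-σ) x = E.trans σ (-x) := by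
  rw [trans, trans]
  congr 1
  ext p
  simp [phase]

theorem proj_mul_warpMap_eq (hσ : ∀ p q, σ q p = -σ p q) (hX : E.block m * X = X)
    (hX' : X * E.block n = X) (hS : MeasurableSet S) (hτ : IsNear 1 τ) (hs : ∀ p ∈ S, τ p = s) :
    E.proj S * E.warpMap σ τ (fun q => q) m n X = E.proj S * X * E.trans σ (-s) := by
  have hT : MeasurableSet (S ∩ cell m) := hS.inter (measurableSet_cell m)
  have e : E.proj S * E.block m = E.proj (S ∩ cell m) :=
    (E.inter' _ _ hS (measurableSet_cell m)).symm
  have h := E.proj_mul_warpMap (σ := σ) hτ.cellBdd CellBdd.id hX' hT Set.inter_subset_right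
    fun p hp => hs p hp.1
  rw [fc_cexp_left_eq_trans hσ, ← e, mul_assoc, E.block_mul_warpMap hτ.cellBdd, hX,
    mul_assoc (E.proj S), hX] at h
  exact h

theorem warpMap_mul_proj_eq (hX : E.block m * X = X)
    (hX' : X * E.block n = X) (hT : MeasurableSet T) (hτ : IsNear 1 τ) (ht : ∀ p ∈ T, τ p = t) :
    E.warpMap σ (fun p => p) τ m n X * E.proj T = E.trans σ t * X * E.proj T := by
  have hT' : MeasurableSet (T ∩ cell n) := hT.inter (measurableSet_cell n)
  have e : E.block n * E.proj T = E.proj (T ∩ cell n) := by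
    rw [Set.inter_comm]
    exact (E.inter' _ _ (measurableSet_cell n) hT).symm
  have h := E.warpMap_mul_proj (σ := σ) CellBdd.id hτ.cellBdd hX hT' Set.inter_subset_right
    fun p hp => ht p hp.1
  rw [← e, ← mul_assoc, E.warpMap_mul_block hτ.cellBdd, hX', ← mul_assoc,
    mul_assoc (E.fc _), hX'] at h
  exact h

variable (E σ m r) in
/-- The double operator integral with symbol `exp (-i σ(p + q, τ(p) + τ(q)))`, up to null sets. -/
def twistMap (τ : EuclideanSpace ℝ (Fin d) → EuclideanSpace ℝ (Fin d)) (X : H →L[ℂ] H) :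
    H →L[ℂ] H :=
  E.fc (fun p => Complex.exp (Complex.I * ((-σ) p (τ p) : ℂ))) *
    E.warpMap σ τ (fun q => q) m r (E.warpMap (-σ) (fun p => p) τ m r X) *
    E.fc (fun p => Complex.exp (Complex.I * ((-σ) p (τ p) : ℂ)))

/-- The four factors contribute exp(-iσ(p, s)), exp(-iσ(q, s)), exp(-iσ(p, t)) and exp(-iσ(q, t)),
where antisymmetry has been used in the second. Those in p form the left unitary, those in q the
right one. -/
theorem proj_mul_twistMap_mul_proj (hσ : ∀ p q, σ q p = -σ p q) (hX : E.block m * X = X)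
    (hX' : X * E.block r = X) (hS : MeasurableSet S) (hT : MeasurableSet T) (hτ : IsNear 1 τ)
    (hs : ∀ p ∈ S, τ p = s) (ht : ∀ p ∈ T, τ p = t) :
    E.proj S * E.twistMap σ m r τ X * E.proj T =
      E.proj S * (E.trans σ (-(s + t)) * X * E.trans σ (-(s + t))) * E.proj T := by
  set Y := E.warpMap (-σ) (fun p => p) τ m r X with hYdef
  have hY : E.block m * Y = Y := by rw [hYdef, E.block_mul_warpMap CellBdd.id, hX]
  have hY' : Y * E.block r = Y := by rw [hYdef, E.warpMap_mul_block hτ.cellBdd, hX']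
  have hu := isBddMeas_cexp_I_mul (measurable_bilin_comp (-σ) measurable_id' hτ.measurable)
  have h1 := proj_mul_fc_cexp_eq (E := E) (σ := -σ) hS hτ.measurable hs
  have h2 := proj_mul_fc_cexp_eq (E := E) (σ := -σ) hT hτ.measurable ht
  rw [← (E.fc_comm_proj hu hT).eq, ← (E.trans_comm_proj (-σ) t hT).eq] at h2
  have h3 := proj_mul_warpMap_eq hσ hY hY' hS hτ hs
  have h4 : Y * E.proj T = _ := warpMap_mul_proj_eq (σ := -σ) hX hX' hT hτ ht
  rw [trans_neg_left] at h1 h2 h4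
  have hcS := fun x => (E.trans_comm_proj σ x hS).eq
  have hcT := fun x => (E.trans_comm_proj σ x hT).eq
  rw [twistMap, ← hYdef, ← mul_assoc, ← mul_assoc, h1, mul_assoc _ (E.fc _), h2, ← hcS,
    mul_assoc _ (E.proj S), h3, hcT, neg_add, E.trans_add]
  calc E.trans σ (-s) * (E.proj S * Y * E.trans σ (-s)) * (E.proj T * E.trans σ (-t))
      = E.trans σ (-s) * E.proj S * Y * (E.trans σ (-s) * E.proj T) * E.trans σ (-t) := by
        simp only [mul_assoc]
    _ = E.trans σ (-s) * E.proj S * (Y * E.proj T) * E.trans σ (-s) * E.trans σ (-t) := by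
        rw [hcT]
        simp only [mul_assoc]
    _ = E.trans σ (-s) * E.proj S * (E.trans σ (-t) * X) * (E.proj T * E.trans σ (-s)) *
          E.trans σ (-t) := by
        rw [h4]
        simp only [mul_assoc]
    _ = E.proj S * (E.trans σ (-s) * E.trans σ (-t) * X) * E.trans σ (-s) *
          (E.proj T * E.trans σ (-t)) := by
        rw [hcS, ← hcT]
        simp only [mul_assoc]
    _ = _ := by
        rw [← hcT]
        simp only [mul_assoc]

/-- As the tags approach the identity the two outer phases tend to exp(-iσ(p, p)) = 1, and the two
multipliers in between become inverse to each other. -/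
theorem tendsto_twistMap (hσ : ∀ p q, σ q p = -σ p q)
    {f : ℕ → EuclideanSpace ℝ (Fin d) → EuclideanSpace ℝ (Fin d)}
    (hf : ∀ N : ℕ, IsNear (1 / ((N : ℝ) + 1)) (f N)) {X : ℕ → (H →L[ℂ] H)} {Y : H →L[ℂ] H}
    (hX : ∀ N, E.block m * X N = X N) (hX' : ∀ N, X N * E.block r = X N) (hY : E.block m * Y = Y)
    (hY' : Y * E.block r = Y) (h : Tendsto X atTop (𝓝 Y)) :
    Tendsto (fun N => E.twistMap σ m r (f N) (X N)) atTop (𝓝 Y) := by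
  have hid : ∀ N : ℕ, IsNear (1 / ((N : ℝ) + 1)) fun p : EuclideanSpace ℝ (Fin d) => p :=
    fun N => IsNear.id (by positivity)
  have hσ' : ∀ p q, (-σ) q p = -(-σ) p q := fun p q => by simp [hσ p q]
  have h1 := tendsto_warpMap (σ := -σ) hid hf hX hX' hY hY' h
  have hl : ∀ N, E.block m * E.warpMap (-σ) (fun p => p) (f N) m r (X N) =
      E.warpMap (-σ) (fun p => p) (f N) m r (X N) := fun N => by
    rw [E.block_mul_warpMap CellBdd.id, hX]
  have hr : ∀ N, E.warpMap (-σ) (fun p => p) (f N) m r (X N) * E.block r =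
      E.warpMap (-σ) (fun p => p) (f N) m r (X N) := fun N => by
    rw [E.warpMap_mul_block (hf N).cellBdd, hX']
  have h2 := tendsto_warpMap (σ := σ) hf hid hl hr
    (by rw [E.block_mul_warpMap CellBdd.id, hY]) (by rw [E.warpMap_mul_block CellBdd.id, hY']) h1
  rw [← mul_apply_eq_comp, E.warpMap_neg_mul_warpMap CellBdd.id CellBdd.id,
    one_apply_eq_self] at h2
  have h3 := tendsto_fc_cexp_mul hσ' hf
    (fun N => by rw [E.block_mul_warpMap (hf N).cellBdd, hl]) h2
  refine tendsto_mul_fc_cexp (n := r) hσ' hf (fun N => ?_) h3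
  rw [mul_assoc, E.warpMap_mul_block CellBdd.id, hr]

variable (E σ K L) in
/-- The matrix of the product of two warped Riemann sums, one of them with factors reversed. -/
def riemannProd (τ : EuclideanSpace ℝ (Fin d) → EuclideanSpace ℝ (Fin d)) (m r : Fin d → ℤ) :
    H →L[ℂ] H :=
  ∑' n, E.warpMap σ τ (fun q => q) m n (K m n) * E.warpMap (-σ) (fun p => p) τ n r (L n r)

namespace RapidMat

theorem exists_norm_warpMap_mul_warpMap_le (hK : E.RapidMat K) (hL : E.RapidMat L) :
    ∃ C, ∀ τ, IsNear 1 τ → ∀ m n r,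
      ‖E.warpMap σ τ (fun q => q) m n (K m n) * E.warpMap (-σ) (fun p => p) τ n r (L n r)‖ ≤
        C * (‖K m n‖ * ‖L n r‖) := by
  obtain ⟨C, hC0, hC⟩ := E.exists_warpMap_bounds σ
  obtain ⟨C', hC0', hC'⟩ := E.exists_warpMap_bounds (-σ)
  refine ⟨C * C', fun τ hτ m n r => ?_⟩
  have h1 := (hC m n _ (hK.block_mul m n) (hK.mul_block m n) _ _ hτ (IsNear.id zero_le_one)).1
  have h2 := (hC' n r _ (hL.block_mul n r) (hL.mul_block n r) _ _ (IsNear.id zero_le_one) hτ).1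
  calc _ ≤ _ := norm_mul_le _ _
    _ ≤ C * ‖K m n‖ * (C' * ‖L n r‖) := by gcongr
    _ = _ := by ring

theorem summable_riemannProd (hK : E.RapidMat K) (hL : E.RapidMat L) (hτ : IsNear 1 τ) :
    Summable fun n =>
      E.warpMap σ τ (fun q => q) m n (K m n) * E.warpMap (-σ) (fun p => p) τ n r (L n r) := by
  obtain ⟨C, hC⟩ := hK.exists_norm_warpMap_mul_warpMap_le (σ := σ) hL
  exact Summable.of_norm_bounded ((hK.exists_summable_norm_mul_norm hL m r).mul_left C)
    fun n => hC τ hτ m n r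

theorem block_mul_riemannProd (hK : E.RapidMat K) (hL : E.RapidMat L) (hτ : IsNear 1 τ) :
    E.block m * E.riemannProd σ K L τ m r = E.riemannProd σ K L τ m r := by
  rw [riemannProd, ← (hK.summable_riemannProd hL hτ).tsum_mul_left]
  refine tsum_congr fun n => ?_
  rw [← mul_assoc, E.block_mul_warpMap hτ.cellBdd, hK.block_mul]

theorem riemannProd_mul_block (hK : E.RapidMat K) (hL : E.RapidMat L) (hτ : IsNear 1 τ) :
    E.riemannProd σ K L τ m r * E.block r = E.riemannProd σ K L τ m r := by
  rw [riemannProd, ← (hK.summable_riemannProd hL hτ).tsum_mul_right]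
  refine tsum_congr fun n => ?_
  rw [mul_assoc, E.warpMap_mul_block hτ.cellBdd, hL.mul_block]

/-- Only the outer variables are tagged. For tags s and t both multipliers act on the intermediate
variable as unitaries, which merge into a single `trans σ (-(s + t))` between K and L. -/
theorem proj_mul_riemannProd_mul_proj (hK : E.RapidMat K) (hL : E.RapidMat L)
    (hσ : ∀ p q, σ q p = -σ p q) (hτ : IsNear 1 τ) (hS : MeasurableSet S) (hT : MeasurableSet T)
    (hs : ∀ p ∈ S, τ p = s) (ht : ∀ p ∈ T, τ p = t) :
    E.proj S * E.riemannProd σ K L τ m r * E.proj T =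
      E.proj S * (∑' n, K m n * E.trans σ (-(s + t)) * L n r) * E.proj T := by
  have h1 := hK.summable_riemannProd (σ := σ) (m := m) (r := r) hL hτ
  have h2 := hK.summable_mul_mul hL (E.trans σ (-(s + t))) m r
  rw [riemannProd, ← h1.tsum_mul_left, ← h2.tsum_mul_left, ← (h1.mul_left _).tsum_mul_right,
    ← (h2.mul_left _).tsum_mul_right]
  refine tsum_congr fun n => ?_
  rw [← mul_assoc, proj_mul_warpMap_eq hσ (hK.block_mul m n) (hK.mul_block m n) hS hτ hs,
    mul_assoc _ (E.warpMap _ _ _ _ _ _),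
    warpMap_mul_proj_eq (hL.block_mul n r) (hL.mul_block n r) hT hτ ht, trans_neg_left, neg_add,
    E.trans_add]
  simp only [mul_assoc]

/-- Dominated convergence in the intermediate index: the multipliers are bounded uniformly in the
cubes and the tags, so the norms of the entries dominate. -/
theorem tendsto_riemannProd (hK : E.RapidMat K) (hL : E.RapidMat L)
    {f : ℕ → EuclideanSpace ℝ (Fin d) → EuclideanSpace ℝ (Fin d)}
    (hf : ∀ N : ℕ, IsNear (1 / ((N : ℝ) + 1)) (f N)) (m r : Fin d → ℤ) :
    Tendsto (fun N => E.riemannProd σ K L (f N) m r) atTop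
      (𝓝 (∑' n, E.warpMat σ K m n * E.warpMat (-σ) L n r)) := by
  obtain ⟨C, hC⟩ := hK.exists_norm_warpMap_mul_warpMap_le (σ := σ) hL
  have hid : ∀ N : ℕ, IsNear (1 / ((N : ℝ) + 1)) fun p : EuclideanSpace ℝ (Fin d) => p :=
    fun N => IsNear.id (by positivity)
  refine tendsto_tsum_of_dominated_convergence
    ((hK.exists_summable_norm_mul_norm hL m r).mul_left C) (fun n => ?_)
    (Eventually.of_forall fun N n => hC _ ((hf N).mono (one_div_add_one_le_one N)) m n r)
  exact (tendsto_warpMap hf hid (fun _ => hK.block_mul m n) (fun _ => hK.mul_block m n)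
    (hK.block_mul m n) (hK.mul_block m n) tendsto_const_nhds).mul
    (tendsto_warpMap hid hf (fun _ => hL.block_mul n r) (fun _ => hL.mul_block n r)
    (hL.block_mul n r) (hL.mul_block n r) tendsto_const_nhds)

/-- Tested between two pieces of the partition, either one of them is null or both tags lie in the
support. In the latter case the claim is `hKL` at these tags, with its unitaries reproduced by the
twist. -/
theorem riemannProd_eq_twistMap (hK : E.RapidMat K) (hL : E.RapidMat L)
    (hσ : ∀ p q, σ q p = -σ p q) {δ : ℝ} (hδ : δ ≤ 1) {Δ : ℕ → Set (EuclideanSpace ℝ (Fin d))}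
    {t : ℕ → EuclideanSpace ℝ (Fin d)} (h : IsTaggedPartition δ Δ t)
    (ht : ∀ j, t j ∈ E.support ∨ E.proj (Δ j) = 0)
    (hKL : ∀ p ∈ E.support, ∀ q ∈ E.support, ∑' n, K m n * E.trans σ (-(p + q)) * L n r =
      E.trans σ (-(p + q)) * (∑' n, L m n * E.trans σ (p + q) * K n r) *
        E.trans σ (-(p + q))) :
    E.riemannProd σ K L h.tagMap m r =
      E.twistMap σ m r h.tagMap (E.riemannProd (-σ) L K h.tagMap m r) := by
  have hτ := h.isNear.mono hδ
  have hσ' : ∀ p q, (-σ) q p = -(-σ) p q := fun p q => by simp [hσ p q]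
  refine E.eq_of_proj_mul_eq h.measurable h.disjoint h.cover fun i => ?_
  refine E.eq_of_mul_proj_eq h.measurable h.disjoint h.cover fun j => ?_
  rcases ht i with hi | hi
  · rcases ht j with hj | hj
    · have e1 := hK.proj_mul_riemannProd_mul_proj (m := m) (r := r) hL hσ hτ (h.measurable i)
        (h.measurable j) (fun p hp => h.tagMap_eq hp) (fun p hp => h.tagMap_eq hp)
      have e2 := hL.proj_mul_riemannProd_mul_proj (m := m) (r := r) hK hσ' hτ (h.measurable i)
        (h.measurable j) (fun p hp => h.tagMap_eq hp) (fun p hp => h.tagMap_eq hp)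
      rw [trans_neg_left, neg_neg] at e2
      rw [e1, proj_mul_twistMap_mul_proj hσ (hL.block_mul_riemannProd hK hτ)
        (hL.riemannProd_mul_block hK hτ) (h.measurable i) (h.measurable j) hτ
        (fun p hp => h.tagMap_eq hp) (fun p hp => h.tagMap_eq hp), hKL _ hi _ hj]
      set V := E.trans σ (-(t i + t j))
      have hcS : V * E.proj (Δ i) = E.proj (Δ i) * V := (E.trans_comm_proj σ _ (h.measurable i)).eq
      have hcT : V * E.proj (Δ j) = E.proj (Δ j) * V := (E.trans_comm_proj σ _ (h.measurable j)).eq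
      have key : ∀ Z : H →L[ℂ] H, E.proj (Δ i) * (V * Z * V) * E.proj (Δ j) =
          V * (E.proj (Δ i) * Z * E.proj (Δ j)) * V := fun Z => by
        calc E.proj (Δ i) * (V * Z * V) * E.proj (Δ j)
            = (E.proj (Δ i) * V) * Z * (V * E.proj (Δ j)) := by simp only [mul_assoc]
          _ = _ := by
            rw [← hcS, hcT]
            simp only [mul_assoc]
      rw [key, key, e2]
    · rw [hj, mul_zero, mul_zero]
  · simp only [hi, zero_mul]

theorem tsum_warpMat_mul_warpMat (hK : E.RapidMat K) (hL : E.RapidMat L)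
    (hσ : ∀ p q, σ q p = -σ p q) (m r : Fin d → ℤ)
    (hKL : ∀ p ∈ E.support, ∀ q ∈ E.support, ∑' n, K m n * E.trans σ (-(p + q)) * L n r =
      E.trans σ (-(p + q)) * (∑' n, L m n * E.trans σ (p + q) * K n r) *
        E.trans σ (-(p + q))) :
    ∑' n, E.warpMat σ K m n * E.warpMat (-σ) L n r =
      ∑' n, E.warpMat (-σ) L m n * E.warpMat σ K n r := by
  choose Δ t h ht using fun N : ℕ =>
    E.exists_isTaggedPartition_support (δ := 1 / ((N : ℝ) + 1)) (by positivity)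
  have hN := one_div_add_one_le_one
  have h1 := hK.tendsto_riemannProd (σ := σ) hL (fun N => (h N).isNear) m r
  have h2 := hL.tendsto_riemannProd (σ := -σ) hK (fun N => (h N).isNear) m r
  rw [show -(-σ) = σ from neg_neg σ] at h2
  have hl : ∀ N, E.block m * E.riemannProd (-σ) L K (h N).tagMap m r =
      E.riemannProd (-σ) L K (h N).tagMap m r := fun N =>
    hL.block_mul_riemannProd hK ((h N).isNear.mono (hN N))
  have hr : ∀ N, E.riemannProd (-σ) L K (h N).tagMap m r * E.block r =
      E.riemannProd (-σ) L K (h N).tagMap m r := fun N =>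
    hL.riemannProd_mul_block hK ((h N).isNear.mono (hN N))
  -- The limit inherits the localisation in the two cubes, which `tendsto_twistMap` requires.
  have hl' := tendsto_nhds_unique (h2.congr fun N => (hl N).symm) (h2.const_mul (E.block m))
  have hr' := tendsto_nhds_unique (h2.congr fun N => (hr N).symm) (h2.mul_const (E.block r))
  have h3 := tendsto_twistMap hσ (fun N => (h N).isNear) hl hr hl'.symm hr'.symm h2
  refine tendsto_nhds_unique h1 (h3.congr fun N => ?_)
  exact (hK.riemannProd_eq_twistMap hL hσ (hN N) (h N) (ht N) hKL).symm

theorem apply_warpMat_apply_warpMat (hK : E.RapidMat K) (hL : E.RapidMat L)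
    (hσ : ∀ p q, σ q p = -σ p q)
    (hKL : ∀ p ∈ E.support, ∀ q ∈ E.support, ∀ ψ, E.Rapid ψ →
      E.trans σ p (apply K (E.trans σ (-p) (E.trans σ (-q) (apply L (E.trans σ q ψ))))) =
      E.trans σ (-q) (apply L (E.trans σ q (E.trans σ p (apply K (E.trans σ (-p) ψ))))))
    {ψ : H} (hψ : E.Rapid ψ) :
    apply (E.warpMat σ K) (apply (E.warpMat (-σ) L) ψ) =
      apply (E.warpMat (-σ) L) (apply (E.warpMat σ K) ψ) := by
  have hK' := hK.warpMat (σ := σ)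
  have hL' := hL.warpMat (σ := -σ)
  refine E.eq_of_block_eq fun m => ?_
  -- The translation by 0 is the identity, so this is the plain product.
  have h1 := hK'.block_apply_trans_apply (σ := σ) hL' hψ 0 m
  have h2 := hL'.block_apply_trans_apply (σ := σ) hK' hψ 0 m
  simp only [E.trans_zero, one_apply_eq_self, mul_one] at h1 h2
  rw [h1, h2]
  refine tsum_congr fun r => ?_
  rw [hK.tsum_warpMat_mul_warpMat hL hσ m r fun p hp q hq => ?_]
  ext φ
  -- Translating the test vector by -q cancels the rightmost unitary of the hypothesis; applying
  -- `trans σ (-p)` below cancels the leftmost one. What remains depends on p + q only.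
  have hφ := E.rapid_trans (B := σ) (rapid_block r φ) (-q)
  have h3 := hKL p hp q hq _ hφ
  have e1 : ∀ v, E.trans σ (-p) (E.trans σ (-q) v) = E.trans σ (-(p + q)) v := fun v => by
    rw [neg_add, E.trans_add, mul_apply_eq_comp]
  have e2 : ∀ v, E.trans σ q (E.trans σ p v) = E.trans σ (p + q) v := fun v => by
    rw [add_comm, E.trans_add, mul_apply_eq_comp]
  have e3 : ∀ v, E.trans σ q (E.trans σ (-q) v) = v := fun v => by
    rw [← mul_apply_eq_comp, E.trans_mul_trans_neg, one_apply_eq_self]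
  have e4 : ∀ v, E.trans σ (-p) (E.trans σ p v) = v := fun v => by
    rw [← mul_apply_eq_comp, E.trans_neg_mul_trans, one_apply_eq_self]
  have h4 := congrArg (E.trans σ (-p)) h3
  rw [e4] at h4
  simp only [e1, e2, e3] at h4
  have e5 : E.trans σ (-(p + q)) (E.block r φ) = E.block r (E.trans σ (-(p + q)) φ) :=
    congr($((E.trans_comm_block σ (-(p + q)) r).eq) φ)
  have h5 := congrArg (E.block m) h4
  rw [e5, ← mul_apply_eq_comp (E.block m), ← (E.trans_comm_block σ (-(p + q)) m).eq,
    mul_apply_eq_comp, hK.block_apply_trans_apply_block hL, hL.block_apply_trans_apply_block hK]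
    at h5
  exact h5

end RapidMat

end SpectralMeasure

end Commutation

/-! ### Translation back to graphs of warped convolutions. -/

section WarpedConvolution

variable {d : ℕ} {H : Type*} [NormedAddCommGroup H] [InnerProductSpace ℂ H] [CompleteSpace H]
  {B : LinearMap.BilinForm ℝ (EuclideanSpace ℝ (Fin d))} {U : UnitaryRep d H}
  {E : SpectralMeasure d H} {Q : EuclideanSpace ℝ (Fin d) →ₗ[ℝ] EuclideanSpace ℝ (Fin d)}
  {F G : H →ₗ.[ℂ] H} {K L : (Fin d → ℤ) → (Fin d → ℤ) → (H →L[ℂ] H)} {ψ : H}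

open SpectralMeasure

/-- The bridge from an abstract antisymmetric form to warping: for σ(p, x) = B(p, Qx) the group
generated by σ is the translation group along Q. -/
theorem SpectralMeasure.trans_compl₂ (x : EuclideanSpace ℝ (Fin d)) :
    E.trans (B.compl₂ Q) x = E.trans B (Q x) := rfl

theorem IsSpectralResolution.mem_warpedConvolution_graph (hE : IsSpectralResolution B U E)
    (hB : B.Nondegenerate) (hs : B.IsSymm) (hQ : ∀ p q, B q (Q p) = -B p (Q q))
    (hK : E.RapidMat K) (hKF : ∀ ψ, E.Rapid ψ → (ψ, apply K ψ) ∈ F.graph) (hψ : E.Rapid ψ) :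
    (ψ, apply (E.warpMat (B.compl₂ Q) K) ψ) ∈ (warpedConvolution U E Q F).graph := by
  rw [warpedConvolution_graph]
  refine ⟨(hE.mem_smoothVectors_iff hB hs).2 hψ, _, fun p => ?_,
    hK.hasIntegral_warpMat (σ := B.compl₂ Q) hψ hQ⟩
  have h := hE.mem_graph_adjointAction hKF (Q p) hψ
  rwa [← map_neg] at h

theorem warpedConvolution_domain_eq
    (h : ∀ ψ ∈ smoothVectors U, ∃ v, (ψ, v) ∈ (warpedConvolution U E Q F).graph) :
    (warpedConvolution U E Q F).domain = smoothVectors U := by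
  refine le_antisymm (fun ψ hψ => ?_) fun ψ hψ => ?_
  · have := (warpedConvolution U E Q F).mem_graph ⟨ψ, hψ⟩
    rw [warpedConvolution_graph] at this
    exact this.1
  · obtain ⟨v, hv⟩ := h ψ hψ
    exact LinearPMap.mem_domain_of_mem_graph hv

/-- Graphs of operators are single-valued, so the vectors supplied by `CommuteOn` must be those
computed from the matrices, which always exist on rapidly decaying vectors. -/
theorem IsSpectralResolution.apply_commute_of_commuteOn (hE : IsSpectralResolution B U E)
    (hB : B.Nondegenerate) (hs : B.IsSymm) (hK : E.RapidMat K)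
    (hKF : ∀ ψ, E.Rapid ψ → (ψ, apply K ψ) ∈ F.graph) (hL : E.RapidMat L)
    (hLG : ∀ ψ, E.Rapid ψ → (ψ, apply L ψ) ∈ G.graph) {x y : EuclideanSpace ℝ (Fin d)}
    (h : CommuteOn (smoothVectors U) (adjointAction U x F) (adjointAction U (-y) G))
    (hψ : E.Rapid ψ) :
    E.trans B x (apply K (E.trans B (-x) (E.trans B (-y) (apply L (E.trans B y ψ))))) =
      E.trans B (-y) (apply L (E.trans B y (E.trans B x (apply K (E.trans B (-x) ψ))))) := by
  obtain ⟨η, ⟨φ, h1, h2⟩, χ, h3, h4⟩ := h ψ ((hE.mem_smoothVectors_iff hB hs).2 hψ)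
  have g1 := hE.mem_graph_adjointAction hLG (-y) hψ
  rw [neg_neg] at g1
  obtain rfl := LinearPMap.mem_graph_snd_inj _ h1 g1 rfl
  have g2 := hE.mem_graph_adjointAction hKF x
    (E.rapid_trans (B := B) (hL.rapid_apply (E.rapid_trans (B := B) hψ y)) (-y))
  have g3 := hE.mem_graph_adjointAction hKF x hψ
  obtain rfl := LinearPMap.mem_graph_snd_inj _ h3 g3 rfl
  have g4 := hE.mem_graph_adjointAction hLG (-y)
    (E.rapid_trans (B := B) (hK.rapid_apply (E.rapid_trans (B := B) hψ (-x))) x)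
  rw [neg_neg] at g4
  exact (LinearPMap.mem_graph_snd_inj _ g2 h2 rfl).trans
    (LinearPMap.mem_graph_snd_inj _ h4 g4 rfl)

end WarpedConvolution

end Warped

end

theorem lemma3 {d : ℕ} (hd : 2 ≤ d) {H : Type*} [NormedAddCommGroup H] [InnerProductSpace ℂ H]
    [CompleteSpace H] [TopologicalSpace.SeparableSpace H]
    (B : LinearMap.BilinForm ℝ (EuclideanSpace ℝ (Fin d))) (hBsymm : B.IsSymm)
    (hBnondeg : B.Nondegenerate)
    (U : Warped.UnitaryRep d H) (E : Warped.SpectralMeasure d H)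
    (hE : Warped.IsSpectralResolution B U E)
    (Q : EuclideanSpace ℝ (Fin d) →ₗ[ℝ] EuclideanSpace ℝ (Fin d))
    (hQ : ∀ p q, B q (Q p) = -B p (Q q))
    (F G : H →ₗ.[ℂ] H) (hF : F ∈ Warped.smoothOperators U E)
    (hG : G ∈ Warped.smoothOperators U E)
    (hFG : ∀ p ∈ E.support, ∀ q ∈ E.support,
      Warped.CommuteOn (Warped.smoothVectors U)
        (Warped.adjointAction U (Q p) F) (Warped.adjointAction U (-(Q q)) G)) :
    (Warped.warpedConvolution U E Q F).domain = Warped.smoothVectors U ∧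
    (Warped.warpedConvolution U E (-Q) G).domain = Warped.smoothVectors U ∧
    Warped.CommuteOn (Warped.smoothVectors U)
      (Warped.warpedConvolution U E Q F) (Warped.warpedConvolution U E (-Q) G) := by
  obtain ⟨K, hK, hKF⟩ := hE.exists_rapidMat hBnondeg hBsymm hF
  obtain ⟨L, hL, hLG⟩ := hE.exists_rapidMat hBnondeg hBsymm hG
  have hQ' : ∀ p q, B q ((-Q) p) = -B p ((-Q) q) := fun p q => by simp [hQ p q]
  -- Warping with -Q is warping with -σ, the form in which the second operator enters the
  -- commutation of matrices.
  have hneg : B.compl₂ (-Q) = -B.compl₂ Q := by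
    ext p q
    simp
  have h1 := fun ψ => hE.mem_warpedConvolution_graph (ψ := ψ) hBnondeg hBsymm hQ hK hKF
  have h2 := fun ψ => hE.mem_warpedConvolution_graph (ψ := ψ) hBnondeg hBsymm hQ' hL hLG
  rw [hneg] at h2
  have hsm := fun ψ => hE.mem_smoothVectors_iff (ψ := ψ) hBnondeg hBsymm
  refine ⟨Warped.warpedConvolution_domain_eq fun ψ hψ => ⟨_, h1 ψ ((hsm ψ).1 hψ)⟩,
    Warped.warpedConvolution_domain_eq fun ψ hψ => ⟨_, h2 ψ ((hsm ψ).1 hψ)⟩, fun ψ hψ => ?_⟩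
  have hψ' := (hsm ψ).1 hψ
  have hcomm := hK.apply_warpMat_apply_warpMat (σ := B.compl₂ Q) hL hQ (fun p hp q hq φ hφ => by
    have h := hE.apply_commute_of_commuteOn hBnondeg hBsymm hK hKF hL hLG (hFG p hp q hq) hφ
    simp only [Warped.SpectralMeasure.trans_compl₂, map_neg]
    exact h) hψ'
  -- Both products are defined because warped matrices map rapidly decaying vectors to rapidly
  -- decaying ones.
  refine ⟨_, ⟨_, h2 ψ hψ', h1 _ (hL.warpMat.rapid_apply hψ')⟩, _, h1 ψ hψ', ?_⟩
  rw [hcomm]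
  exact h2 _ (hK.warpMat.rapid_apply hψ')
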